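/- Let $n\ge 2$ and $0<\theta\le 1$. Consider on $(0,\infty)\times\mathbb{R}^n$ the drift-diffusion problem $$\partial_t u+(-\Delta)^{\theta/2}u-\nabla\cdot(u\nabla\psi)=0,\qquad -\Delta\psi=u,\qquad u(0,\cdot)=u_0,$$ where $(-\Delta)^{\theta/2}\varphi=\mathcal F^{-1}[|\xi|^{\theta}\mathcal F[\varphi]]$ and $$\nabla\psi(t,x)=\nabla(-\Delta)^{-1}u(t,x)=-\frac{\Gamma(n/2)}{2\pi^{n/2}}\int_{\mathbb{R}^n}\frac{x-y}{|x-y|^{n}}\,u(t,y)\,dy .$$ Let $u_0\in L^1_{loc}(\mathbb{R}^n)$ and let the measurable real function $u$ be a weak solution, i.e. for every $\varphi\in C_c^\infty(\mathbb{R}^n)$ and every $t>0$, $$\int_{\mathbb{R}^n} u(t)\varphi\,dx-\int_{\mathbb{R}^n} u_0\varphi\,dx=\int_0^t\Bigl(-\int_{\mathbb{R}^n} u(s)\,(-\Delta)^{\theta/2}\varphi\,dx-\int_{\mathbb{R}^n} u(s)\nabla\psi(s)\cdot\nabla\varphi\,dx\Bigr)ds .$$ Assume that $u(t)\in L^1(\mathbb{R}^n)\cap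 L^\infty(\mathbb{R}^n)$ for every $t>0$ and that, for every $1\le p\le\infty$, there is a constant $C_p$ with $$\|u(t)\|_{L^p(\mathbb{R}^n)}\le C_p(1+t)^{-\frac n\theta(1-\frac1p)}\qquad\text{for all }t>0$$ (in particular $u\in L^\infty(0,\infty;L^1(\mathbb{R}^n)\cap L^\infty(\mathbb{R}^n))$), and that $x\,u_0\in L^{n/(n-1)}(\mathbb{R}^n)$. Then there is a constant $C$ such that $$\|x_j u(t)\|_{L^{n/(n-1)}(\mathbb{R}^n)}\le C\log(e+t)$$ for all $t>0$ and $j=1,\dots,n$. -/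

import Mathlib

open MeasureTheory
open scoped ENNReal

namespace DriftDiffusion

noncomputable section

/-- The fractional Laplacian `(-Δ)^{θ/2} φ = 𝓕⁻¹ [|ξ|^θ 𝓕 φ]` of a real test function. Mathlib's
Fourier transform is `∫ exp (-2πi x·ξ) φ x dx`, so the frequency variable of the usual symbol is
`2πξ`. The result is real because `φ` is real and the symbol is real and even. -/
def fracLaplacian {n : ℕ} (θ : ℝ) (φ : EuclideanSpace ℝ (Fin n) → ℝ) :
    EuclideanSpace ℝ (Fin n) → ℝ := fun x =>
  (FourierTransform.fourierInv
    (fun ξ : EuclideanSpace ℝ (Fin n) =>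
      (((2 * Real.pi * ‖ξ‖) ^ θ : ℝ) : ℂ) *
        FourierTransform.fourier (fun y : EuclideanSpace ℝ (Fin n) => ((φ y : ℝ) : ℂ)) ξ) x).re

/-- The field `∇ψ = ∇(-Δ)⁻¹ v`, where `-Δψ = v` on `ℝⁿ`: the convolution of `v` with the gradient
`-Γ(n/2) / (2 π^{n/2}) · x / |x|ⁿ` of the fundamental solution of `-Δ`. The integral
converges absolutely for `v ∈ L¹ ∩ L^∞`. -/
def gradPotential {n : ℕ} (v : EuclideanSpace ℝ (Fin n) → ℝ) (x : EuclideanSpace ℝ (Fin n)) :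
    EuclideanSpace ℝ (Fin n) :=
  (-(Real.Gamma ((n : ℝ) / 2) / (2 * Real.pi ^ ((n : ℝ) / 2)))) •
    ∫ y, (v y / ‖x - y‖ ^ n) • (x - y)

/-- `u` satisfies, on the time interval `(0, ∞)`, `u ∈ L^∞(0, ∞; L¹ ∩ L^∞)` and
`‖u(t)‖_p ≤ C (1 + t)^{-(n/θ)(1 - 1/p)}` for all `1 ≤ p ≤ ∞`. (The cases `p = 1, ∞` of the second
property give the boundedness in time required by the first.) -/
structure HasDecay {n : ℕ} (θ : ℝ) (u : ℝ → EuclideanSpace ℝ (Fin n) → ℝ) : Prop where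
  aestronglyMeasurable : AEStronglyMeasurable (Function.uncurry u)
    ((volume.restrict (Set.Ioi (0 : ℝ))).prod volume)
  memLp_one : ∀ t : ℝ, 0 < t → MemLp (u t) 1 volume
  memLp_top : ∀ t : ℝ, 0 < t → MemLp (u t) ∞ volume
  decay : ∀ p : ℝ≥0∞, 1 ≤ p → ∃ C : ℝ, ∀ t : ℝ, 0 < t →
    eLpNorm (u t) p volume ≤
      ENNReal.ofReal (C * (1 + t) ^ (-((n : ℝ) / θ) * (1 - (p⁻¹).toReal)))

/-- `u` is a weak (distributional) solution of
`∂ₜu + (-Δ)^{θ/2}u - ∇·(u∇ψ) = 0`, `-Δψ = u`, `u(0) = u₀`, integrated in time from `0` to any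
`t > 0` against test functions of `x`. Meant for `u ∈ L^∞(0, ∞; L¹ ∩ L^∞)`, for which
all the integrals converge absolutely. -/
structure IsWeakSolution {n : ℕ} (θ : ℝ) (u₀ : EuclideanSpace ℝ (Fin n) → ℝ)
    (u : ℝ → EuclideanSpace ℝ (Fin n) → ℝ) : Prop where
  locallyIntegrable_init : LocallyIntegrable u₀ volume
  weak_eq : ∀ φ : EuclideanSpace ℝ (Fin n) → ℝ, ContDiff ℝ ((⊤ : ℕ∞) : WithTop ℕ∞) φ →
    HasCompactSupport φ → ∀ t : ℝ, 0 < t →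
      (∫ x, u t x * φ x) - ∫ x, u₀ x * φ x =
        ∫ s in (0 : ℝ)..t,
          ((-∫ x, u s x * fracLaplacian θ φ x) -
            ∫ x, u s x * inner ℝ (gradPotential (u s) x) (gradient φ x))

end

end DriftDiffusion

/-! Write `q = n/(n-1)`, so that `1 < q ≤ 2` and `(n-1)q = n`. The quantity followed in time is the
weighted energy `E = ∫ (a|v|)^q`, where `v = ρ * u(t)` is a mollification of the solution and `a` is
a bounded truncation of `(1+|x|²)^{1/2}`. The goal is a differential inequality that is uniform in
the truncation: `E' ≤ A (1+t)⁻¹ (1 + E^{1-1/q}) + B (1+t)⁻² (1+E) + remainder`. Its critical part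
says `(E^{1/q})' ≲ (1+t)⁻¹`, hence `E^{1/q} ≲ log (e+t)`.

Diffusion. The fractional Laplacian is a singular integral of second differences against
`|z|^{-n-θ}` (`exists_fracLaplacian_eq`). Split it at `|z| = τ = (1+t)^{1/θ}`, the diffusive length.
For small `z`, convexity of `|·|^q` and a change of variables put the second difference on `a^q`,
where it is at most `2|z|^q`. As `‖v‖_q ≲ τ⁻¹`, this part costs `τ^{q-θ} τ^{-q} = τ^{-θ} = (1+t)⁻¹`.
For large `z`, only the Lipschitz bound `a(x) ≤ a(x+z) + |z|` is used. The error `|z| ∫ (a|v|)^{q-1}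
|v(·+z)|` is paired with the kernel by Hölder. The resulting `|z|^{1-n-θ}` lies in `L^q` away from
the origin since `(n+θ-1)q = n+θq`, which yields `τ^{-θ} E^{1-1/q}`. Both halves are in
`neg_integral_energyDeriv_mul_secondDiff_le`.

Drift. Integrating by parts, the field meets either the gradient of the weight, or its own
divergence, which is a multiple of `u`. The decay of `u` and of the field makes these terms `τ^{-n}
E^{1-1/q}` and `τ^{-n} E`, both harmless (`integral_energyDeriv_mul_driftFlux_le`). Mollifying
leaves a commutator of DiPerna–Lions type. It is an integral of products of increments of `u` and of
the field (`driftComm_eq`), and it tends to zero in `L¹` with the radius of the mollifier because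
the field has increments of size `|h| ‖u‖₂` in `L²`. That bound
(`lintegral_sq_gradPotential_add_sub_le`) comes from an energy identity for the Newtonian potential,
without singular integral theory.

Conclusion. The weak formulation tested with `ρ(x - ·)` gives `v` as a time primitive of a bounded
velocity, so the energy satisfies an exact integral identity (`energy_eq`). A Gronwall argument
(`le_log_rpow_of_integral_le`) bounds `E`. Then the mollifier is removed with the weight fixed,
which kills the commutator, and afterwards the truncation is removed, each time by Fatou's lemma. -/

namespace DriftDiffusion

open Set Filter Topology Metric

/-- Euclidean `n`-space. -/
abbrev Eu (n : ℕ) := EuclideanSpace ℝ (Fin n)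

/-- The surface area of the unit sphere of `ℝⁿ`. -/
noncomputable def sphereArea (n : ℕ) : ℝ := n * (volume : Measure (Eu n)).real (ball 0 1)

lemma sphereArea_nonneg (n : ℕ) : 0 ≤ sphereArea n := by unfold sphereArea; positivity

/-! ### Integrals of powers of the norm over balls and their complements. -/

section powers

variable {n : ℕ} {s r : ℝ}

lemma nontrivial_Eu (hn : 1 ≤ n) : Nontrivial (Eu n) := by
  have : Nonempty (Fin n) := ⟨⟨0, hn⟩⟩
  infer_instance

lemma pow_mul_rpow_eq (hn : 1 ≤ n) {y : ℝ} (hy : 0 < y) :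
    y ^ (n - 1) * y ^ s = y ^ (s + n - 1) := by
  rw [← Real.rpow_natCast, ← Real.rpow_add hy, Nat.cast_sub hn]
  congr 1
  push_cast
  ring

lemma indicator_ball_norm_rpow :
    (ball (0 : Eu n) r).indicator (fun z : Eu n => ‖z‖ ^ s) =
      fun z => (Iio r).indicator (fun y : ℝ => y ^ s) ‖z‖ := by
  ext z; simp [indicator]

lemma indicator_compl_ball_norm_rpow :
    (ball (0 : Eu n) r)ᶜ.indicator (fun z : Eu n => ‖z‖ ^ s) =
      fun z => (Ici r).indicator (fun y : ℝ => y ^ s) ‖z‖ := by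
  ext z; simp [indicator]

lemma integrableOn_norm_rpow_ball (hn : 1 ≤ n) (hs : -(n : ℝ) < s) :
    IntegrableOn (fun z : Eu n => ‖z‖ ^ s) (ball 0 r) := by
  have := nontrivial_Eu hn
  rw [integrableOn_fun_norm_addHaar volume (f := fun y : ℝ => y ^ s)]
  simp only [finrank_euclideanSpace_fin, smul_eq_mul]
  rw [integrableOn_congr_fun (g := fun y : ℝ => y ^ (s + n - 1))
    (fun y hy => pow_mul_rpow_eq hn hy.1) measurableSet_Ioo]
  rcases le_or_gt r 0 with h | h
  · simp [Ioo_eq_empty (not_lt.mpr h)]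
  · exact ((intervalIntegral.integrableOn_Ioo_rpow_iff h).2 (by linarith))

lemma integrableOn_norm_rpow_compl_ball (hn : 1 ≤ n) (hs : s < -(n : ℝ)) (hr : 0 < r) :
    IntegrableOn (fun z : Eu n => ‖z‖ ^ s) (ball 0 r)ᶜ := by
  have := nontrivial_Eu hn
  rw [← integrable_indicator_iff measurableSet_ball.compl, indicator_compl_ball_norm_rpow,
    integrable_fun_norm_addHaar volume (f := (Ici r).indicator (fun y : ℝ => y ^ s))]
  simp only [finrank_euclideanSpace_fin, smul_eq_mul]
  rw [integrableOn_congr_fun (g := (Ici r).indicator fun y : ℝ => y ^ (s + n - 1))]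
  · refine Integrable.integrableOn ?_
    rw [integrable_indicator_iff measurableSet_Ici, integrableOn_Ici_iff_integrableOn_Ioi]
    exact integrableOn_Ioi_rpow_of_lt (by linarith) hr
  · intro y hy
    by_cases h : r ≤ y <;> simp [h, pow_mul_rpow_eq hn (mem_Ioi.1 hy)]
  · exact measurableSet_Ioi

lemma setIntegral_norm_rpow_ball (hn : 1 ≤ n) (hs : -(n : ℝ) < s) (hr : 0 < r) :
    ∫ z in ball (0 : Eu n) r, ‖z‖ ^ s = sphereArea n * (r ^ (s + n) / (s + n)) := by
  have := nontrivial_Eu hn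
  rw [← integral_indicator measurableSet_ball, indicator_ball_norm_rpow,
    integral_fun_norm_addHaar volume (f := (Iio r).indicator (fun y : ℝ => y ^ s))]
  simp only [finrank_euclideanSpace_fin, smul_eq_mul, nsmul_eq_mul]
  rw [setIntegral_congr_fun (g := (Iio r).indicator fun y : ℝ => y ^ (s + n - 1)) measurableSet_Ioi]
  · rw [setIntegral_indicator measurableSet_Iio, Ioi_inter_Iio, ← integral_Ioc_eq_integral_Ioo,
      ← intervalIntegral.integral_of_le hr.le, integral_rpow (Or.inl (by linarith)),
      Real.zero_rpow (by linarith), sphereArea]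
    ring_nf
  · intro y hy
    by_cases h : y < r <;> simp [h, pow_mul_rpow_eq hn (mem_Ioi.1 hy)]

lemma setIntegral_norm_rpow_compl_ball (hn : 1 ≤ n) (hs : s < -(n : ℝ)) (hr : 0 < r) :
    ∫ z in (ball (0 : Eu n) r)ᶜ, ‖z‖ ^ s = sphereArea n * (r ^ (s + n) / (-(s + n))) := by
  have := nontrivial_Eu hn
  rw [← integral_indicator measurableSet_ball.compl, indicator_compl_ball_norm_rpow,
    integral_fun_norm_addHaar volume (f := (Ici r).indicator (fun y : ℝ => y ^ s))]
  simp only [finrank_euclideanSpace_fin, smul_eq_mul, nsmul_eq_mul]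
  rw [setIntegral_congr_fun (g := (Ici r).indicator fun y : ℝ => y ^ (s + n - 1)) measurableSet_Ioi]
  · rw [setIntegral_indicator measurableSet_Ici, inter_eq_right.2 (Ici_subset_Ioi.2 hr),
      integral_Ici_eq_integral_Ioi, integral_Ioi_rpow_of_lt (by linarith) hr, sphereArea]
    rw [show s + n - 1 + 1 = s + n by ring, neg_div, div_neg]
    ring_nf
  · intro y hy
    by_cases h : r ≤ y <;> simp [h, pow_mul_rpow_eq hn (mem_Ioi.1 hy)]

/-- A bounded integrable function is integrable against a locally integrable negative power. -/
lemma integrable_mul_norm_rpow {v : Eu n → ℝ} (hn : 1 ≤ n) (hs : -(n : ℝ) < s) (hs0 : s ≤ 0)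
    (hv : Integrable v) {M : ℝ} (hM : ∀ᵐ y, |v y| ≤ M) (x : Eu n) :
    Integrable (fun y => v y * ‖x - y‖ ^ s) ∧
    ∀ r : ℝ, 0 < r → ∫ y, |v y| * ‖x - y‖ ^ s ≤
      M * (sphereArea n * (r ^ (s + n) / (s + n))) + r ^ s * ∫ y, |v y| := by
  have hbd : ∀ r : ℝ, 0 < r → ∃ g : Eu n → ℝ, Integrable g ∧
      (∀ᵐ y, |v y| * ‖x - y‖ ^ s ≤ g y) ∧
      ∫ y, g y = M * (sphereArea n * (r ^ (s + n) / (s + n))) + r ^ s * ∫ y, |v y| := by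
    intro r hr
    have h1 : Integrable (fun y : Eu n => (ball (0 : Eu n) r).indicator (fun z => ‖z‖ ^ s) (x - y)) := by
      have := (integrable_indicator_iff measurableSet_ball).2
        (integrableOn_norm_rpow_ball (n := n) (r := r) hn hs)
      exact this.comp_sub_left x
    -- Split at distance `r` from `x`: inside, `|v| ≤ M` and the power is integrated; outside, the
    -- nonincreasing power is at most `r ^ s`.
    refine ⟨fun y => M * (ball (0 : Eu n) r).indicator (fun z => ‖z‖ ^ s) (x - y) + r ^ s * |v y|,
      (h1.const_mul M).add (hv.abs.const_mul _), ?_, ?_⟩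
    · filter_upwards [hM] with y hy
      by_cases h : ‖x - y‖ < r
      · have : (x - y) ∈ ball (0 : Eu n) r := by simpa using h
        rw [indicator_of_mem this]
        have : 0 ≤ r ^ s * |v y| := by positivity
        have : |v y| * ‖x - y‖ ^ s ≤ M * ‖x - y‖ ^ s := by gcongr
        linarith
      · have : (x - y) ∉ ball (0 : Eu n) r := by simpa using h
        rw [indicator_of_notMem this]
        have : ‖x - y‖ ^ s ≤ r ^ s := Real.rpow_le_rpow_of_nonpos hr (not_lt.1 h) hs0
        nlinarith [abs_nonneg (v y)]
    · rw [integral_add (h1.const_mul M) (hv.abs.const_mul _), integral_const_mul,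
        integral_const_mul,
        integral_sub_left_eq_self (fun z => (ball (0 : Eu n) r).indicator (fun z => ‖z‖ ^ s) z) volume x,
        integral_indicator measurableSet_ball, setIntegral_norm_rpow_ball hn hs hr]
  have hmeas : AEStronglyMeasurable (fun y => v y * ‖x - y‖ ^ s) :=
    hv.aestronglyMeasurable.mul
      ((measurable_norm.pow_const s).comp (measurable_const.sub measurable_id)).aestronglyMeasurable
  have hint : Integrable (fun y => v y * ‖x - y‖ ^ s) := by
    obtain ⟨g, hg, hle, -⟩ := hbd 1 one_pos
    refine hg.mono' hmeas ?_
    filter_upwards [hle] with y hy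
    rwa [norm_mul, Real.norm_eq_abs, Real.norm_of_nonneg (by positivity : (0 : ℝ) ≤ ‖x - y‖ ^ s)]
  refine ⟨hint, fun r hr => ?_⟩
  obtain ⟨g, hg, hle, hge⟩ := hbd r hr
  rw [← hge]
  refine integral_mono_ae ?_ hg hle
  refine hint.abs.congr (.of_forall fun y => ?_)
  simp only [abs_mul]
  rw [abs_of_nonneg (by positivity : (0 : ℝ) ≤ ‖x - y‖ ^ s)]

end powers

/-! ### The Newtonian field kernel, its smooth regularization and its divergence. -/

section kernels

variable {n : ℕ}

/-- The homogeneous vector kernel `z / |z|ⁿ`. -/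
noncomputable def kern (z : Eu n) : Eu n := (‖z‖ ^ n)⁻¹ • z

/-- The regularized kernel `z / (|z|² + δ²)^{n/2}`. -/
noncomputable def kernReg (δ : ℝ) (z : Eu n) : Eu n := (‖z‖ ^ 2 + δ ^ 2) ^ (-(n : ℝ) / 2) • z

/-- The divergence of the regularized kernel. -/
noncomputable def kernDens (δ : ℝ) (z : Eu n) : ℝ :=
  n * δ ^ 2 * (‖z‖ ^ 2 + δ ^ 2) ^ (-(n : ℝ) / 2 - 1)

/-- The normalization of the Newtonian kernel. -/
noncomputable def newtonConst (n : ℕ) : ℝ :=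
  -(Real.Gamma ((n : ℝ) / 2) / (2 * Real.pi ^ ((n : ℝ) / 2)))

lemma gradPotential_eq (v : Eu n → ℝ) (x : Eu n) :
    gradPotential v x = newtonConst n • ∫ y, v y • kern (x - y) := by
  unfold gradPotential newtonConst kern
  simp_rw [smul_smul, div_eq_mul_inv]

lemma norm_kern_le (z : Eu n) : ‖kern z‖ ≤ ‖z‖ ^ (1 - (n : ℝ)) := by
  unfold kern
  rcases eq_or_ne z 0 with rfl | hz
  · simp; positivity
  · have h : 0 < ‖z‖ := norm_pos_iff.2 hz
    rw [norm_smul, norm_inv, norm_pow, norm_norm, Real.rpow_sub h, Real.rpow_one,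
      Real.rpow_natCast]
    exact le_of_eq (by field_simp)

lemma norm_kernReg_le (δ : ℝ) (z : Eu n) : ‖kernReg δ z‖ ≤ ‖z‖ ^ (1 - (n : ℝ)) := by
  unfold kernReg
  rcases eq_or_ne z 0 with rfl | hz
  · simp; positivity
  · have h : 0 < ‖z‖ := norm_pos_iff.2 hz
    rw [norm_smul, Real.norm_of_nonneg (by positivity), sub_eq_neg_add, Real.rpow_add h,
      Real.rpow_one]
    gcongr
    calc (‖z‖ ^ 2 + δ ^ 2) ^ (-(n : ℝ) / 2) ≤ (‖z‖ ^ 2) ^ (-(n : ℝ) / 2) :=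
          Real.rpow_le_rpow_of_nonpos (by positivity) (by nlinarith [sq_nonneg δ])
            (by have : (0 : ℝ) ≤ n := by positivity
                linarith)
      _ = ‖z‖ ^ (-(n : ℝ)) := by
          rw [← Real.rpow_natCast, ← Real.rpow_mul h.le]; congr 1; push_cast; ring

lemma measurable_kern : Measurable (kern (n := n)) := by unfold kern; fun_prop

lemma sq_add_sq_pos {δ : ℝ} (hδ : 0 < δ) (z : Eu n) : 0 < ‖z‖ ^ 2 + δ ^ 2 := by positivity

lemma continuous_kernReg {δ : ℝ} (hδ : 0 < δ) : Continuous (kernReg (n := n) δ) := by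
  unfold kernReg
  exact ((by fun_prop : Continuous fun z : Eu n => ‖z‖ ^ 2 + δ ^ 2).rpow_const
    (fun z => Or.inl (sq_add_sq_pos hδ z).ne')).smul continuous_id

lemma continuous_kernDens {δ : ℝ} (hδ : 0 < δ) : Continuous (kernDens (n := n) δ) := by
  unfold kernDens
  refine Continuous.mul continuous_const ?_
  exact (by fun_prop : Continuous fun z : Eu n => ‖z‖ ^ 2 + δ ^ 2).rpow_const
    (fun z => Or.inl (sq_add_sq_pos hδ z).ne')

lemma kernDens_nonneg (δ : ℝ) (z : Eu n) : 0 ≤ kernDens δ z := by unfold kernDens; positivity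

/-- The derivative of the regularized kernel. -/
noncomputable def kernRegDeriv (δ : ℝ) (z : Eu n) : Eu n →L[ℝ] Eu n :=
  (‖z‖ ^ 2 + δ ^ 2) ^ (-(n : ℝ) / 2) • ContinuousLinearMap.id ℝ (Eu n) +
    ((-(n : ℝ) * (‖z‖ ^ 2 + δ ^ 2) ^ (-(n : ℝ) / 2 - 1)) • innerSL ℝ z).smulRight z

lemma hasFDerivAt_kernReg {δ : ℝ} (hδ : 0 < δ) (z : Eu n) :
    HasFDerivAt (kernReg δ) (kernRegDeriv δ z) z := by
  have h1 : HasFDerivAt (fun z : Eu n => ‖z‖ ^ 2 + δ ^ 2) (2 • innerSL ℝ z) z :=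
    (hasStrictFDerivAt_norm_sq z).hasFDerivAt.add_const _
  have h2 := (h1.rpow_const (p := -(n : ℝ) / 2) (Or.inl (sq_add_sq_pos hδ z).ne'))
  refine (h2.smul (hasFDerivAt_id z)).congr_fderiv ?_
  unfold kernRegDeriv
  ext w : 1
  simp only [id, add_apply, smul_apply,
    ContinuousLinearMap.smulRight_apply, ContinuousLinearMap.id_apply, nsmul_eq_mul, smul_eq_mul]
  congr 2
  simp
  ring

/-- The trace carries the factor `n(|z|²+δ²) - n|z|² = nδ²`: the homogeneous kernel is divergence
free off the origin, so only the regularization survives. -/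
lemma sum_kernRegDeriv {δ : ℝ} (hδ : 0 < δ) (z : Eu n) :
    ∑ j, (kernRegDeriv δ z (EuclideanSpace.single j 1)) j = kernDens δ z := by
  have hs := sq_add_sq_pos hδ z
  unfold kernRegDeriv kernDens
  simp only [add_apply, smul_apply,
    ContinuousLinearMap.smulRight_apply, ContinuousLinearMap.id_apply, smul_eq_mul,
    PiLp.add_apply, PiLp.smul_apply, innerSL_apply_apply, EuclideanSpace.inner_single_right,
    PiLp.single_apply]
  simp only [if_true, mul_one, one_mul, conj_trivial, Finset.sum_add_distrib, Finset.sum_const,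
    Finset.card_univ, Fintype.card_fin, nsmul_eq_mul, mul_assoc, ← Finset.mul_sum]
  have : ∑ i, z i * z i = ‖z‖ ^ 2 := by
    rw [EuclideanSpace.norm_sq_eq]; simp [sq]
  rw [this, Real.rpow_sub hs, Real.rpow_one]
  field_simp
  ring

lemma tendsto_kernReg (z : Eu n) :
    Tendsto (fun δ => kernReg δ z) (𝓝 0) (𝓝 (kern z)) := by
  rcases eq_or_ne z 0 with rfl | hz
  · simp [kernReg, kern]
  · have h : 0 < ‖z‖ := norm_pos_iff.2 hz
    have : ContinuousAt (fun δ : ℝ => kernReg δ z) 0 := by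
      unfold kernReg
      exact (ContinuousAt.rpow_const (f := fun δ : ℝ => ‖z‖ ^ 2 + δ ^ 2) (by fun_prop)
        (Or.inl (by positivity))).smul continuousAt_const
    convert this.tendsto using 2
    unfold kern kernReg
    congr 1
    rw [zero_pow two_ne_zero, add_zero, ← Real.rpow_natCast ‖z‖ 2, ← Real.rpow_mul h.le,
      ← Real.rpow_natCast, ← Real.rpow_neg h.le]
    congr 1
    push_cast; ring

lemma sq_add_sq_ge {δ : ℝ} (z : Eu n) :
    min 1 (δ ^ 2) / 2 * (1 + ‖z‖) ^ 2 ≤ ‖z‖ ^ 2 + δ ^ 2 := by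
  have h1 : min 1 (δ ^ 2) ≤ 1 := min_le_left _ _
  have h2 : min 1 (δ ^ 2) ≤ δ ^ 2 := min_le_right _ _
  have h3 : 0 ≤ min 1 (δ ^ 2) := by positivity
  have : (1 + ‖z‖) ^ 2 ≤ 2 * (1 + ‖z‖ ^ 2) := by nlinarith [sq_nonneg (1 - ‖z‖)]
  nlinarith [mul_le_mul_of_nonneg_right h1 (sq_nonneg ‖z‖), mul_le_mul_of_nonneg_left this h3]

lemma exists_rpow_sq_add_sq_le {δ : ℝ} (hδ : 0 < δ) (s : ℝ) (hs : s ≤ 0) :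
    ∃ C, 0 ≤ C ∧ ∀ z : Eu n, (‖z‖ ^ 2 + δ ^ 2) ^ s ≤ C * (1 + ‖z‖) ^ (2 * s) := by
  have hc : 0 < min 1 (δ ^ 2) / 2 := by positivity
  refine ⟨(min 1 (δ ^ 2) / 2) ^ s, by positivity, fun z => ?_⟩
  calc (‖z‖ ^ 2 + δ ^ 2) ^ s ≤ (min 1 (δ ^ 2) / 2 * (1 + ‖z‖) ^ 2) ^ s :=
        Real.rpow_le_rpow_of_nonpos (by positivity) (sq_add_sq_ge z) hs
    _ = _ := by
        rw [Real.mul_rpow hc.le (by positivity), ← Real.rpow_natCast (1 + ‖z‖), ← Real.rpow_mul (by positivity)]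
        norm_num

lemma integrable_one_add_norm_rpow {s : ℝ} (hs : s < -(n : ℝ)) :
    Integrable (fun z : Eu n => (1 + ‖z‖) ^ s) := by
  have := integrable_one_add_norm (E := Eu n) (μ := volume) (r := -s)
    (by rw [finrank_euclideanSpace_fin]; linarith)
  simpa using this

lemma integrable_kernDens {δ : ℝ} (hδ : 0 < δ) : Integrable (kernDens (n := n) δ) := by
  obtain ⟨C, -, hC⟩ := exists_rpow_sq_add_sq_le (n := n) hδ (-(n : ℝ) / 2 - 1)
    (by have : (0 : ℝ) ≤ n := by positivity
        linarith)
  have h := (integrable_one_add_norm_rpow (n := n) (s := 2 * (-(n : ℝ) / 2 - 1)) (by linarith)).const_mul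
    (n * δ ^ 2 * C)
  refine h.mono' (continuous_kernDens hδ).aestronglyMeasurable (.of_forall fun z => ?_)
  rw [Real.norm_of_nonneg (kernDens_nonneg _ _), kernDens, mul_assoc (n * δ ^ 2)]
  gcongr
  exact hC z

/-- The divergences are mass-preserving dilations of one integrable profile, hence concentrate at
the origin as `δ → 0`. -/
lemma kernDens_smul {δ : ℝ} (hδ : 0 < δ) (z : Eu n) :
    kernDens δ (δ • z) = (δ ^ n)⁻¹ * kernDens 1 z := by
  unfold kernDens
  rw [norm_smul, Real.norm_of_nonneg hδ.le,
    show (δ * ‖z‖) ^ 2 + δ ^ 2 = δ ^ 2 * (‖z‖ ^ 2 + 1 ^ 2) by ring,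
    Real.mul_rpow (by positivity) (by positivity), ← Real.rpow_natCast δ 2, ← Real.rpow_mul hδ.le,
    show ((2 : ℕ) : ℝ) * (-(n : ℝ) / 2 - 1) = -(n : ℝ) - (2 : ℕ) by push_cast; ring,
    Real.rpow_sub hδ, Real.rpow_neg hδ.le, Real.rpow_natCast, Real.rpow_natCast]
  field_simp

lemma integral_kernDens_mul {δ : ℝ} (hδ : 0 < δ) (F : Eu n → ℝ) :
    ∫ z, kernDens δ z * F z = ∫ z, kernDens 1 z * F (δ • z) := by
  have h := Measure.integral_comp_smul (volume : Measure (Eu n)) (fun z => kernDens δ z * F z) δ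
  rw [finrank_euclideanSpace_fin, abs_of_pos (by positivity), smul_eq_mul] at h
  simp_rw [kernDens_smul hδ, mul_assoc] at h
  rw [integral_const_mul] at h
  exact (mul_left_cancel₀ (by positivity) h).symm

/-- The total mass of the divergence of the kernel. -/
noncomputable def kernMass (n : ℕ) : ℝ := ∫ z : Eu n, kernDens 1 z

lemma kernMass_nonneg (n : ℕ) : 0 ≤ kernMass n := integral_nonneg (kernDens_nonneg 1)

lemma integral_kernDens {δ : ℝ} (hδ : 0 < δ) : ∫ z : Eu n, kernDens δ z = kernMass n := by
  simpa [kernMass] using integral_kernDens_mul (n := n) hδ (fun _ => 1)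

lemma sum_apply_single (L : Eu n →L[ℝ] ℝ) (v : Eu n) :
    L v = ∑ j, v j * L (EuclideanSpace.single j 1) := by
  conv_lhs => rw [← (EuclideanSpace.basisFun (Fin n) ℝ).sum_repr v, map_sum]
  simp

/-- The divergence theorem on the whole space. -/
lemma integral_fderiv_apply_eq_neg_div {F : Eu n → ℝ} {X : Eu n → Eu n}
    {X' : Eu n → Eu n →L[ℝ] Eu n} (hF : Differentiable ℝ F) (hX : ∀ x, HasFDerivAt X (X' x) x)
    (h1 : ∀ j, Integrable fun x => X x j * fderiv ℝ F x (EuclideanSpace.single j 1))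
    (h2 : ∀ j, Integrable fun x => X' x (EuclideanSpace.single j 1) j * F x)
    (h3 : ∀ j, Integrable fun x => X x j * F x) :
    ∫ x, fderiv ℝ F x (X x) = -∫ x, (∑ j, X' x (EuclideanSpace.single j 1) j) * F x := by
  have hXj : ∀ j x, HasFDerivAt (fun x => X x j)
      ((EuclideanSpace.proj j : Eu n →L[ℝ] ℝ).comp (X' x)) x := fun j x =>
    (EuclideanSpace.proj j : Eu n →L[ℝ] ℝ).hasFDerivAt.comp x (hX x)
  have key : ∀ j, ∫ x, X x j * fderiv ℝ F x (EuclideanSpace.single j 1) =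
      -∫ x, X' x (EuclideanSpace.single j 1) j * F x := fun j => by
    have h := integral_mul_fderiv_eq_neg_fderiv_mul_of_integrable (μ := (volume : Measure (Eu n)))
      (f := fun x => X x j) (g := F) (v := EuclideanSpace.single j 1)
      (by simp_rw [(hXj j _).fderiv]; exact h2 j) (h1 j) (h3 j)
      (fun x _ => (hXj j x).differentiableAt) (fun x _ => hF x)
    simp_rw [(hXj j _).fderiv] at h
    exact h
  simp_rw [fun x => sum_apply_single (fderiv ℝ F x) (X x), Finset.sum_mul]
  rw [integral_finsetSum _ fun j _ => h1 j, integral_finsetSum _ fun j _ => h2 j,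
    ← Finset.sum_neg_distrib]
  exact Finset.sum_congr rfl fun j _ => key j

end kernels

/-! ### Size and weak divergence of the field. -/

section fields

variable {n : ℕ}

lemma aestronglyMeasurable_clm_apply {α : Type*} [MeasurableSpace α] {μ : Measure α}
    {f : α → Eu n →L[ℝ] ℝ} {g : α → Eu n} (hf : AEStronglyMeasurable f μ)
    (hg : AEStronglyMeasurable g μ) : AEStronglyMeasurable (fun x => f x (g x)) μ :=
  isBoundedBilinearMap_apply.continuous.comp_aestronglyMeasurable (hf.prodMk hg)

lemma integrable_smul_kern (hn : 2 ≤ n) {v : Eu n → ℝ} (hv : Integrable v) {M : ℝ}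
    (hM : ∀ᵐ y, |v y| ≤ M) (x : Eu n) : Integrable fun y => v y • kern (x - y) := by
  have hn' : (2 : ℝ) ≤ n := by exact_mod_cast hn
  obtain ⟨h, -⟩ := integrable_mul_norm_rpow (s := 1 - (n : ℝ)) (by omega) (by linarith)
    (by linarith) hv hM x
  refine h.mono (hv.aestronglyMeasurable.smul
    (measurable_kern.comp (measurable_const.sub measurable_id)).aestronglyMeasurable)
    (.of_forall fun y => ?_)
  rw [norm_smul, norm_mul, Real.norm_of_nonneg (by positivity : (0 : ℝ) ≤ ‖x - y‖ ^ (1 - (n : ℝ)))]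
  gcongr
  exact norm_kern_le _

lemma integral_mul_norm_rpow_le (hn : 2 ≤ n) {v : Eu n → ℝ} (hv : Integrable v) {M : ℝ}
    (hM : ∀ᵐ y, |v y| ≤ M) (x : Eu n) {r : ℝ} (hr : 0 < r) :
    ∫ y, |v y| * ‖x - y‖ ^ (1 - (n : ℝ)) ≤
      M * (sphereArea n * r) + r ^ (1 - (n : ℝ)) * ∫ y, |v y| := by
  have hn' : (2 : ℝ) ≤ n := by exact_mod_cast hn
  have := (integrable_mul_norm_rpow (s := 1 - (n : ℝ)) (by omega) (by linarith)
    (by linarith) hv hM x).2 r hr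
  simpa using this

lemma integrable_abs_mul_norm_rpow (hn : 2 ≤ n) {v : Eu n → ℝ} (hv : Integrable v) {M : ℝ}
    (hM : ∀ᵐ y, |v y| ≤ M) (x : Eu n) :
    Integrable fun y => |v y| * ‖x - y‖ ^ (1 - (n : ℝ)) := by
  have hn' : (2 : ℝ) ≤ n := by exact_mod_cast hn
  have := (integrable_mul_norm_rpow (s := 1 - (n : ℝ)) (by omega) (by linarith)
    (by linarith) hv hM x).1.abs
  refine this.congr (.of_forall fun y => ?_)
  simp only [abs_mul]
  rw [abs_of_nonneg (by positivity : (0 : ℝ) ≤ ‖x - y‖ ^ (1 - (n : ℝ)))]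

/-- The pointwise bound of the field by the `L¹` and `L^∞` norms of the density. -/
lemma norm_gradPotential_le (hn : 2 ≤ n) {v : Eu n → ℝ} (hv : Integrable v) {M : ℝ}
    (hM : ∀ᵐ y, |v y| ≤ M) (x : Eu n) {r : ℝ} (hr : 0 < r) :
    ‖gradPotential v x‖ ≤
      |newtonConst n| * (M * (sphereArea n * r) + r ^ (1 - (n : ℝ)) * ∫ y, |v y|) := by
  rw [gradPotential_eq, norm_smul, Real.norm_eq_abs]
  gcongr
  refine (norm_integral_le_integral_norm _).trans
    (le_trans ?_ (integral_mul_norm_rpow_le hn hv hM x hr))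
  refine integral_mono (integrable_smul_kern hn hv hM x).norm
    (integrable_abs_mul_norm_rpow hn hv hM x) fun y => ?_
  simp only [norm_smul, Real.norm_eq_abs]
  gcongr
  exact norm_kern_le _

lemma aestronglyMeasurable_gradPotential {v : Eu n → ℝ} (hv : AEStronglyMeasurable v) :
    AEStronglyMeasurable (gradPotential v) := by
  simp_rw [funext fun x => gradPotential_eq v x]
  have h : AEStronglyMeasurable (fun p : Eu n × Eu n => v p.2 • kern (p.1 - p.2))
      (volume.prod volume) := hv.comp_snd.smul
    (measurable_kern.comp (measurable_fst.sub measurable_snd)).aestronglyMeasurable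
  exact h.integral_prod_right'.const_smul (newtonConst n)

lemma exists_norm_kernReg_le {δ : ℝ} (hδ : 0 < δ) :
    ∃ C, 0 ≤ C ∧ ∀ z : Eu n, ‖kernReg δ z‖ ≤ C * (1 + ‖z‖) ^ (1 - (n : ℝ)) := by
  obtain ⟨C, hC0, hC⟩ := exists_rpow_sq_add_sq_le (n := n) hδ (-(n : ℝ) / 2)
    (by have : (0 : ℝ) ≤ n := by positivity
        linarith)
  refine ⟨C, hC0, fun z => ?_⟩
  rw [kernReg, norm_smul, Real.norm_of_nonneg (by positivity), sub_eq_neg_add,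
    Real.rpow_add (by positivity), Real.rpow_one, ← mul_assoc]
  refine mul_le_mul ((hC z).trans_eq (by congr 2; ring)) (by linarith [norm_nonneg z])
    (norm_nonneg _) (by positivity)

lemma norm_kernRegDeriv_le {δ : ℝ} (hδ : 0 < δ) (z : Eu n) :
    ‖kernRegDeriv δ z‖ ≤ (1 + n) * (‖z‖ ^ 2 + δ ^ 2) ^ (-(n : ℝ) / 2) := by
  have hs := sq_add_sq_pos hδ z
  unfold kernRegDeriv
  refine (norm_add_le _ _).trans ?_
  rw [norm_smul, ContinuousLinearMap.norm_smulRight_apply, norm_smul, innerSL_apply_norm,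
    norm_mul, norm_neg, Real.norm_of_nonneg (by positivity), Real.norm_of_nonneg (by positivity),
    Real.norm_of_nonneg (by positivity), add_mul, one_mul]
  refine add_le_add ?_ ?_
  · exact mul_le_of_le_one_right (by positivity) ContinuousLinearMap.norm_id_le
  · rw [Real.rpow_sub hs, Real.rpow_one, mul_assoc, mul_assoc]
    gcongr
    rw [div_mul_eq_mul_div, div_le_iff₀ hs]
    gcongr
    nlinarith [sq_nonneg δ]

lemma exists_norm_kernRegDeriv_le {δ : ℝ} (hδ : 0 < δ) :
    ∃ C, 0 ≤ C ∧ ∀ z : Eu n, ‖kernRegDeriv δ z‖ ≤ C * (1 + ‖z‖) ^ (-(n : ℝ)) := by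
  obtain ⟨C, hC0, hC⟩ := exists_rpow_sq_add_sq_le (n := n) hδ (-(n : ℝ) / 2)
    (by have : (0 : ℝ) ≤ n := by positivity
        linarith)
  refine ⟨(1 + n) * C, by positivity, fun z => (norm_kernRegDeriv_le hδ z).trans ?_⟩
  rw [mul_assoc]
  gcongr
  exact (hC z).trans_eq (by congr 2; ring)

lemma continuous_kernRegDeriv {δ : ℝ} (hδ : 0 < δ) : Continuous (kernRegDeriv (n := n) δ) := by
  unfold kernRegDeriv
  have h (s : ℝ) : Continuous fun z : Eu n => (‖z‖ ^ 2 + δ ^ 2) ^ s :=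
    (by fun_prop : Continuous fun z : Eu n => ‖z‖ ^ 2 + δ ^ 2).rpow_const
      (fun z => Or.inl (sq_add_sq_pos hδ z).ne')
  refine ((h _).smul continuous_const).add ?_
  have h2 : Continuous fun z : Eu n =>
      (-(n : ℝ) * (‖z‖ ^ 2 + δ ^ 2) ^ (-(n : ℝ) / 2 - 1)) • innerSL ℝ z :=
    (continuous_const.mul (h _)).smul (innerSL ℝ).continuous
  exact ((ContinuousLinearMap.smulRightL ℝ (Eu n) (Eu n)).continuous.comp h2).clm_apply continuous_id

lemma one_add_norm_rpow_le_one {s : ℝ} (hs : s ≤ 0) (z : Eu n) : (1 + ‖z‖) ^ s ≤ 1 :=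
  Real.rpow_le_one_of_one_le_of_nonpos (by linarith [norm_nonneg z]) hs

lemma norm_apply_single_le (L : Eu n →L[ℝ] Eu n) (j : Fin n) :
    ‖L (EuclideanSpace.single j 1) j‖ ≤ ‖L‖ := by
  refine (PiLp.norm_apply_le _ _).trans ((L.le_opNorm _).trans ?_)
  simp

lemma norm_apply_single_le' (L : Eu n →L[ℝ] ℝ) (j : Fin n) :
    ‖L (EuclideanSpace.single j 1)‖ ≤ ‖L‖ := by
  refine (L.le_opNorm _).trans ?_
  simp

lemma continuous_apply_coord {X : Eu n → Eu n} (hX : Continuous X) (j : Fin n) :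
    Continuous fun x => X x j :=
  (EuclideanSpace.proj j : Eu n →L[ℝ] ℝ).continuous.comp hX

/-- Test functions that are bounded and integrable together with their derivative. -/
structure IsTest (F : Eu n → ℝ) : Prop where
  contDiff : ContDiff ℝ 1 F
  integrable : Integrable F
  integrable_fderiv : Integrable (fderiv ℝ F)
  bounded : ∃ C, ∀ x, ‖F x‖ ≤ C
  bounded_fderiv : ∃ C, ∀ x, ‖fderiv ℝ F x‖ ≤ C

lemma IsTest.continuous_fderiv {F : Eu n → ℝ} (hF : IsTest F) : Continuous (fderiv ℝ F) :=
  hF.contDiff.continuous_fderiv one_ne_zero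

lemma IsTest.comp_add_right {F : Eu n → ℝ} (hF : IsTest F) (y : Eu n) :
    IsTest (fun x => F (x + y)) where
  contDiff := hF.contDiff.comp (contDiff_id.add contDiff_const)
  integrable := hF.integrable.comp_add_right y
  integrable_fderiv := (hF.integrable_fderiv.comp_add_right y).congr
    (.of_forall fun x => (fderiv_comp_add_right y).symm)
  bounded := hF.bounded.imp fun C hC x => hC _
  bounded_fderiv := hF.bounded_fderiv.imp fun C hC x => by
    rw [fderiv_comp_add_right]; exact hC _

lemma IsTest.of_hasCompactSupport {F : Eu n → ℝ} (hF : ContDiff ℝ 1 F) (hc : HasCompactSupport F) :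
    IsTest F where
  contDiff := hF
  integrable := hF.continuous.integrable_of_hasCompactSupport hc
  integrable_fderiv :=
    (hF.continuous_fderiv one_ne_zero).integrable_of_hasCompactSupport (hc.fderiv ℝ)
  bounded := hc.exists_bound_of_continuous hF.continuous
  bounded_fderiv := (hc.fderiv ℝ).exists_bound_of_continuous (hF.continuous_fderiv one_ne_zero)

lemma integral_fderiv_kernReg (hn : 2 ≤ n) {δ : ℝ} (hδ : 0 < δ) {F : Eu n → ℝ} (hF : IsTest F) :
    ∫ z, fderiv ℝ F z (kernReg δ z) = -∫ z, kernDens δ z * F z := by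
  have hn' : (2 : ℝ) ≤ n := by exact_mod_cast hn
  obtain ⟨C, hC0, hC⟩ := exists_norm_kernReg_le (n := n) hδ
  obtain ⟨C', hC0', hC'⟩ := exists_norm_kernRegDeriv_le (n := n) hδ
  have hb : ∀ z : Eu n, ‖kernReg δ z‖ ≤ C := fun z => (hC z).trans
    (mul_le_of_le_one_right hC0 (one_add_norm_rpow_le_one (by linarith) z))
  have hb' : ∀ z : Eu n, ‖kernRegDeriv δ z‖ ≤ C' := fun z => (hC' z).trans
    (mul_le_of_le_one_right hC0' (one_add_norm_rpow_le_one (by linarith) z))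
  have hFc := hF.contDiff.continuous
  have hdFc := hF.continuous_fderiv
  rw [integral_fderiv_apply_eq_neg_div (hF.contDiff.differentiable one_ne_zero)
    (hasFDerivAt_kernReg hδ)]
  · simp_rw [sum_kernRegDeriv hδ]
  · intro j
    refine (hF.integrable_fderiv.norm.const_mul C).mono'
      ((continuous_apply_coord (continuous_kernReg hδ) j).mul
        (hdFc.clm_apply continuous_const)).aestronglyMeasurable (.of_forall fun x => ?_)
    rw [norm_mul]
    gcongr
    · exact (PiLp.norm_apply_le _ _).trans (hb x)
    · exact norm_apply_single_le' _ _
  · intro j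
    refine (hF.integrable.norm.const_mul C').mono'
      ((continuous_apply_coord ((continuous_kernRegDeriv hδ).clm_apply continuous_const) j).mul
        hFc).aestronglyMeasurable (.of_forall fun x => ?_)
    rw [norm_mul]
    gcongr
    exact (norm_apply_single_le _ _).trans (hb' x)
  · intro j
    refine (hF.integrable.norm.const_mul C).mono'
      ((continuous_apply_coord (continuous_kernReg hδ) j).mul hFc).aestronglyMeasurable
      (.of_forall fun x => ?_)
    rw [norm_mul]
    gcongr
    exact (PiLp.norm_apply_le _ _).trans (hb x)

/-- The divergence of `z/|z|ⁿ` is a multiple of the Dirac mass at the origin. The regularized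
identity is rescaled so that the density stays fixed and `F` is evaluated at `δ z`; both sides then
converge by domination. The value of `kernMass n` is never computed, since the later estimates need
only some finite constant. -/
lemma integral_fderiv_kern (hn : 2 ≤ n) {F : Eu n → ℝ} (hF : IsTest F) :
    ∫ z, fderiv ℝ F z (kern z) = -(kernMass n * F 0) := by
  obtain ⟨C0, hC0⟩ := hF.bounded
  obtain ⟨C1, hC1⟩ := hF.bounded_fderiv
  have hn' : (2 : ℝ) ≤ n := by exact_mod_cast hn
  have hmem : ∀ᶠ δ : ℝ in 𝓝[>] 0, 0 < δ := self_mem_nhdsWithin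
  have l1 : Tendsto (fun δ => ∫ z, fderiv ℝ F z (kernReg δ z)) (𝓝[>] 0)
      (𝓝 (∫ z, fderiv ℝ F z (kern z))) := by
    refine tendsto_integral_filter_of_dominated_convergence
      (fun z => ‖fderiv ℝ F z‖ * ‖z‖ ^ (1 - (n : ℝ))) ?_ ?_ ?_ ?_
    · filter_upwards [hmem] with δ hδ
      exact (hF.continuous_fderiv.clm_apply (continuous_kernReg hδ)).aestronglyMeasurable
    · filter_upwards with δ
      refine .of_forall fun z => ((fderiv ℝ F z).le_opNorm _).trans ?_
      gcongr
      exact norm_kernReg_le δ z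
    · have := integrable_abs_mul_norm_rpow hn hF.integrable_fderiv.norm (M := C1)
        (.of_forall fun y => by rw [abs_norm]; exact hC1 y) 0
      simpa using this
    · refine .of_forall fun z => ?_
      exact ((fderiv ℝ F z).continuous.tendsto _).comp
        ((tendsto_kernReg z).mono_left nhdsWithin_le_nhds)
  have l2 : Tendsto (fun δ => ∫ z, fderiv ℝ F z (kernReg δ z)) (𝓝[>] 0)
      (𝓝 (-(kernMass n * F 0))) := by
    have : Tendsto (fun δ : ℝ => ∫ z, kernDens 1 z * F (δ • z)) (𝓝[>] 0)
        (𝓝 (∫ z : Eu n, kernDens 1 z * F 0)) := by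
      refine tendsto_integral_filter_of_dominated_convergence
        (fun z => kernDens 1 z * C0) ?_ ?_ ?_ ?_
      · filter_upwards with δ
        exact ((continuous_kernDens one_pos).mul
          (hF.contDiff.continuous.comp (continuous_const_smul δ))).aestronglyMeasurable
      · filter_upwards with δ
        refine .of_forall fun z => ?_
        rw [norm_mul, Real.norm_of_nonneg (kernDens_nonneg _ _)]
        exact mul_le_mul_of_nonneg_left (hC0 _) (kernDens_nonneg _ _)
      · exact (integrable_kernDens one_pos).mul_const _
      · refine .of_forall fun z => Tendsto.const_mul _ ?_
        have : Continuous fun δ : ℝ => F (δ • z) :=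
          hF.contDiff.continuous.comp (continuous_id.smul continuous_const)
        simpa using (this.tendsto 0).mono_left nhdsWithin_le_nhds
    rw [integral_mul_const] at this
    refine this.neg.congr' ?_
    filter_upwards [hmem] with δ hδ
    rw [integral_fderiv_kernReg hn hδ hF, integral_kernDens_mul hδ]
  exact tendsto_nhds_unique l1 l2

/-- The constant in `div ∇(-Δ)⁻¹ v = const • v`. -/
noncomputable def divConst (n : ℕ) : ℝ := -(newtonConst n * kernMass n)

/-- The divergence of the field is a multiple of the density, in the weak form. -/
lemma integral_fderiv_gradPotential (hn : 2 ≤ n) {v : Eu n → ℝ} (hv : Integrable v) {M : ℝ}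
    (hM : ∀ᵐ y, |v y| ≤ M) {F : Eu n → ℝ} (hF : IsTest F) :
    ∫ x, fderiv ℝ F x (gradPotential v x) = divConst n * ∫ y, v y * F y := by
  have hprod : Integrable (fun p : Eu n × Eu n => v p.2 * fderiv ℝ F p.1 (kern (p.1 - p.2)))
      (volume.prod volume) := by
    have hm : AEStronglyMeasurable
        (fun p : Eu n × Eu n => v p.2 * fderiv ℝ F p.1 (kern (p.1 - p.2)))
        (volume.prod volume) :=
      hv.aestronglyMeasurable.comp_snd.mul (aestronglyMeasurable_clm_apply
        (hF.continuous_fderiv.comp continuous_fst).aestronglyMeasurable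
        (measurable_kern.comp (measurable_fst.sub measurable_snd)).aestronglyMeasurable)
    rw [integrable_prod_iff hm]
    have hle : ∀ x y, ‖v y * fderiv ℝ F x (kern (x - y))‖ ≤
        ‖fderiv ℝ F x‖ * (|v y| * ‖x - y‖ ^ (1 - (n : ℝ))) := fun x y => by
      rw [norm_mul, Real.norm_eq_abs]
      have := ((fderiv ℝ F x).le_opNorm (kern (x - y))).trans
        (mul_le_mul_of_nonneg_left (norm_kern_le (x - y)) (norm_nonneg _))
      calc _ ≤ |v y| * (‖fderiv ℝ F x‖ * ‖x - y‖ ^ (1 - (n : ℝ))) := by gcongr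
        _ = _ := by ring
    have hint : ∀ x, Integrable fun y => v y * fderiv ℝ F x (kern (x - y)) := fun x => by
      refine ((integrable_abs_mul_norm_rpow hn hv hM x).const_mul ‖fderiv ℝ F x‖).mono'
        ?_ (.of_forall (hle x))
      exact hv.aestronglyMeasurable.mul ((fderiv ℝ F x).continuous.measurable.comp
        (measurable_kern.comp (measurable_const.sub measurable_id))).aestronglyMeasurable
    refine ⟨.of_forall hint, ?_⟩
    -- For fixed `x` the inner integral is at most `|∇F(x)|` times the uniform bound of the field
    -- potential with splitting radius `1`, and `∇F` is integrable.
    refine (hF.integrable_fderiv.norm.mul_const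
      (M * (sphereArea n * 1) + 1 ^ (1 - (n : ℝ)) * ∫ y, |v y|)).mono'
      hm.norm.integral_prod_right' (.of_forall fun x => ?_)
    rw [Real.norm_of_nonneg (integral_nonneg fun _ => norm_nonneg _)]
    refine (integral_mono (hint x).norm
      ((integrable_abs_mul_norm_rpow hn hv hM x).const_mul ‖fderiv ℝ F x‖) (hle x)).trans ?_
    rw [integral_const_mul]
    gcongr
    exact integral_mul_norm_rpow_le hn hv hM x one_pos
  -- The Dirac identity applied to the translate `F (· + y)`.
  have hinner : ∀ y, ∫ x, fderiv ℝ F x (kern (x - y)) = -(kernMass n * F y) := fun y => by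
    have h := integral_fderiv_kern hn (hF.comp_add_right y)
    simp_rw [fderiv_comp_add_right, zero_add] at h
    rw [← h, ← integral_add_right_eq_self _ y]
    simp
  calc ∫ x, fderiv ℝ F x (gradPotential v x)
      = ∫ x, newtonConst n * ∫ y, v y * fderiv ℝ F x (kern (x - y)) := by
        congr 1; ext x
        rw [gradPotential_eq, map_smul, smul_eq_mul,
          ← ContinuousLinearMap.integral_comp_comm _ (integrable_smul_kern hn hv hM x)]
        simp
    _ = newtonConst n * ∫ y, v y * ∫ x, fderiv ℝ F x (kern (x - y)) := by
        rw [integral_const_mul, integral_integral_swap hprod]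
        simp_rw [integral_const_mul]
    _ = _ := by
        simp_rw [hinner, mul_neg, integral_neg, divConst]
        rw [show (fun a => v a * (kernMass n * F a)) = fun a => kernMass n * (v a * F a) from
          funext fun a => by ring, integral_const_mul]
        ring

end fields

/-! ### Young's convolution inequality in `L^p`. -/

section young

variable {n : ℕ}

/-- Young's convolution inequality for an integrable kernel. -/
lemma lintegral_conv_rpow_le {k f : Eu n → ℝ≥0∞} (hk : Measurable k) (hf : AEMeasurable f)
    {p : ℝ} (hp : 1 < p) :
    ∫⁻ x, (∫⁻ y, k (x - y) * f y) ^ p ≤ (∫⁻ z, k z) ^ p * ∫⁻ y, f y ^ p := by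
  have hpq := Real.HolderConjugate.conjExponent hp
  set p' := p.conjExponent
  have hp0 : 0 < p := by linarith
  have hks (x : Eu n) : Measurable fun y => k (x - y) := hk.comp (measurable_const.sub measurable_id)
  have hsub (x : Eu n) : ∫⁻ y, k (x - y) = ∫⁻ z, k z := lintegral_sub_left_eq_self k x
  have hpt : ∀ x, (∫⁻ y, k (x - y) * f y) ^ p ≤
      (∫⁻ z, k z) ^ (p - 1) * ∫⁻ y, k (x - y) * f y ^ p := fun x => by
    -- Hölder after the factorization `k f = (k^{1/p} f) · k^{1/p'}`: the whole mass of `k` comes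
    -- out with power `p/p' = p - 1`, and Tonelli finishes.
    have h := ENNReal.lintegral_mul_le_Lp_mul_Lq volume hpq
      (f := fun y => k (x - y) ^ (1 / p) * f y) (g := fun y => k (x - y) ^ (1 / p'))
      (((hks x).pow_const _).aemeasurable.mul hf) ((hks x).pow_const _).aemeasurable
    have e1 : ∀ y, (k (x - y) ^ (1 / p) * f y) * k (x - y) ^ (1 / p') = k (x - y) * f y := fun y => by
      rw [mul_right_comm, ← ENNReal.rpow_add_of_nonneg _ _ (by positivity) (by
        have := hpq.symm.pos; positivity), one_div, one_div, hpq.inv_add_inv_eq_one,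
        ENNReal.rpow_one]
    have e2 : ∀ y, (k (x - y) ^ (1 / p) * f y) ^ p = k (x - y) * f y ^ p := fun y => by
      rw [ENNReal.mul_rpow_of_nonneg _ _ hp0.le, ← ENNReal.rpow_mul, one_div_mul_cancel hp0.ne',
        ENNReal.rpow_one]
    have e3 : ∀ y, (k (x - y) ^ (1 / p')) ^ p' = k (x - y) := fun y => by
      rw [← ENNReal.rpow_mul, one_div_mul_cancel hpq.symm.pos.ne', ENNReal.rpow_one]
    simp only [Pi.mul_apply, e1, e2, e3, hsub] at h
    calc _ ≤ _ := ENNReal.rpow_le_rpow h hp0.le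
      _ = _ := by
        rw [ENNReal.mul_rpow_of_nonneg _ _ hp0.le, ← ENNReal.rpow_mul, ← ENNReal.rpow_mul,
          one_div_mul_cancel hp0.ne', ENNReal.rpow_one, mul_comm]
        congr 2
        rw [one_div, ← hpq.one_sub_inv, sub_mul, inv_mul_cancel₀ hp0.ne', one_mul]
  calc _ ≤ ∫⁻ x, (∫⁻ z, k z) ^ (p - 1) * ∫⁻ y, k (x - y) * f y ^ p := lintegral_mono hpt
    _ = (∫⁻ z, k z) ^ (p - 1) * ∫⁻ y, ∫⁻ x, k (x - y) * f y ^ p := by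
      have hm : AEMeasurable (fun z : Eu n × Eu n => k (z.1 - z.2) * f z.2 ^ p)
          (volume.prod volume) :=
        (hk.comp (measurable_fst.sub measurable_snd)).aemeasurable.mul
          ((hf.comp_quasiMeasurePreserving Measure.quasiMeasurePreserving_snd).pow_const p)
      rw [lintegral_const_mul'' _ (AEMeasurable.lintegral_prod_right' hm),
        lintegral_lintegral_swap hm]
    _ = (∫⁻ z, k z) ^ (p - 1) * ((∫⁻ z, k z) * ∫⁻ y, f y ^ p) := by
      congr 1
      rw [← lintegral_const_mul'' _ (hf.pow_const p)]
      refine lintegral_congr fun y => ?_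
      have hky : Measurable fun x => k (x - y) := hk.comp (measurable_id.sub measurable_const)
      rw [lintegral_mul_const _ hky, lintegral_sub_right_eq_self k y]
    _ = _ := by
      rw [← mul_assoc]
      congr 1
      conv_lhs => rw [← ENNReal.rpow_one (∫⁻ z, k z), ← ENNReal.rpow_mul, one_mul]
      rw [← ENNReal.rpow_add_of_nonneg _ _ (by linarith) (by norm_num)]
      congr 1; ring

end young

/-! ### Polynomial decay of increments, and increments of functions with a square integrable
gradient. -/

section differences

variable {n : ℕ}

/-- Peetre's inequality, from `1+|x| ≤ (1+|y|)(1+|x+y|)`. It lets polynomial decay survive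
translations. -/
lemma rpow_one_add_norm_add_le {s : ℝ} (hs : s ≤ 0) (x y : Eu n) :
    (1 + ‖x + y‖) ^ s ≤ (1 + ‖y‖) ^ (-s) * (1 + ‖x‖) ^ s := by
  have h : 1 + ‖x‖ ≤ (1 + ‖y‖) * (1 + ‖x + y‖) := by
    have : ‖x‖ ≤ ‖x + y‖ + ‖y‖ := by
      simpa using norm_sub_le (x + y) y
    nlinarith [norm_nonneg y, norm_nonneg (x + y)]
  have h2 := Real.rpow_le_rpow_of_nonpos (by positivity) h hs
  rw [Real.mul_rpow (by positivity) (by positivity)] at h2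
  calc _ = (1 + ‖y‖) ^ (-s) * ((1 + ‖y‖) ^ s * (1 + ‖x + y‖) ^ s) := by
        rw [← mul_assoc, ← Real.rpow_add (by positivity), neg_add_cancel, Real.rpow_zero, one_mul]
    _ ≤ _ := by gcongr

/-- Convolution with a density supported in a ball preserves polynomial decay, by Peetre's
inequality over the support. -/
lemma norm_integral_smul_le_decay {G : Type*} [NormedAddCommGroup G] [NormedSpace ℝ G]
    {u : Eu n → ℝ} (hu : Integrable u) {R : ℝ}
    (hR : ∀ y, R < ‖y‖ → u y = 0) {k : Eu n → G} {C s : ℝ} (hC : 0 ≤ C) (hs : s ≤ 0)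
    (hk : ∀ z, ‖k z‖ ≤ C * (1 + ‖z‖) ^ s) (x : Eu n) :
    ‖∫ y, u y • k (x - y)‖ ≤ C * (1 + R) ^ (-s) * (∫ y, |u y|) * (1 + ‖x‖) ^ s := by
  calc _ ≤ ∫ y, |u y| * (C * (1 + R) ^ (-s) * (1 + ‖x‖) ^ s) := by
        refine norm_integral_le_of_norm_le (hu.abs.mul_const _) (.of_forall fun y => ?_)
        rw [norm_smul, Real.norm_eq_abs]
        by_cases hy : R < ‖y‖
        · simp [hR y hy]
        · gcongr
          refine (hk _).trans ?_
          rw [mul_assoc]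
          gcongr
          have := rpow_one_add_norm_add_le hs x (-y)
          rw [← sub_eq_add_neg, norm_neg] at this
          refine this.trans ?_
          gcongr
          · linarith
          · exact not_lt.1 hy
    _ = _ := by rw [integral_mul_const]; ring

/-- The mean value inequality on the segment from `z` to `z + h`, along which Peetre's inequality
keeps the decay at `z`. Increments therefore decay as fast as the derivative, one power faster than
the kernels used below. -/
lemma norm_add_sub_le_decay {G : Type*} [NormedAddCommGroup G] [NormedSpace ℝ G]
    {k : Eu n → G} {k' : Eu n → Eu n →L[ℝ] G} (hk : ∀ z, HasFDerivAt k (k' z) z) {C s : ℝ}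
    (hC : 0 ≤ C) (hs : s ≤ 0) (hk' : ∀ z, ‖k' z‖ ≤ C * (1 + ‖z‖) ^ s) (h z : Eu n) :
    ‖k (z + h) - k z‖ ≤ C * (1 + ‖h‖) ^ (-s) * ‖h‖ * (1 + ‖z‖) ^ s := by
  have := Convex.norm_image_sub_le_of_norm_hasFDerivWithin_le (𝕜 := ℝ) (f := k) (f' := k')
    (s := segment ℝ z (z + h)) (C := C * ((1 + ‖h‖) ^ (-s) * (1 + ‖z‖) ^ s))
    (fun x _ => (hk x).hasFDerivWithinAt) (fun x hx => ?_) (convex_segment _ _)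
    (left_mem_segment _ _ _) (right_mem_segment _ _ _)
  · refine this.trans_eq ?_
    rw [add_sub_cancel_left]; ring
  · refine (hk' x).trans ?_
    gcongr
    rw [segment_eq_image'] at hx
    obtain ⟨τ, hτ, rfl⟩ := hx
    refine (rpow_one_add_norm_add_le hs _ _).trans ?_
    gcongr
    · linarith
    · rw [add_sub_cancel_left, norm_smul, Real.norm_of_nonneg hτ.1]
      exact mul_le_of_le_one_left (norm_nonneg _) hτ.2

/-- A function whose gradient is square integrable is Lipschitz in the square mean. -/
lemma integral_sq_add_sub_le {P : Eu n → ℝ} {f : Eu n → Eu n} (hf : Continuous f)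
    (hP : ∀ x, HasFDerivAt P (innerSL ℝ (f x)) x) (hf2 : Integrable fun x => ‖f x‖ ^ 2) (h : Eu n) :
    Integrable (fun x => (P (x + h) - P x) ^ 2) ∧
    ∫ x, (P (x + h) - P x) ^ 2 ≤ ‖h‖ ^ 2 * ∫ x, ‖f x‖ ^ 2 := by
  have hPc : Continuous P := continuous_iff_continuousAt.2 fun x => (hP x).continuousAt
  have hcf (x : Eu n) : Continuous fun τ : ℝ => f (x + τ • h) := by fun_prop
  have hFTC : ∀ x, P (x + h) - P x = ∫ τ in (0 : ℝ)..1, inner ℝ (f (x + τ • h)) h := fun x => by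
    have hd : ∀ τ : ℝ, HasDerivAt (fun τ : ℝ => P (x + τ • h)) (inner ℝ (f (x + τ • h)) h) τ :=
      fun τ => by
        have h1 : HasDerivAt (fun τ : ℝ => x + τ • h) h τ := by
          simpa using ((hasDerivAt_id τ).smul_const h).const_add x
        exact (hP _).comp_hasDerivAt τ h1
    rw [intervalIntegral.integral_eq_sub_of_hasDerivAt (fun τ _ => hd τ)
      (((hcf x).inner continuous_const).intervalIntegrable _ _)]
    simp
  have hpt : ∀ x, (P (x + h) - P x) ^ 2 ≤ ∫ τ in Icc (0 : ℝ) 1, ‖h‖ ^ 2 * ‖f (x + τ • h)‖ ^ 2 :=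
    fun x => by
      rw [hFTC, intervalIntegral.integral_of_le zero_le_one, ← integral_Icc_eq_integral_Ioc]
      have : IsProbabilityMeasure (volume.restrict (Icc (0 : ℝ) 1)) := ⟨by simp⟩
      -- Jensen for the square on the unit interval, a probability space.
      have hJ := (even_two.convexOn_pow (𝕜 := ℝ)).map_integral_le
        (μ := volume.restrict (Icc (0 : ℝ) 1)) (f := fun τ : ℝ => inner ℝ (f (x + τ • h)) h)
        (by fun_prop) isClosed_univ (by simp)
        (((hcf x).inner continuous_const).integrableOn_Icc)
        ((((hcf x).inner continuous_const).pow 2).integrableOn_Icc)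
      refine hJ.trans (integral_mono ((((hcf x).inner continuous_const).pow 2).integrableOn_Icc)
        ((continuous_const.mul ((hcf x).norm.pow 2)).integrableOn_Icc) fun τ => ?_)
      have := abs_real_inner_le_norm (f (x + τ • h)) h
      simp only
      rw [← sq_abs, ← mul_pow, mul_comm]
      gcongr
  have hprod : Integrable (fun p : Eu n × ℝ => ‖h‖ ^ 2 * ‖f (p.1 + p.2 • h)‖ ^ 2)
      (volume.prod (volume.restrict (Icc (0 : ℝ) 1))) := by
    rw [integrable_prod_iff' (by fun_prop)]
    refine ⟨.of_forall fun τ => (hf2.comp_add_right (τ • h)).const_mul _, ?_⟩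
    have : ∀ τ : ℝ, ∫ x, ‖‖h‖ ^ 2 * ‖f (x + τ • h)‖ ^ 2‖ = ‖h‖ ^ 2 * ∫ x, ‖f x‖ ^ 2 := fun τ => by
      rw [← integral_add_right_eq_self (fun x => ‖f x‖ ^ 2) (τ • h), ← integral_const_mul]
      exact integral_congr_ae (.of_forall fun x => Real.norm_of_nonneg (by positivity))
    simp only [this]
    exact integrable_const _
  have hint : Integrable (fun x => (P (x + h) - P x) ^ 2) := by
    refine hprod.integral_prod_left.mono' (by fun_prop) (.of_forall fun x => ?_)
    rw [Real.norm_of_nonneg (sq_nonneg _)]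
    exact hpt x
  refine ⟨hint, (integral_mono hint hprod.integral_prod_left hpt).trans_eq ?_⟩
  rw [integral_integral_swap hprod]
  have : ∀ τ : ℝ, ∫ x, ‖h‖ ^ 2 * ‖f (x + τ • h)‖ ^ 2 = ‖h‖ ^ 2 * ∫ x, ‖f x‖ ^ 2 := fun τ => by
    rw [← integral_add_right_eq_self (fun x => ‖f x‖ ^ 2) (τ • h), ← integral_const_mul]
  simp [this]

/-- A potential of the regularized kernel. -/
noncomputable def kernPot (δ : ℝ) (z : Eu n) : ℝ :=
  (1 / 2) * ∫ τ in (0 : ℝ)..‖z‖ ^ 2, (τ + δ ^ 2) ^ (-(n : ℝ) / 2)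

lemma hasFDerivAt_kernPot {δ : ℝ} (hδ : 0 < δ) (z : Eu n) :
    HasFDerivAt (kernPot δ) (innerSL ℝ (kernReg δ z)) z := by
  have hpos : ∀ τ : ℝ, 0 ≤ τ → 0 < τ + δ ^ 2 := fun τ hτ => by positivity
  have hcont : ContinuousOn (fun τ : ℝ => (τ + δ ^ 2) ^ (-(n : ℝ) / 2)) (Ioi (-δ ^ 2)) := by
    refine ContinuousOn.rpow_const (by fun_prop) fun τ hτ => Or.inl ?_
    have : -δ ^ 2 < τ := hτ
    linarith
  have hz : ‖z‖ ^ 2 ∈ Ioi (-δ ^ 2) := by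
    have : 0 < δ ^ 2 := by positivity
    simp only [mem_Ioi]; nlinarith [sq_nonneg ‖z‖]
  have hG : HasDerivAt (fun s : ℝ => ∫ τ in (0 : ℝ)..s, (τ + δ ^ 2) ^ (-(n : ℝ) / 2))
      ((‖z‖ ^ 2 + δ ^ 2) ^ (-(n : ℝ) / 2)) (‖z‖ ^ 2) := by
    refine intervalIntegral.integral_hasDerivAt_right ?_
      (hcont.stronglyMeasurableAtFilter isOpen_Ioi _ hz)
      (hcont.continuousAt (isOpen_Ioi.mem_nhds hz))
    refine ContinuousOn.intervalIntegrable (hcont.mono fun τ hτ => ?_)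
    rw [uIcc_of_le (by positivity)] at hτ
    have : 0 < δ ^ 2 := by positivity
    simp only [mem_Ioi]; linarith [hτ.1]
  have h1 : HasFDerivAt (fun z : Eu n => ‖z‖ ^ 2) (2 • innerSL ℝ z) z :=
    (hasStrictFDerivAt_norm_sq z).hasFDerivAt
  refine ((hG.comp_hasFDerivAt z h1).const_mul (1 / 2)).congr_fderiv ?_
  ext w
  simp [kernReg]
  ring

end differences

/-! ### The `L²` estimate for increments of the field. -/

section energy

variable {n : ℕ}

lemma hasFDerivAt_comp_sub_right {G : Type*} [NormedAddCommGroup G] [NormedSpace ℝ G]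
    {f : Eu n → G} {f' : Eu n →L[ℝ] G} {x y : Eu n} (h : HasFDerivAt f f' (x - y)) :
    HasFDerivAt (fun x => f (x - y)) f' x := by
  simpa [Function.comp_def] using h.comp x ((hasFDerivAt_id x).sub_const y)

/-- The field of the density `u` for the regularized kernel, up to normalization. -/
noncomputable def fieldReg (δ : ℝ) (u : Eu n → ℝ) (x : Eu n) : Eu n := ∫ y, u y • kernReg δ (x - y)

lemma hasFDerivAt_fieldReg (hn : 2 ≤ n) {δ : ℝ} (hδ : 0 < δ) {u : Eu n → ℝ} (hu : Integrable u)
    (x : Eu n) : HasFDerivAt (fieldReg δ u) (∫ y, u y • kernRegDeriv δ (x - y)) x := by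
  have hn' : (2 : ℝ) ≤ n := by exact_mod_cast hn
  obtain ⟨C, hC0, hC⟩ := exists_norm_kernReg_le (n := n) hδ
  obtain ⟨C', hC0', hC'⟩ := exists_norm_kernRegDeriv_le (n := n) hδ
  have hb : ∀ z : Eu n, ‖kernReg δ z‖ ≤ C := fun z => (hC z).trans
    (mul_le_of_le_one_right hC0 (one_add_norm_rpow_le_one (by linarith) z))
  have hb' : ∀ z : Eu n, ‖kernRegDeriv δ z‖ ≤ C' := fun z => (hC' z).trans
    (mul_le_of_le_one_right hC0' (one_add_norm_rpow_le_one (by linarith) z))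
  have hm (x : Eu n) : AEStronglyMeasurable fun y => u y • kernReg δ (x - y) :=
    hu.aestronglyMeasurable.smul
      ((continuous_kernReg hδ).comp (by fun_prop)).aestronglyMeasurable
  refine hasFDerivAt_integral_of_dominated_of_fderiv_le (s := univ) (bound := fun y => |u y| * C')
    (F' := fun x y => u y • kernRegDeriv δ (x - y)) univ_mem (.of_forall hm) ?_ ?_ ?_ ?_ ?_
  · refine (hu.abs.mul_const C).mono' (hm x) (.of_forall fun y => ?_)
    rw [norm_smul, Real.norm_eq_abs]
    gcongr
    exact hb _
  · exact hu.aestronglyMeasurable.smul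
      ((continuous_kernRegDeriv hδ).comp (by fun_prop)).aestronglyMeasurable
  · refine .of_forall fun y x _ => ?_
    rw [norm_smul, Real.norm_eq_abs]
    gcongr
    exact hb' _
  · exact hu.abs.mul_const _
  · refine .of_forall fun y x _ => ?_
    exact (hasFDerivAt_comp_sub_right (hasFDerivAt_kernReg hδ (x - y))).const_smul (u y)

/-- The increment of the potential of the field `fieldReg`. -/
noncomputable def potDiff (δ : ℝ) (u : Eu n → ℝ) (h x : Eu n) : ℝ :=
  ∫ y, u y * (kernPot δ (x - y + h) - kernPot δ (x - y))

lemma norm_kernPot_add_sub_le (hn : 2 ≤ n) {δ : ℝ} (hδ : 0 < δ) :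
    ∃ C, 0 ≤ C ∧ ∀ h z : Eu n, ‖kernPot δ (z + h) - kernPot δ z‖ ≤
      C * (1 + ‖h‖) ^ (-(1 - (n : ℝ))) * ‖h‖ * (1 + ‖z‖) ^ (1 - (n : ℝ)) := by
  have hn' : (2 : ℝ) ≤ n := by exact_mod_cast hn
  obtain ⟨C, hC0, hC⟩ := exists_norm_kernReg_le (n := n) hδ
  refine ⟨C, hC0, fun h z => ?_⟩
  exact norm_add_sub_le_decay (hasFDerivAt_kernPot hδ) hC0 (by linarith)
    (fun z => by rw [innerSL_apply_norm]; exact hC z) h z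

lemma integrable_smul_kernReg (hn : 2 ≤ n) {δ : ℝ} (hδ : 0 < δ) {u : Eu n → ℝ} (hu : Integrable u)
    (x : Eu n) : Integrable fun y => u y • kernReg δ (x - y) := by
  have hn' : (2 : ℝ) ≤ n := by exact_mod_cast hn
  obtain ⟨C, hC0, hC⟩ := exists_norm_kernReg_le (n := n) hδ
  have hb : ∀ z : Eu n, ‖kernReg δ z‖ ≤ C := fun z => (hC z).trans
    (mul_le_of_le_one_right hC0 (one_add_norm_rpow_le_one (by linarith) z))
  refine (hu.abs.mul_const C).mono' (hu.aestronglyMeasurable.smul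
      ((continuous_kernReg hδ).comp (by fun_prop)).aestronglyMeasurable) (.of_forall fun y => ?_)
  rw [norm_smul, Real.norm_eq_abs]
  gcongr
  exact hb _

/-- The increment of the field is a gradient. The increment of the potential is used because the
potential itself need not decay (it grows logarithmically when `n = 2`), whereas its increments
decay like `|x|^{1-n}`. -/
lemma hasFDerivAt_potDiff (hn : 2 ≤ n) {δ : ℝ} (hδ : 0 < δ) {u : Eu n → ℝ} (hu : Integrable u)
    (h x : Eu n) : HasFDerivAt (potDiff δ u h)
      (innerSL ℝ (fieldReg δ u (x + h) - fieldReg δ u x)) x := by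
  have hn' : (2 : ℝ) ≤ n := by exact_mod_cast hn
  obtain ⟨C, hC0, hC⟩ := exists_norm_kernReg_le (n := n) hδ
  obtain ⟨C', hC0', hC'⟩ := norm_kernPot_add_sub_le (n := n) hn hδ
  have hb : ∀ z : Eu n, ‖kernReg δ z‖ ≤ C := fun z => (hC z).trans
    (mul_le_of_le_one_right hC0 (one_add_norm_rpow_le_one (by linarith) z))
  have hNc : Continuous (kernPot (n := n) δ) :=
    continuous_iff_continuousAt.2 fun x => (hasFDerivAt_kernPot hδ x).continuousAt
  have hm (x : Eu n) :
      AEStronglyMeasurable fun y => u y * (kernPot δ (x - y + h) - kernPot δ (x - y)) :=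
    hu.aestronglyMeasurable.mul (by fun_prop : Continuous fun y =>
      kernPot δ (x - y + h) - kernPot δ (x - y)).aestronglyMeasurable
  have hcK := continuous_kernReg (n := n) hδ
  have hint : Integrable fun y => u y • (kernReg δ (x - y + h) - kernReg δ (x - y)) := by
    simp_rw [smul_sub, sub_add_eq_add_sub]
    exact (integrable_smul_kernReg hn hδ hu (x + h)).sub (integrable_smul_kernReg hn hδ hu x)
  have hval : innerSL ℝ (fieldReg δ u (x + h) - fieldReg δ u x) =
      ∫ y, u y • innerSL ℝ (kernReg δ (x - y + h) - kernReg δ (x - y)) := by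
    rw [fieldReg, fieldReg, ← integral_sub (integrable_smul_kernReg hn hδ hu (x + h))
      (integrable_smul_kernReg hn hδ hu x), ← ContinuousLinearMap.integral_comp_comm]
    · congr 1; ext y : 1
      rw [← smul_sub, map_smul, sub_add_eq_add_sub]
    · exact (integrable_smul_kernReg hn hδ hu (x + h)).sub (integrable_smul_kernReg hn hδ hu x)
  rw [hval]
  refine hasFDerivAt_integral_of_dominated_of_fderiv_le (s := univ)
    (bound := fun y => |u y| * (C + C))
    (F' := fun x y => u y • innerSL ℝ (kernReg δ (x - y + h) - kernReg δ (x - y)))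
    univ_mem (.of_forall hm) ?_ ?_ ?_ ?_ ?_
  · refine (hu.abs.mul_const (C' * (1 + ‖h‖) ^ (-(1 - (n : ℝ))) * ‖h‖)).mono' (hm x)
      (.of_forall fun y => ?_)
    rw [norm_mul, Real.norm_eq_abs]
    gcongr
    refine (hC' h (x - y)).trans (mul_le_of_le_one_right (by positivity)
      (one_add_norm_rpow_le_one (by linarith) _))
  · exact hu.aestronglyMeasurable.smul
      (((innerSL ℝ).continuous.comp (by fun_prop : Continuous fun y =>
        kernReg δ (x - y + h) - kernReg δ (x - y)))).aestronglyMeasurable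
  · refine .of_forall fun y x _ => ?_
    rw [norm_smul, Real.norm_eq_abs, innerSL_apply_norm]
    gcongr
    exact (norm_sub_le _ _).trans (add_le_add (hb _) (hb _))
  · exact hu.abs.mul_const _
  · refine .of_forall fun y x _ => ?_
    have h1 : HasFDerivAt (fun x => kernPot δ (x - y + h)) (innerSL ℝ (kernReg δ (x - y + h))) x := by
      have := (hasFDerivAt_kernPot hδ (x - y + h)).comp x
        (((hasFDerivAt_id x).sub_const y).add_const h)
      simpa [Function.comp_def] using this
    have h2 := hasFDerivAt_comp_sub_right (hasFDerivAt_kernPot hδ (x - y))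
    rw [map_sub]
    exact (h1.sub h2).const_mul (u y)

lemma integrable_of_norm_le_decay {G : Type*} [NormedAddCommGroup G]
    {k : Eu n → G} (hk : Continuous k) {C s : ℝ} (hs : s < -(n : ℝ))
    (h : ∀ z, ‖k z‖ ≤ C * (1 + ‖z‖) ^ s) : Integrable k :=
  ((integrable_one_add_norm_rpow hs).const_mul C).mono' hk.aestronglyMeasurable (.of_forall h)

/-- The energy estimate: the increments of the regularized field in the square mean. -/
lemma integral_sq_fieldReg_add_sub_le (hn : 2 ≤ n) {δ : ℝ} (hδ : 0 < δ) {u : Eu n → ℝ}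
    (hu : Integrable u) (hu2 : Integrable fun y => u y ^ 2) {R : ℝ}
    (hR : ∀ y, R < ‖y‖ → u y = 0) (h : Eu n) :
    Integrable (fun x => ‖fieldReg δ u (x + h) - fieldReg δ u x‖ ^ 2) ∧
    ∫ x, ‖fieldReg δ u (x + h) - fieldReg δ u x‖ ^ 2 ≤
      (kernMass n * ‖h‖) ^ 2 * ∫ y, u y ^ 2 := by
  have hn' : (2 : ℝ) ≤ n := by exact_mod_cast hn
  have hn0 : -(n : ℝ) ≤ 0 := by linarith
  obtain ⟨C1, hC10, hC1⟩ := exists_norm_kernRegDeriv_le (n := n) hδ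
  obtain ⟨C2, hC20, hC2⟩ := norm_kernPot_add_sub_le (n := n) hn hδ
  obtain ⟨C3, hC30, hC3⟩ := exists_rpow_sq_add_sq_le (n := n) hδ (-(n : ℝ) / 2 - 1) (by linarith)
  set f : Eu n → Eu n := fun x => fieldReg δ u (x + h) - fieldReg δ u x with hf
  set D : Eu n → Eu n →L[ℝ] Eu n := fun x => ∫ y, u y • kernRegDeriv δ (x - y) with hD
  set P : Eu n → ℝ := potDiff δ u h with hP
  set g : Eu n → ℝ := fun x => ∫ y, u y * kernDens δ (x - y) with hg
  have hdB : ∀ x, HasFDerivAt (fieldReg δ u) (D x) x := hasFDerivAt_fieldReg hn hδ hu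
  have hdP : ∀ x, HasFDerivAt P (innerSL ℝ (f x)) x := hasFDerivAt_potDiff hn hδ hu h
  have hdf : ∀ x, HasFDerivAt f (D (x + h) - D x) x := fun x => by
    refine HasFDerivAt.sub ?_ (hdB x)
    simpa [Function.comp_def] using (hdB (x + h)).comp x ((hasFDerivAt_id x).add_const h)
  have hBc : Continuous (fieldReg δ u) :=
    continuous_iff_continuousAt.2 fun x => (hdB x).continuousAt
  have hfc : Continuous f := (hBc.comp (continuous_id.add continuous_const)).sub hBc
  have hPc : Continuous P := continuous_iff_continuousAt.2 fun x => (hdP x).continuousAt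
  have hDm : Measurable D := by
    have : D = fderiv ℝ (fieldReg δ u) := funext fun x => (hdB x).fderiv.symm
    rw [this]; exact measurable_fderiv ℝ _
  obtain ⟨CD, hCD0, hCD⟩ : ∃ C, 0 ≤ C ∧ ∀ x, ‖D x‖ ≤ C * (1 + ‖x‖) ^ (-(n : ℝ)) :=
    ⟨_, by positivity, fun x => (norm_integral_smul_le_decay hu (R := |R|)
      (fun y hy => hR y ((le_abs_self R).trans_lt hy)) hC10 hn0 hC1 x)⟩
  obtain ⟨Cf, hCf0, hCf⟩ : ∃ C, 0 ≤ C ∧ ∀ x, ‖f x‖ ≤ C * (1 + ‖x‖) ^ (-(n : ℝ)) :=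
    ⟨_, by positivity, fun x => norm_add_sub_le_decay hdB hCD0 hn0 hCD h x⟩
  obtain ⟨CP, hCP0, hCP⟩ : ∃ C, 0 ≤ C ∧ ∀ x, ‖P x‖ ≤ C * (1 + ‖x‖) ^ (1 - (n : ℝ)) :=
    ⟨_, by positivity, fun x => (norm_integral_smul_le_decay hu (R := |R|)
      (k := fun z => kernPot δ (z + h) - kernPot δ z)
      (fun y hy => hR y ((le_abs_self R).trans_lt hy)) (by positivity) (by linarith) (hC2 h) x)⟩
  obtain ⟨Cg, hCg0, hCg⟩ : ∃ C, 0 ≤ C ∧ ∀ x, ‖g x‖ ≤ C * (1 + ‖x‖) ^ (-(n : ℝ) - 2) := by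
    refine ⟨_, ?_, fun x => (norm_integral_smul_le_decay hu (R := |R|)
      (k := kernDens δ) (C := n * δ ^ 2 * C3) (s := -(n : ℝ) - 2)
      (fun y hy => hR y ((le_abs_self R).trans_lt hy)) (by positivity) (by linarith)
      (fun z => ?_) x)⟩
    · positivity
    · rw [Real.norm_of_nonneg (kernDens_nonneg _ _), kernDens, mul_assoc (n * δ ^ 2)]
      gcongr
      exact (hC3 z).trans_eq (by congr 2; ring)
  have hgc : Continuous g := by
    refine continuous_of_dominated (bound := fun y => |u y| * (n * δ ^ 2 * C3)) (fun x => ?_)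
      (fun x => .of_forall fun y => ?_) (hu.abs.mul_const _) (.of_forall fun y => ?_)
    · exact hu.aestronglyMeasurable.mul
        ((continuous_kernDens hδ).comp (by fun_prop)).aestronglyMeasurable
    · rw [norm_mul, Real.norm_eq_abs, Real.norm_of_nonneg (kernDens_nonneg _ _), kernDens]
      gcongr
      refine (hC3 _).trans (mul_le_of_le_one_right hC30 (one_add_norm_rpow_le_one (by linarith) _))
    · exact continuous_const.mul ((continuous_kernDens hδ).comp (by fun_prop))
  have hmulle : ∀ (a b s t : ℝ) (x : Eu n), a * (1 + ‖x‖) ^ s * (b * (1 + ‖x‖) ^ t) =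
      a * b * (1 + ‖x‖) ^ (s + t) := fun a b s t x => by
    rw [Real.rpow_add (by positivity)]; ring
  have hf2 : Integrable fun x => ‖f x‖ ^ 2 := by
    refine integrable_of_norm_le_decay (hfc.norm.pow 2) (C := Cf * Cf) (s := -(n : ℝ) + -(n : ℝ))
      (by linarith) fun x => ?_
    rw [← hmulle, Real.norm_of_nonneg (by positivity), sq]
    gcongr <;> exact hCf x
  have hg2 : Integrable fun x => g x ^ 2 := by
    refine integrable_of_norm_le_decay (hgc.pow 2) (C := Cg * Cg)
      (s := (-(n : ℝ) - 2) + (-(n : ℝ) - 2)) (by linarith) fun x => ?_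
    rw [← hmulle, norm_pow, sq]
    gcongr <;> exact hCg x
  have htrace : ∀ x, ∑ j, (D (x + h) - D x) (EuclideanSpace.single j 1) j = g (x + h) - g x := by
    have hint : ∀ x, Integrable fun y => u y • kernRegDeriv δ (x - y) := fun x => by
      refine (hu.abs.mul_const C1).mono' (hu.aestronglyMeasurable.smul
        ((continuous_kernRegDeriv hδ).comp (by fun_prop)).aestronglyMeasurable)
        (.of_forall fun y => ?_)
      rw [norm_smul, Real.norm_eq_abs]
      gcongr
      exact (hC1 _).trans (mul_le_of_le_one_right hC10 (one_add_norm_rpow_le_one hn0 _))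
    let T : (Eu n →L[ℝ] Eu n) →L[ℝ] ℝ := ∑ j, (EuclideanSpace.proj j : Eu n →L[ℝ] ℝ).comp
      (ContinuousLinearMap.apply ℝ (Eu n) (EuclideanSpace.single j (1 : ℝ)))
    have hT : ∀ A, T A = ∑ j, A (EuclideanSpace.single j 1) j := fun A => by simp [T]
    have hTD : ∀ x, T (D x) = g x := fun x => by
      rw [hD, ← ContinuousLinearMap.integral_comp_comm _ (hint x)]
      congr 1; ext y
      rw [map_smul, hT, sum_kernRegDeriv hδ, smul_eq_mul]
    intro x
    rw [← hT, map_sub, hTD, hTD]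
  -- The decays `-n` of the field increment and `1-n` of the potential add up to `1-2n`, which is
  -- below `-n` because `n ≥ 2`.
  have hdecay2 : ∀ (k : Eu n → ℝ), AEStronglyMeasurable k → ∀ C, (∀ x, ‖k x‖ ≤ C * (1 + ‖x‖) ^
      (-(n : ℝ) + (1 - (n : ℝ)))) → Integrable k := fun k hk C hC =>
    ((integrable_one_add_norm_rpow (by linarith)).const_mul C).mono' hk (.of_forall hC)
  have hPmeas := hPc.aestronglyMeasurable (μ := volume)
  -- As `f = ∇P`, the divergence theorem turns `∫ |f|²` into minus the integral of `P` against the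
  -- increment of the mollified density `g`.
  have hdiv : ∫ x, fderiv ℝ P x (f x) =
      -∫ x, (∑ j, (D (x + h) - D x) (EuclideanSpace.single j 1) j) * P x := by
    refine integral_fderiv_apply_eq_neg_div (fun x => (hdP x).differentiableAt) hdf ?_ ?_ ?_
    · intro j
      have hfd : ∀ x, fderiv ℝ P x (EuclideanSpace.single j 1) = f x j := fun x => by
        rw [(hdP x).fderiv, innerSL_apply_apply, EuclideanSpace.inner_single_right]; simp
      simp_rw [hfd]
      refine hf2.mono' ((continuous_apply_coord hfc j).mul
        (continuous_apply_coord hfc j)).aestronglyMeasurable (.of_forall fun x => ?_)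
      rw [norm_mul, sq]
      gcongr <;> exact PiLp.norm_apply_le _ _
    · intro j
      refine hdecay2 _ ?_ ((CD * (1 + ‖h‖) ^ (n : ℝ) + CD) * CP) fun x => ?_
      · refine AEStronglyMeasurable.mul ?_ hPmeas
        have h1 : Measurable fun x => (D (x + h) - D x) (EuclideanSpace.single j 1) :=
          ((hDm.comp (measurable_id.add measurable_const)).sub hDm).apply_continuousLinearMap _
        exact ((EuclideanSpace.proj j : Eu n →L[ℝ] ℝ).continuous.measurable.comp
          h1).aestronglyMeasurable
      · rw [← hmulle, norm_mul]
        gcongr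
        · refine (norm_apply_single_le _ _).trans ((norm_sub_le _ _).trans ?_)
          rw [add_mul]
          refine add_le_add ((hCD _).trans ?_) (hCD x)
          have := rpow_one_add_norm_add_le hn0 x h
          rw [neg_neg] at this
          calc _ ≤ CD * ((1 + ‖h‖) ^ (n : ℝ) * (1 + ‖x‖) ^ (-(n : ℝ))) := by gcongr
            _ = _ := by ring
        · exact hCP x
    · intro j
      refine hdecay2 _ ((continuous_apply_coord hfc j).mul hPc).aestronglyMeasurable
        (Cf * CP) fun x => ?_
      rw [← hmulle, norm_mul]
      gcongr
      · exact (PiLp.norm_apply_le _ _).trans (hCf x)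
      · exact hCP x
  have hPd : ∀ x, fderiv ℝ P x (f x) = ‖f x‖ ^ 2 := fun x => by
    rw [(hdP x).fderiv, innerSL_apply_apply, real_inner_self_eq_norm_sq]
  simp_rw [hPd, htrace] at hdiv
  have hgP : ∀ k : Eu n, Integrable fun x => g x * P (x + k) := fun k => by
    have hg1 : Integrable g := integrable_of_norm_le_decay hgc (by linarith) hCg
    refine (hg1.norm.mul_const CP).mono' (hgc.mul (hPc.comp (by fun_prop))).aestronglyMeasurable
      (.of_forall fun x => ?_)
    rw [norm_mul]
    gcongr
    exact (hCP _).trans (mul_le_of_le_one_right hCP0 (one_add_norm_rpow_le_one (by linarith) _))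
  -- Summation by parts moves the increment from `g`, which is controlled only in size, to `P`,
  -- whose increments are controlled by `f`.
  have hX : ∫ x, ‖f x‖ ^ 2 = ∫ x, g x * -(P (x + -h) - P x) := by
    have e1 : ∫ x, g (x + h) * P x = ∫ x, g x * P (x + -h) := by
      rw [← integral_add_right_eq_self (fun x => g x * P (x + -h)) h]
      simp
    have i1 : Integrable fun x => g (x + h) * P x := by
      simpa using (hgP (-h)).comp_add_right h
    have i2 : Integrable fun x => g x * P x := by simpa using hgP 0
    rw [hdiv]
    simp_rw [sub_mul, neg_sub, mul_sub]
    rw [integral_sub i1 i2, integral_sub i2 (hgP _), e1]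
    ring
  obtain ⟨hw2, hw⟩ := integral_sq_add_sub_le hfc hdP hf2 (-h)
  rw [norm_neg] at hw
  -- Young's inequality: `g` is the convolution of `u` with a density of mass `kernMass n`.
  have hgu : ∫ x, g x ^ 2 ≤ kernMass n ^ 2 * ∫ y, u y ^ 2 := by
    have hY := lintegral_conv_rpow_le (n := n) (k := fun z => ENNReal.ofReal (kernDens δ z))
      (f := fun y => ‖u y‖ₑ) (continuous_kernDens hδ).measurable.ennreal_ofReal
      hu.aestronglyMeasurable.enorm one_lt_two
    rw [← ofReal_integral_eq_lintegral_ofReal (integrable_kernDens hδ)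
      (.of_forall (kernDens_nonneg δ)), integral_kernDens hδ] at hY
    have hsq : ∀ w : ℝ, ENNReal.ofReal (w ^ 2) = ‖w‖ₑ ^ (2 : ℝ) := fun w => by
      rw [← sq_abs, ENNReal.ofReal_pow (abs_nonneg _), Real.enorm_eq_ofReal_abs]
      norm_num
    rw [← ENNReal.ofReal_le_ofReal_iff (by positivity),
      ENNReal.ofReal_mul (by positivity), ofReal_integral_eq_lintegral_ofReal hg2
        (.of_forall fun _ => sq_nonneg _), ofReal_integral_eq_lintegral_ofReal hu2
        (.of_forall fun _ => sq_nonneg _), hsq, Real.enorm_of_nonneg (kernMass_nonneg n)]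
    simp_rw [hsq]
    refine le_trans (lintegral_mono fun x => ?_) hY
    refine ENNReal.rpow_le_rpow ((enorm_integral_le_lintegral_enorm _).trans_eq ?_) (by norm_num)
    refine lintegral_congr fun y => ?_
    rw [enorm_mul, Real.enorm_of_nonneg (kernDens_nonneg _ _), mul_comm]
  refine ⟨hf2, ?_⟩
  rcases eq_or_ne h 0 with rfl | hh
  · simp
  have hh' : 0 < ‖h‖ ^ 2 := by have := norm_pos_iff.2 hh; positivity
  -- The inequality of the means weighted by `‖h‖²`. By `hw` the last integral is at most `‖h‖² ∫
  -- ‖f‖²`, so it is absorbed on the left.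
  have hAM : 2 * ‖h‖ ^ 2 * ∫ x, ‖f x‖ ^ 2 ≤
      ‖h‖ ^ 4 * (∫ x, g x ^ 2) + ∫ x, (P (x + -h) - P x) ^ 2 := by
    rw [hX, ← integral_const_mul, ← integral_const_mul, ← integral_add (hg2.const_mul _) hw2]
    refine integral_mono ?_ ((hg2.const_mul _).add hw2) fun x => ?_
    · refine Integrable.const_mul ?_ _
      have := ((by simpa using hgP 0 : Integrable fun x => g x * P x)).sub (hgP (-h))
      refine this.congr (.of_forall fun x => ?_)
      simp only [Pi.sub_apply]; ring
    · simp only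
      nlinarith [sq_nonneg (‖h‖ ^ 2 * g x + (P (x + -h) - P x))]
  have : ‖h‖ ^ 2 * ∫ x, ‖f x‖ ^ 2 ≤ ‖h‖ ^ 2 * ((kernMass n * ‖h‖) ^ 2 * ∫ y, u y ^ 2) := by
    have := mul_le_mul_of_nonneg_left hgu (by positivity : 0 ≤ ‖h‖ ^ 4)
    nlinarith
  exact le_of_mul_le_mul_left this hh'

lemma ofReal_sq_eq_enorm_rpow {G : Type*} [NormedAddCommGroup G] (w : G) :
    ENNReal.ofReal (‖w‖ ^ 2) = ‖w‖ₑ ^ (2 : ℝ) := by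
  rw [ENNReal.ofReal_pow (norm_nonneg _), ofReal_norm]
  norm_num

lemma integrable_sq_of_bounded {v : Eu n → ℝ} (hv : Integrable v) {M : ℝ}
    (hM : ∀ᵐ y, |v y| ≤ M) : Integrable fun y => v y ^ 2 := by
  refine (hv.norm.const_mul M).mono' (hv.aestronglyMeasurable.pow 2) ?_
  filter_upwards [hM] with y hy
  rw [norm_pow, sq, Real.norm_eq_abs]
  gcongr

/-- The increments of the field are controlled in the square mean by the density. -/
lemma lintegral_sq_gradPotential_add_sub_le (hn : 2 ≤ n) {v : Eu n → ℝ}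
    (hv : Integrable v) {M : ℝ} (hM : ∀ᵐ y, |v y| ≤ M) (h : Eu n) :
    ∫⁻ x, ‖gradPotential v (x + h) - gradPotential v x‖ₑ ^ (2 : ℝ) ≤
      ENNReal.ofReal ((|newtonConst n| * kernMass n * ‖h‖) ^ 2) * ∫⁻ y, ‖v y‖ₑ ^ (2 : ℝ) := by
  -- Cutting `v` to the ball of radius `k` supplies the compact support needed for decay. The bound
  -- is independent of the cut and of `δ`, so Fatou's lemma passes to the limit.
  set u : ℕ → Eu n → ℝ := fun k => (closedBall (0 : Eu n) k).indicator v with hu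
  set δ : ℕ → ℝ := fun k => 1 / ((k : ℝ) + 1) with hδ
  have hδ0 : ∀ k, 0 < δ k := fun k => by simp only [hδ]; positivity
  have hui : ∀ k, Integrable (u k) := fun k => hv.indicator measurableSet_closedBall
  have hule : ∀ k y, ‖u k y‖ ≤ ‖v y‖ := fun k y => norm_indicator_le_norm_self _ _
  have hlim : ∀ x, Tendsto (fun k => newtonConst n • fieldReg (δ k) (u k) x) atTop
      (𝓝 (gradPotential v x)) := fun x => by
    rw [gradPotential_eq]
    refine Tendsto.const_smul ?_ _
    refine tendsto_integral_of_dominated_convergence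
      (fun y => |v y| * ‖x - y‖ ^ (1 - (n : ℝ)))
      (fun k => (integrable_smul_kernReg hn (hδ0 k) (hui k) x).aestronglyMeasurable)
      (integrable_abs_mul_norm_rpow hn hv hM x) (fun k => .of_forall fun y => ?_)
      (.of_forall fun y => ?_)
    · rw [norm_smul, ← Real.norm_eq_abs]
      gcongr
      · exact hule k y
      · exact norm_kernReg_le _ _
    · have h1 : Tendsto (fun k => u k y) atTop (𝓝 (v y)) := by
        refine tendsto_const_nhds.congr' ?_
        filter_upwards [eventually_ge_atTop ⌈‖y‖⌉₊] with k hk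
        rw [hu]
        simp only
        rw [indicator_of_mem]
        simpa using (Nat.le_ceil ‖y‖).trans (by exact_mod_cast hk)
      exact h1.smul ((tendsto_kernReg (x - y)).comp tendsto_one_div_add_atTop_nhds_zero_nat)
  have hbound : ∀ k, ∫⁻ x, ‖newtonConst n • fieldReg (δ k) (u k) (x + h) -
      newtonConst n • fieldReg (δ k) (u k) x‖ₑ ^ (2 : ℝ) ≤
      ENNReal.ofReal ((|newtonConst n| * kernMass n * ‖h‖) ^ 2) * ∫⁻ y, ‖v y‖ₑ ^ (2 : ℝ) := by
    intro k
    have hv2 : Integrable fun y => ‖v y‖ ^ 2 := by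
      simpa only [Real.norm_eq_abs, sq_abs] using integrable_sq_of_bounded hv hM
    have hu2 : Integrable fun y => u k y ^ 2 := integrable_sq_of_bounded (M := M) (hui k) (by
      filter_upwards [hM] with y hy using (hule k y).trans hy)
    obtain ⟨hi, hle⟩ := integral_sq_fieldReg_add_sub_le hn (hδ0 k) (hui k) hu2 (R := k)
      (fun y hy => indicator_of_notMem (by simpa using hy) _) h
    simp_rw [← ofReal_sq_eq_enorm_rpow, ← smul_sub, norm_smul, mul_pow]
    rw [← ofReal_integral_eq_lintegral_ofReal (hi.const_mul _) (.of_forall fun _ => by positivity),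
      ← ofReal_integral_eq_lintegral_ofReal hv2 (.of_forall fun _ => by positivity),
      ← ENNReal.ofReal_mul (by positivity), integral_const_mul]
    refine ENNReal.ofReal_le_ofReal ?_
    have h2 : ∫ y, u k y ^ 2 ≤ ∫ y, ‖v y‖ ^ 2 := by
      refine integral_mono hu2 hv2 fun y => ?_
      simp only
      rw [← sq_abs]
      exact pow_le_pow_left₀ (abs_nonneg _) (hule k y) 2
    calc _ ≤ ‖newtonConst n‖ ^ 2 * ((kernMass n * ‖h‖) ^ 2 * ∫ y, u k y ^ 2) := by gcongr
      _ ≤ ‖newtonConst n‖ ^ 2 * ((kernMass n * ‖h‖) ^ 2 * ∫ y, ‖v y‖ ^ 2) := by gcongr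
      _ = _ := by rw [Real.norm_eq_abs]; ring
  have hmeas : ∀ k, AEMeasurable fun x => ‖newtonConst n • fieldReg (δ k) (u k) (x + h) -
      newtonConst n • fieldReg (δ k) (u k) x‖ₑ ^ (2 : ℝ) := fun k => by
    have hc : Continuous (fieldReg (δ k) (u k)) := continuous_iff_continuousAt.2 fun x =>
      (hasFDerivAt_fieldReg hn (hδ0 k) (hui k) x).continuousAt
    have : Continuous fun x => newtonConst n • fieldReg (δ k) (u k) (x + h) -
      newtonConst n • fieldReg (δ k) (u k) x := by fun_prop
    exact (this.measurable.enorm.pow_const _).aemeasurable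
  calc _ = ∫⁻ x, liminf (fun k => ‖newtonConst n • fieldReg (δ k) (u k) (x + h) -
      newtonConst n • fieldReg (δ k) (u k) x‖ₑ ^ (2 : ℝ)) atTop := by
        refine lintegral_congr fun x => (Tendsto.liminf_eq ?_).symm
        exact ((ENNReal.continuous_rpow_const.comp continuous_enorm).tendsto _).comp
          ((hlim (x + h)).sub (hlim x))
    _ ≤ liminf (fun k => ∫⁻ x, ‖newtonConst n • fieldReg (δ k) (u k) (x + h) -
      newtonConst n • fieldReg (δ k) (u k) x‖ₑ ^ (2 : ℝ)) atTop := lintegral_liminf_le' hmeas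
    _ ≤ _ := liminf_le_of_le (by isBoundedDefault) fun b hb => by
        obtain ⟨k, hk⟩ := hb.exists
        exact hk.trans (hbound k)

end energy

/-! ### The Lévy–Khintchine formula and the singular integral form of the fractional Laplacian. -/

section symbol

variable {n : ℕ} {θ : ℝ}

/-- The kernel `|z|^{-n-θ}` of the fractional Laplacian, up to normalization. -/
noncomputable def levyKer (θ : ℝ) (z : Eu n) : ℝ := ‖z‖ ^ (-((n : ℝ) + θ))

lemma levyKer_nonneg (θ : ℝ) (z : Eu n) : 0 ≤ levyKer θ z := by unfold levyKer; positivity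

lemma measurable_levyKer : Measurable (levyKer (n := n) θ) := measurable_norm.pow_const _

lemma norm_rpow_mul_levyKer {s : ℝ} (hs : s ≠ (n : ℝ) + θ) (z : Eu n) :
    ‖z‖ ^ s * levyKer θ z = ‖z‖ ^ (s - (n + θ)) := by
  unfold levyKer
  rcases eq_or_ne z 0 with rfl | hz
  · rw [norm_zero, ← Real.rpow_add' le_rfl (by rw [← sub_eq_add_neg]; exact sub_ne_zero.2 hs),
      sub_eq_add_neg]
  · rw [← Real.rpow_add (norm_pos_iff.2 hz), sub_eq_add_neg]

lemma integrableOn_levyKer_compl_ball (hn : 1 ≤ n) (hθ : 0 < θ) {r : ℝ} (hr : 0 < r) :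
    IntegrableOn (levyKer (n := n) θ) (ball 0 r)ᶜ :=
  integrableOn_norm_rpow_compl_ball hn (by linarith) hr

lemma integrableOn_sq_mul_levyKer_ball (hn : 1 ≤ n) (hθ1 : θ ≤ 1) {r : ℝ} :
    IntegrableOn (fun z : Eu n => ‖z‖ ^ (2 : ℝ) * levyKer θ z) (ball 0 r) := by
  have hn' : (1 : ℝ) ≤ n := by exact_mod_cast hn
  have h := integrableOn_norm_rpow_ball (n := n) (s := 2 - (n + θ)) (r := r) hn (by linarith)
  -- If the exponents cancel, the two sides differ at the origin, where `0 ^ 0 = 1`; there the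
  -- identity is used almost everywhere only.
  rcases eq_or_ne (2 : ℝ) (n + θ) with h2 | h2
  · refine (h.congr_fun_ae ?_)
    refine ae_restrict_of_ae ?_
    filter_upwards [compl_mem_ae_iff.2 (show (volume : Measure (Eu n)) {0} = 0 by
      have := nontrivial_Eu hn
      simp)] with z hz
    have hz : 0 < ‖z‖ := norm_pos_iff.2 hz
    rw [levyKer, ← Real.rpow_add hz, sub_eq_add_neg]
  · simp_rw [norm_rpow_mul_levyKer h2]; exact h

/-- A function dominated by `min 1 |z|²` is integrable against the Lévy kernel. -/
lemma integrable_mul_levyKer (hn : 1 ≤ n) (hθ : 0 < θ) (hθ1 : θ ≤ 1) {f : Eu n → ℝ} {C : ℝ}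
    (hf : AEStronglyMeasurable f) (h1 : ∀ z, ‖f z‖ ≤ C) (h2 : ∀ z, ‖f z‖ ≤ C * ‖z‖ ^ 2) :
    Integrable fun z => f z * levyKer θ z := by
  have hm : AEStronglyMeasurable (fun z => f z * levyKer θ z) :=
    hf.mul measurable_levyKer.aestronglyMeasurable
  rw [← integrableOn_univ, ← union_compl_self (ball (0 : Eu n) 1)]
  refine IntegrableOn.union ?_ ?_
  · refine ((integrableOn_sq_mul_levyKer_ball hn hθ1).const_mul C).mono' hm.restrict
      (.of_forall fun z => ?_)
    rw [norm_mul, Real.norm_of_nonneg (levyKer_nonneg _ _), ← mul_assoc]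
    gcongr
    · exact levyKer_nonneg _ _
    · simpa using h2 z
  · refine ((integrableOn_levyKer_compl_ball hn hθ one_pos).const_mul C).mono' hm.restrict
      (.of_forall fun z => ?_)
    rw [norm_mul, Real.norm_of_nonneg (levyKer_nonneg _ _)]
    gcongr
    · exact levyKer_nonneg _ _
    · exact h1 z

/-- The Lévy–Khintchine integral. -/
noncomputable def levySymbol (θ : ℝ) (ξ : Eu n) : ℝ :=
  ∫ z, (1 - Real.cos (inner ℝ ξ z)) * levyKer θ z

lemma integrable_levySymbol (hn : 1 ≤ n) (hθ : 0 < θ) (hθ1 : θ ≤ 1) (ξ : Eu n) :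
    Integrable fun z => (1 - Real.cos (inner ℝ ξ z)) * levyKer θ z := by
  have hnn : ∀ z : Eu n, ‖1 - Real.cos (inner ℝ ξ z)‖ = 1 - Real.cos (inner ℝ ξ z) := fun z =>
    Real.norm_of_nonneg (by linarith [Real.cos_le_one (inner ℝ ξ z)])
  refine integrable_mul_levyKer (C := 2 + ‖ξ‖ ^ 2) hn hθ hθ1 (by fun_prop) (fun z => ?_)
    (fun z => ?_)
  · rw [hnn]; nlinarith [Real.neg_one_le_cos (inner ℝ ξ z), sq_nonneg ‖ξ‖]
  · rw [hnn]
    have h1 := Real.one_sub_sq_div_two_le_cos (x := inner ℝ ξ z)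
    have h2 : (inner ℝ ξ z) ^ 2 ≤ ‖ξ‖ ^ 2 * ‖z‖ ^ 2 := by
      rw [← sq_abs, ← mul_pow]
      gcongr
      exact abs_real_inner_le_norm ξ z
    nlinarith [sq_nonneg ‖z‖, sq_nonneg ‖ξ‖, mul_nonneg (sq_nonneg ‖ξ‖) (sq_nonneg ‖z‖)]

/-- Homogeneity of degree `θ`, from the dilation `z ↦ l z`: the kernel has degree `-n-θ` and the
volume degree `n`. -/
lemma levySymbol_smul {l : ℝ} (hl : 0 < l) (ξ : Eu n) :
    levySymbol θ (l • ξ) = l ^ θ * levySymbol θ ξ := by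
  have h := Measure.integral_comp_smul (volume : Measure (Eu n))
    (fun z => (1 - Real.cos (inner ℝ ξ z)) * levyKer θ z) l
  rw [finrank_euclideanSpace_fin, abs_of_pos (by positivity), smul_eq_mul] at h
  have hk : ∀ z : Eu n, levyKer θ (l • z) = l ^ (-((n : ℝ) + θ)) * levyKer θ z := fun z => by
    rw [levyKer, norm_smul, Real.norm_of_nonneg hl.le, Real.mul_rpow hl.le (norm_nonneg _), levyKer]
  have h' : levySymbol θ (l • ξ) =
      l ^ ((n : ℝ) + θ) * ∫ z, (1 - Real.cos (inner ℝ ξ (l • z))) * levyKer θ (l • z) := by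
    rw [levySymbol, ← integral_const_mul]
    congr 1; ext z
    rw [hk, real_inner_smul_left, real_inner_smul_right, Real.rpow_neg hl.le]
    have : 0 < l ^ ((n : ℝ) + θ) := by positivity
    field_simp
  rw [h', h, levySymbol, Real.rpow_add hl, Real.rpow_natCast]
  field_simp

/-- The reflection in the hyperplane orthogonal to `ξ - η` exchanges the two vectors and preserves
both the kernel and the volume. Together with homogeneity this determines the symbol up to a
constant. -/
lemma levySymbol_eq_of_norm_eq {ξ η : Eu n} (h : ‖ξ‖ = ‖η‖) :
    levySymbol θ ξ = levySymbol θ η := by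
  set O := (ℝ ∙ (ξ - η))ᗮ.reflection
  have hO : O ξ = η := Submodule.reflection_sub h
  have hmp : MeasurePreserving O := LinearIsometryEquiv.measurePreserving O
  unfold levySymbol
  rw [← hmp.integral_comp O.toHomeomorph.measurableEmbedding
    (fun z => (1 - Real.cos (inner ℝ η z)) * levyKer θ z)]
  congr 1; ext z
  have : inner ℝ η (O z) = inner ℝ ξ z := by rw [← hO, O.inner_map_map]
  rw [this, levyKer, levyKer, O.norm_map]

/-- The integrand is nonnegative, and positive on the open set where the cosine is below `1`; that
set contains `π ξ/|ξ|²`, where the cosine is `-1`. -/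
lemma levySymbol_pos (hn : 1 ≤ n) (hθ : 0 < θ) (hθ1 : θ ≤ 1) {ξ : Eu n} (hξ : ξ ≠ 0) :
    0 < levySymbol θ ξ := by
  unfold levySymbol
  rw [integral_pos_iff_support_of_nonneg (fun z => mul_nonneg
    (by linarith [Real.cos_le_one (inner ℝ ξ z)] : 0 ≤ 1 - Real.cos (inner ℝ ξ z))
    (levyKer_nonneg _ _)) (integrable_levySymbol hn hθ hθ1 ξ)]
  have hopen : IsOpen {z : Eu n | Real.cos (inner ℝ ξ z) < 1} :=
    isOpen_lt (by fun_prop) continuous_const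
  refine (hopen.measure_pos volume ⟨(Real.pi / ‖ξ‖ ^ 2) • ξ, ?_⟩).trans_le (measure_mono ?_)
  · have : 0 < ‖ξ‖ := norm_pos_iff.2 hξ
    simp only [mem_ofPred_eq, real_inner_smul_right, real_inner_self_eq_norm_sq]
    rw [div_mul_cancel₀ _ (by positivity), Real.cos_pi]
    norm_num
  · intro z hz
    simp only [mem_ofPred_eq] at hz
    have hz0 : z ≠ 0 := by rintro rfl; simp at hz
    have : 0 < levyKer θ z := by
      have := norm_pos_iff.2 hz0
      unfold levyKer; positivity
    exact mul_ne_zero (by linarith) this.ne'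

/-- The Lévy–Khintchine formula for `|ξ|^θ`. -/
lemma exists_levySymbol_eq (hn : 1 ≤ n) (hθ : 0 < θ) (hθ1 : θ ≤ 1) :
    ∃ c : ℝ, 0 < c ∧ ∀ ξ : Eu n, ‖ξ‖ ^ θ = c * levySymbol θ ξ := by
  have := nontrivial_Eu hn
  obtain ⟨e, he⟩ := exists_norm_eq (Eu n) zero_le_one
  have he0 : e ≠ 0 := by rintro rfl; simp at he
  have hp := levySymbol_pos hn hθ hθ1 he0
  refine ⟨(levySymbol θ e)⁻¹, inv_pos.2 hp, fun ξ => ?_⟩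
  rcases eq_or_ne ξ 0 with rfl | hξ
  · simp [levySymbol, Real.zero_rpow hθ.ne']
  · have hξ' := norm_pos_iff.2 hξ
    have h : levySymbol θ ξ = ‖ξ‖ ^ θ * levySymbol θ e := by
      rw [← levySymbol_smul hξ', levySymbol_eq_of_norm_eq (ξ := ξ)]
      rw [norm_smul, he]; simp
    rw [h]
    field_simp

/-- The symmetric second difference `2 φ(x) - φ(x + z) - φ(x - z)`. -/
def secondDiff (φ : Eu n → ℝ) (x z : Eu n) : ℝ := 2 * φ x - φ (x + z) - φ (x - z)

/-- The fractional Laplacian of a test function as a singular integral. -/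
lemma exists_fracLaplacian_eq (hn : 1 ≤ n) (hθ : 0 < θ) (hθ1 : θ ≤ 1) :
    ∃ c : ℝ, 0 < c ∧ ∀ φ : Eu n → ℝ, ContDiff ℝ ((⊤ : ℕ∞) : WithTop ℕ∞) φ → HasCompactSupport φ →
      ∀ x, fracLaplacian θ φ x = c * ∫ z, secondDiff φ x z * levyKer θ z := by
  obtain ⟨c, hc, hsym⟩ := exists_levySymbol_eq (n := n) hn hθ hθ1
  -- The half comes from `1 - cos = (2 - e^{i·} - e^{-i·})/2`, which produces half of a second
  -- difference.
  refine ⟨c / 2, by positivity, fun φ hφ hφc x => ?_⟩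
  set φc : Eu n → ℂ := fun y => (φ y : ℂ) with hφc_def
  have hcs : HasCompactSupport φc := hφc.comp_left (g := fun r : ℝ => (r : ℂ)) (by simp)
  have hcd : ContDiff ℝ ((⊤ : ℕ∞) : WithTop ℕ∞) φc := Complex.ofRealCLM.contDiff.comp hφ
  set S : SchwartzMap (Eu n) ℂ := hcs.toSchwartzMap hcd with hS
  set g : Eu n → ℂ := FourierTransform.fourier φc with hg
  have hgS : g = (FourierTransform.fourier S : SchwartzMap (Eu n) ℂ) := by
    rw [SchwartzMap.fourier_coe]; rfl
  have hgi : Integrable g := by rw [hgS]; exact SchwartzMap.integrable _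
  have hgc : Continuous g := by rw [hgS]; exact SchwartzMap.continuous _
  have hg2 : Integrable fun ξ => ‖ξ‖ ^ 2 * ‖g ξ‖ := by
    rw [hgS]; exact SchwartzMap.integrable_pow_mul volume _ 2
  have hinv : ∀ y, ∫ ξ, Complex.exp (((2 * Real.pi * inner ℝ ξ y : ℝ) : ℂ) * Complex.I) * g ξ =
      φc y := fun y => by
    have h := congrFun (hcd.continuous.fourierInv_fourier_eq S.integrable hgi) y
    rw [Real.fourierInv_eq'] at h
    simpa only [smul_eq_mul] using h
  -- From `r^θ ≤ 1 + r²` and the rapid decay of the Fourier transform. Via the symbol formula this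
  -- is also what makes the double integral of `Φ` absolutely convergent.
  have hgθ : Integrable fun ξ : Eu n => (2 * Real.pi * ‖ξ‖) ^ θ * ‖g ξ‖ := by
    refine ((hgi.norm.add (hg2.const_mul ((2 * Real.pi) ^ 2)))).mono' ?_ (.of_forall fun ξ => ?_)
    · exact ((measurable_const.mul measurable_norm).pow_const θ).aestronglyMeasurable.mul
        hgc.norm.aestronglyMeasurable
    · rw [norm_mul, norm_norm, Real.norm_of_nonneg (by positivity), Pi.add_apply, ← mul_assoc,
        ← one_add_mul]
      gcongr
      have h0 : 0 ≤ 2 * Real.pi * ‖ξ‖ := by positivity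
      rcases le_total (2 * Real.pi * ‖ξ‖) 1 with h | h
      · have := Real.rpow_le_one h0 h hθ.le
        have : 0 ≤ (2 * Real.pi) ^ 2 * ‖ξ‖ ^ 2 := by positivity
        linarith
      · calc _ ≤ (2 * Real.pi * ‖ξ‖) ^ (2 : ℝ) :=
              Real.rpow_le_rpow_of_exponent_le h (by linarith)
          _ ≤ _ := by
              rw [Real.rpow_two, mul_pow]; linarith
  have hsym' : ∀ ξ : Eu n, (2 * Real.pi * ‖ξ‖) ^ θ =
      c * ∫ z, (1 - Real.cos (2 * Real.pi * inner ℝ ξ z)) * levyKer θ z := fun ξ => by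
    have := hsym ((2 * Real.pi) • ξ)
    rw [norm_smul, Real.norm_of_nonneg (by positivity)] at this
    rw [this, levySymbol]
    simp_rw [real_inner_smul_left]
  have hsymi : ∀ ξ : Eu n, Integrable fun z =>
      (1 - Real.cos (2 * Real.pi * inner ℝ ξ z)) * levyKer θ z := fun ξ => by
    simpa only [real_inner_smul_left] using
      integrable_levySymbol hn hθ hθ1 ((2 * Real.pi) • ξ)
  set E : Eu n → Eu n → ℂ := fun ξ y =>
    Complex.exp (((2 * Real.pi * inner ℝ ξ y : ℝ) : ℂ) * Complex.I) with hE
  have hEn : ∀ ξ y, ‖E ξ y‖ = 1 := fun ξ y => Complex.norm_exp_ofReal_mul_I _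
  have hEc : Continuous fun p : Eu n × Eu n => E p.1 p.2 := by
    simp only [hE]; fun_prop
  set Φ : Eu n → Eu n → ℂ := fun ξ z =>
    (((1 - Real.cos (2 * Real.pi * inner ℝ ξ z)) * levyKer θ z : ℝ) : ℂ) * (E ξ x * g ξ) with hΦ
  have hΦm : AEStronglyMeasurable (Function.uncurry Φ) (volume.prod volume) := by
    refine AEStronglyMeasurable.mul ?_ ?_
    · refine Complex.continuous_ofReal.comp_aestronglyMeasurable (AEStronglyMeasurable.mul ?_
        (measurable_levyKer.comp measurable_snd).aestronglyMeasurable)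
      exact (by fun_prop : Continuous fun p : Eu n × Eu n =>
        1 - Real.cos (2 * Real.pi * inner ℝ p.1 p.2)).aestronglyMeasurable
    · exact ((hEc.comp (by fun_prop : Continuous fun p : Eu n × Eu n => (p.1, x))).mul
        (hgc.comp continuous_fst)).aestronglyMeasurable
  have hΦn : ∀ ξ z, ‖Φ ξ z‖ = (1 - Real.cos (2 * Real.pi * inner ℝ ξ z)) * levyKer θ z * ‖g ξ‖ :=
    fun ξ z => by
      rw [hΦ, norm_mul, norm_mul, hEn, one_mul, Complex.norm_real, Real.norm_of_nonneg]
      exact mul_nonneg (by linarith [Real.cos_le_one (2 * Real.pi * inner ℝ ξ z)])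
        (levyKer_nonneg _ _)
  have hΦi : Integrable (Function.uncurry Φ) (volume.prod volume) := by
    rw [integrable_prod_iff hΦm]
    refine ⟨.of_forall fun ξ => ?_, ?_⟩
    · exact (Integrable.ofReal (𝕜 := ℂ) (hsymi ξ)).mul_const (E ξ x * g ξ)
    · refine (hgθ.const_mul c⁻¹).congr (.of_forall fun ξ => ?_)
      simp only [Function.uncurry_apply_pair, hΦn]
      rw [integral_mul_const, hsym' ξ]
      field_simp
  -- Multiplying by the exponentials in `±z` translates, so Fourier inversion is applied at `x`, `x
  -- + z` and `x - z`.
  have hinner : ∀ z, ∫ ξ, Φ ξ z = ((secondDiff φ x z * levyKer θ z / 2 : ℝ) : ℂ) := fun z => by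
    have hint : ∀ y, Integrable fun ξ => E ξ y * g ξ := fun y => by
      refine hgi.norm.mono' ((hEc.comp (by fun_prop : Continuous fun ξ : Eu n => (ξ, y))).mul
        hgc).aestronglyMeasurable (.of_forall fun ξ => ?_)
      rw [norm_mul, hEn, one_mul]
    have he : ∀ ξ, Φ ξ z = ((levyKer θ z / 2 : ℝ) : ℂ) *
        (2 * (E ξ x * g ξ) - E ξ (x + z) * g ξ - E ξ (x - z) * g ξ) := fun ξ => by
      have h1 : E ξ (x + z) = E ξ x * E ξ z := by
        simp only [hE]; rw [← Complex.exp_add, inner_add_right]; congr 1; push_cast; ring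
      have h2 : E ξ (x - z) = E ξ x * Complex.exp (-(((2 * Real.pi * inner ℝ ξ z : ℝ) : ℂ) *
          Complex.I)) := by
        simp only [hE]; rw [← Complex.exp_add, inner_sub_right]; congr 1; push_cast; ring
      have h3 : ((Real.cos (2 * Real.pi * inner ℝ ξ z) : ℝ) : ℂ) = (E ξ z + Complex.exp
          (-(((2 * Real.pi * inner ℝ ξ z : ℝ) : ℂ) * Complex.I))) / 2 := by
        rw [Complex.ofReal_cos, Complex.cos, neg_mul]
      simp only [hΦ]
      rw [Complex.ofReal_mul, Complex.ofReal_sub, h3, h1, h2]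
      push_cast
      ring
    simp_rw [he]
    have hi : Integrable fun ξ => 2 * (E ξ x * g ξ) - E ξ (x + z) * g ξ :=
      ((hint x).const_mul 2).sub (hint (x + z))
    rw [integral_const_mul, integral_sub hi (hint (x - z)),
      integral_sub ((hint x).const_mul 2) (hint (x + z)), integral_const_mul, hinv, hinv, hinv]
    simp only [hφc_def, secondDiff]
    push_cast
    ring
  have hmain : FourierTransform.fourierInv
      (fun ξ : Eu n => (((2 * Real.pi * ‖ξ‖) ^ θ : ℝ) : ℂ) * g ξ) x =
      ((c / 2 * ∫ z, secondDiff φ x z * levyKer θ z : ℝ) : ℂ) := by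
    rw [Real.fourierInv_eq']
    calc _ = ∫ ξ, (c : ℂ) * ∫ z, Φ ξ z := by
          congr 1; ext ξ
          simp only [hΦ]
          rw [integral_mul_const, integral_complex_ofReal, hsym' ξ, smul_eq_mul]
          push_cast
          simp only [hE]
          push_cast
          ring
      _ = (c : ℂ) * ∫ z, ∫ ξ, Φ ξ z := by
          rw [integral_const_mul, integral_integral_swap hΦi]
      _ = _ := by
          simp_rw [hinner]
          rw [integral_complex_ofReal, integral_div]
          push_cast
          ring
  unfold fracLaplacian
  rw [hmain, Complex.ofReal_re]

end symbol

/-! ### Convolutions with integrable or bounded kernels. -/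

section convolution

variable {n : ℕ} {G : Type*} [NormedAddCommGroup G] [NormedSpace ℝ G]

/-- The convolution `∫ u(y) k(x - y) dy` with a vector-valued kernel. -/
noncomputable def conv (k : Eu n → G) (u : Eu n → ℝ) (x : Eu n) : G := ∫ y, u y • k (x - y)

lemma integrable_conv {k : Eu n → G} {u : Eu n → ℝ} (hk : Integrable k) (hu : Integrable u) :
    Integrable (conv k u) :=
  hu.integrable_convolution (ContinuousLinearMap.lsmul ℝ ℝ) hk

lemma integrable_conv_integrand_prod {k : Eu n → G} {u : Eu n → ℝ} (hk : Integrable k)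
    (hu : Integrable u) :
    Integrable (fun p : Eu n × Eu n => u p.2 • k (p.1 - p.2)) (volume.prod volume) :=
  hu.convolution_integrand (ContinuousLinearMap.lsmul ℝ ℝ) hk

lemma integral_norm_conv_le {k : Eu n → G} {u : Eu n → ℝ} (hk : Integrable k) (hu : Integrable u) :
    ∫ x, ‖conv k u x‖ ≤ (∫ y, |u y|) * ∫ z, ‖k z‖ := by
  have h := integral_convolution (ContinuousLinearMap.lsmul ℝ ℝ) (μ := volume) (ν := volume)
    hu.abs hk.norm
  simp only [ContinuousLinearMap.lsmul_apply, smul_eq_mul] at h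
  rw [← h]
  refine integral_mono (integrable_conv hk hu).norm
    (hu.abs.integrable_convolution (ContinuousLinearMap.lsmul ℝ ℝ) hk.norm) fun x => ?_
  refine (norm_integral_le_integral_norm _).trans_eq ?_
  simp [convolution_def, norm_smul]

lemma norm_conv_le {k : Eu n → G} {u : Eu n → ℝ} (hu : Integrable u) {C : ℝ}
    (hk : ∀ z, ‖k z‖ ≤ C) (x : Eu n) : ‖conv k u x‖ ≤ C * ∫ y, |u y| := by
  rw [mul_comm, ← integral_mul_const]
  refine norm_integral_le_of_norm_le (hu.abs.mul_const _) (.of_forall fun y => ?_)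
  rw [norm_smul, Real.norm_eq_abs]
  gcongr
  exact hk _

lemma norm_conv_le_of_bounded {k : Eu n → G} {u : Eu n → ℝ} (hk : Integrable k) {M : ℝ}
    (hM : ∀ᵐ y, |u y| ≤ M) (x : Eu n) : ‖conv k u x‖ ≤ M * ∫ z, ‖k z‖ := by
  rw [← integral_sub_left_eq_self (fun z => ‖k z‖) volume x, ← integral_const_mul]
  refine norm_integral_le_of_norm_le ((hk.comp_sub_left x).norm.const_mul _) ?_
  filter_upwards [hM] with y hy
  rw [norm_smul, Real.norm_eq_abs]
  gcongr

lemma integrable_smul_comp_sub_left {k : Eu n → G} {u : Eu n → ℝ} (hk : Continuous k) {C : ℝ}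
    (hC : ∀ z, ‖k z‖ ≤ C) (hu : Integrable u) (x : Eu n) :
    Integrable fun y => u y • k (x - y) := by
  refine (hu.abs.mul_const C).mono' (hu.aestronglyMeasurable.smul
    (hk.comp (by fun_prop)).aestronglyMeasurable) (.of_forall fun y => ?_)
  rw [norm_smul, Real.norm_eq_abs]
  gcongr
  exact hC _

lemma continuous_conv {k : Eu n → G} {u : Eu n → ℝ} (hk : Continuous k) {C : ℝ}
    (hC : ∀ z, ‖k z‖ ≤ C) (hu : Integrable u) : Continuous (conv k u) := by
  refine continuous_of_dominated (bound := fun y => |u y| * C)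
    (fun x => (integrable_smul_comp_sub_left hk hC hu x).aestronglyMeasurable)
    (fun x => .of_forall fun y => ?_) (hu.abs.mul_const _) (.of_forall fun y => ?_)
  · rw [norm_smul, Real.norm_eq_abs]
    gcongr
    exact hC _
  · exact (hk.comp (by fun_prop)).const_smul _

lemma hasFDerivAt_conv {k : Eu n → ℝ} (hk : IsTest k) {u : Eu n → ℝ} (hu : Integrable u)
    (x : Eu n) : HasFDerivAt (conv k u) (conv (fderiv ℝ k) u x) x := by
  obtain ⟨C, hC⟩ := hk.bounded
  obtain ⟨C', hC'⟩ := hk.bounded_fderiv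
  refine hasFDerivAt_integral_of_dominated_of_fderiv_le (s := univ) (bound := fun y => |u y| * C')
    (F' := fun x y => u y • fderiv ℝ k (x - y)) univ_mem (.of_forall fun x =>
      (integrable_smul_comp_sub_left hk.contDiff.continuous hC hu x).aestronglyMeasurable)
    (integrable_smul_comp_sub_left hk.contDiff.continuous hC hu x)
    (integrable_smul_comp_sub_left hk.continuous_fderiv hC' hu x).aestronglyMeasurable
    (.of_forall fun y x _ => ?_) (hu.abs.mul_const _) (.of_forall fun y x _ => ?_)
  · rw [norm_smul, Real.norm_eq_abs]
    gcongr
    exact hC' _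
  · exact (hasFDerivAt_comp_sub_right
      ((hk.contDiff.differentiable one_ne_zero) (x - y)).hasFDerivAt).const_smul (u y)

lemma fderiv_conv {k : Eu n → ℝ} (hk : IsTest k) {u : Eu n → ℝ} (hu : Integrable u) :
    fderiv ℝ (conv k u) = conv (fderiv ℝ k) u := funext fun x => (hasFDerivAt_conv hk hu x).fderiv

lemma isTest_conv {k : Eu n → ℝ} (hk : IsTest k) {u : Eu n → ℝ} (hu : Integrable u) :
    IsTest (conv k u) := by
  obtain ⟨C, hC⟩ := hk.bounded
  obtain ⟨C', hC'⟩ := hk.bounded_fderiv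
  constructor
  · rw [contDiff_one_iff_fderiv, fderiv_conv hk hu]
    exact ⟨fun x => (hasFDerivAt_conv hk hu x).differentiableAt,
      continuous_conv hk.continuous_fderiv hC' hu⟩
  · exact integrable_conv hk.integrable hu
  · rw [fderiv_conv hk hu]; exact integrable_conv hk.integrable_fderiv hu
  · exact ⟨_, norm_conv_le hu hC⟩
  · rw [fderiv_conv hk hu]; exact ⟨_, norm_conv_le hu hC'⟩

end convolution

/-! ### Pointwise and `L¹` bounds of second differences by `min 1 |z|²`. -/

section secondDifferences

variable {n : ℕ}

lemma secondDiff_conv {k : Eu n → ℝ} (hk : IsTest k) {u : Eu n → ℝ} (hu : Integrable u)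
    (x z : Eu n) : secondDiff (conv k u) x z = conv (fun x => secondDiff k x z) u x := by
  obtain ⟨C, hC⟩ := hk.bounded
  have hi := integrable_smul_comp_sub_left hk.contDiff.continuous hC hu
  have hi1 : Integrable fun y => 2 * (u y • k (x - y)) - u y • k (x + z - y) :=
    ((hi x).const_mul 2).sub (hi (x + z))
  unfold secondDiff conv
  rw [← integral_const_mul, ← integral_sub ((hi x).const_mul 2) (hi (x + z)),
    ← integral_sub hi1 (hi (x - z))]
  congr 1; ext y
  simp only [smul_eq_mul]
  rw [sub_add_eq_add_sub, sub_right_comm x y z]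
  ring

/-- Bounds of the second differences of a test function. -/
lemma exists_secondDiff_le {k : Eu n → ℝ} (hk : ContDiff ℝ ((⊤ : ℕ∞) : WithTop ℕ∞) k)
    (hc : HasCompactSupport k) :
    ∃ C, 0 ≤ C ∧ (∀ x z, |secondDiff k x z| ≤ C) ∧ (∀ x z, |secondDiff k x z| ≤ C * ‖z‖ ^ 2) ∧
      (∀ z, ∫ x, |secondDiff k x z| ≤ C) ∧ ∀ z, ∫ x, |secondDiff k x z| ≤ C * ‖z‖ ^ 2 := by
  have hd := hk.differentiable (by simp)
  have hk1 : ContDiff ℝ 1 (fderiv ℝ k) :=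
    (hk.fderiv_right (m := ((⊤ : ℕ∞) : WithTop ℕ∞)) (by simp)).of_le (by exact_mod_cast le_top)
  obtain ⟨C0, hC0⟩ := hc.exists_bound_of_continuous hk.continuous
  obtain ⟨L, hL⟩ := ContDiff.lipschitzWith_of_hasCompactSupport (hc.fderiv ℝ) hk1 one_ne_zero
  obtain ⟨R, hR⟩ := hc.isCompact.isBounded.subset_closedBall (0 : Eu n)
  have hi := hk.continuous.integrable_of_hasCompactSupport (μ := (volume : Measure (Eu n))) hc
  have b1 : ∀ x z, |secondDiff k x z| ≤ 4 * C0 := fun x z => by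
    unfold secondDiff
    have h1 := abs_le.1 (hC0 x); have h2 := abs_le.1 (hC0 (x + z)); have h3 := abs_le.1 (hC0 (x - z))
    exact abs_le.2 ⟨by linarith [h1.1, h2.2, h3.2], by linarith [h1.2, h2.1, h3.1]⟩
  -- Up to sign the second difference is the increment from `x - z` to `x` of `y ↦ k (y + z) - k y`,
  -- whose derivative is at most `L ‖z‖`.
  have b2 : ∀ x z, |secondDiff k x z| ≤ L * ‖z‖ ^ 2 := fun x z => by
    have hg : ∀ y, HasFDerivAt (fun y => k (y + z) - k y) (fderiv ℝ k (y + z) - fderiv ℝ k y) y :=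
      fun y => by
        refine HasFDerivAt.sub ?_ (hd y).hasFDerivAt
        simpa [Function.comp_def] using (hd (y + z)).hasFDerivAt.comp y
          ((hasFDerivAt_id y).add_const z)
    have := Convex.norm_image_sub_le_of_norm_hasFDerivWithin_le (𝕜 := ℝ) (s := univ)
      (f := fun y => k (y + z) - k y) (C := L * ‖z‖) (fun y _ => (hg y).hasFDerivWithinAt)
      (fun y _ => by simpa using hL.norm_sub_le (y + z) y) convex_univ (mem_univ (x - z))
      (mem_univ x)
    rw [sub_add_cancel, sub_sub_cancel, Real.norm_eq_abs] at this
    unfold secondDiff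
    rw [abs_sub_comm] at this
    calc _ = _ := by congr 1; ring
      _ ≤ _ := this
      _ = _ := by ring
  set V := (volume : Measure (Eu n)).real (closedBall 0 (R + 1))
  have hcont : ∀ z, Continuous fun x => secondDiff k x z := fun z => by
    have := hk.continuous
    unfold secondDiff; fun_prop
  have hint : ∀ z, Integrable fun x => |secondDiff k x z| := fun z =>
    (((hi.const_mul 2).sub (hi.comp_add_right z)).sub (hi.comp_sub_right z)).abs
  have b3 : ∀ z, ∫ x, |secondDiff k x z| ≤ 4 * ∫ x, |k x| := fun z => by
    calc _ ≤ ∫ x, (2 * |k x| + |k (x + z)| + |k (x - z)|) := by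
          refine integral_mono (hint z) (((hi.abs.const_mul 2).add
            (hi.comp_add_right z).abs).add (hi.comp_sub_right z).abs) fun x => ?_
          simp only [secondDiff]
          refine (abs_sub _ _).trans (add_le_add_left ((abs_sub _ _).trans ?_) _)
          rw [abs_mul, abs_two]
      _ = _ := by
          have h1 : Integrable fun x => 2 * |k x| + |k (x + z)| :=
            (hi.abs.const_mul 2).add (hi.comp_add_right z).abs
          rw [integral_add h1 (hi.comp_sub_right z).abs, integral_add (hi.abs.const_mul 2)
            (hi.comp_add_right z).abs, integral_const_mul,
            integral_add_right_eq_self (fun x => |k x|),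
            integral_sub_right_eq_self (fun x => |k x|)]
          ring
  -- For `‖z‖ ≤ 1` everything lives in the ball of radius `R + 1`, so the pointwise bound
  -- integrates. Larger `z` need only the crude bound `b3`.
  have b4 : ∀ z : Eu n, ‖z‖ ≤ 1 → ∫ x, |secondDiff k x z| ≤ L * ‖z‖ ^ 2 * V := fun z hz => by
    have hz0 : ∀ x, x ∉ closedBall (0 : Eu n) (R + 1) → |secondDiff k x z| = 0 := fun x hx => by
      have hx' : R + 1 < ‖x‖ := by simpa using hx
      have h0 : ∀ y, R < ‖y‖ → k y = 0 := fun y hy => by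
        by_contra h
        have := hR (subset_tsupport k h)
        simp at this
        linarith
      have e1 : R < ‖x + z‖ := by
        have := norm_sub_le (x + z) z
        rw [add_sub_cancel_right] at this; linarith
      have e2 : R < ‖x - z‖ := by
        have := norm_add_le (x - z) z
        rw [sub_add_cancel] at this; linarith
      simp [secondDiff, h0 x (by linarith), h0 _ e1, h0 _ e2]
    rw [← setIntegral_eq_integral_of_forall_compl_eq_zero hz0]
    refine (integral_mono (hint z).integrableOn (integrableOn_const
      (isCompact_closedBall _ _).measure_lt_top.ne) (fun x => b2 x z)).trans_eq ?_
    rw [setIntegral_const, smul_eq_mul, mul_comm]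
  have hC00 : 0 ≤ C0 := (norm_nonneg _).trans (hC0 0)
  have hI0 : 0 ≤ ∫ x, |k x| := integral_nonneg fun _ => abs_nonneg _
  have hV0 : 0 ≤ V := measureReal_nonneg
  have hLV : 0 ≤ (L : ℝ) * V := mul_nonneg L.2 hV0
  have hL0 : 0 ≤ (L : ℝ) := L.2
  refine ⟨4 * C0 + L + L * V + 4 * ∫ x, |k x|, by positivity, fun x z => ?_, fun x z => ?_,
    fun z => ?_, fun z => ?_⟩
  · linarith [b1 x z]
  · have := b2 x z
    have : 0 ≤ (4 * C0 + L * V + 4 * ∫ x, |k x|) * ‖z‖ ^ 2 := by positivity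
    linarith
  · linarith [b3 z]
  · rcases le_or_gt ‖z‖ 1 with h | h
    · have := b4 z h
      have : 0 ≤ (4 * C0 + L + 4 * ∫ x, |k x|) * ‖z‖ ^ 2 := by positivity
      nlinarith
    · have h1 := b3 z
      have h2 : 1 ≤ ‖z‖ ^ 2 := one_le_pow₀ h.le
      nlinarith [mul_le_mul_of_nonneg_left h2 (by linarith :
        0 ≤ 4 * C0 + L + L * V + 4 * ∫ x, |k x|)]

end secondDifferences

/-! ### Mollifiers and their scaling. -/

section mollifiers

variable {n : ℕ}

/-- Smooth probability densities supported in the ball of radius `ε`. -/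
structure IsMollifier (ε : ℝ) (ρ : Eu n → ℝ) : Prop where
  contDiff : ContDiff ℝ ((⊤ : ℕ∞) : WithTop ℕ∞) ρ
  hasCompactSupport : HasCompactSupport ρ
  nonneg : ∀ x, 0 ≤ ρ x
  integral_eq_one : ∫ x, ρ x = 1
  eq_zero : ∀ x, ε < ‖x‖ → ρ x = 0

lemma IsMollifier.isTest {ε : ℝ} {ρ : Eu n → ℝ} (h : IsMollifier ε ρ) : IsTest ρ :=
  .of_hasCompactSupport (h.contDiff.of_le (by exact_mod_cast le_top)) h.hasCompactSupport

lemma IsMollifier.integral_norm {ε : ℝ} {ρ : Eu n → ℝ} (h : IsMollifier ε ρ) :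
    ∫ x, ‖ρ x‖ = 1 := by
  rw [← h.integral_eq_one]
  congr 1; ext x; exact Real.norm_of_nonneg (h.nonneg x)

/-- The bump functions used as mollifiers. -/
noncomputable def bump (ε : ℝ) (hε : 0 < ε) : ContDiffBump (0 : Eu n) :=
  ⟨ε / 2, ε, by positivity, by linarith⟩

/-- The mollifier of radius `ε`. -/
noncomputable def moll (ε : ℝ) (hε : 0 < ε) : Eu n → ℝ := (bump ε hε).normed volume

lemma isMollifier_moll (ε : ℝ) (hε : 0 < ε) : IsMollifier ε (moll (n := n) ε hε) where
  contDiff := (bump ε hε).contDiff_normed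
  hasCompactSupport := (bump ε hε).hasCompactSupport_normed
  nonneg := (bump ε hε).nonneg_normed
  integral_eq_one := (bump ε hε).integral_normed
  eq_zero x hx := by
    by_contra h
    have : x ∈ Function.support ((bump ε hε).normed volume) := h
    rw [(bump ε hε).support_normed_eq] at this
    simp [bump] at this
    linarith

lemma bump_apply (ε : ℝ) (hε : 0 < ε) (x : Eu n) :
    bump ε hε x = bump (n := n) 1 one_pos (ε⁻¹ • x) := by
  simp only [bump, ContDiffBump.apply, sub_zero, smul_smul]
  congr 1
  · field_simp
  · congr 1; field_simp

lemma moll_apply (ε : ℝ) (hε : 0 < ε) (x : Eu n) :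
    moll ε hε x = (ε ^ n)⁻¹ * moll (n := n) 1 one_pos (ε⁻¹ • x) := by
  have h : ∫ x, bump (n := n) ε hε x = ε ^ n * ∫ x, bump (n := n) 1 one_pos x := by
    simp_rw [bump_apply ε hε]
    rw [Measure.integral_comp_inv_smul_of_nonneg _ _ hε.le, finrank_euclideanSpace_fin, smul_eq_mul]
  unfold moll
  rw [ContDiffBump.normed_def, ContDiffBump.normed_def, h, bump_apply ε hε]
  have := (bump (n := n) 1 one_pos).integral_pos (μ := volume)
  field_simp

/-- The product of the radius and the `L¹` norm of the gradient does not depend on the radius: this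
balance keeps the commutator bounded. -/
lemma integral_norm_fderiv_moll (ε : ℝ) (hε : 0 < ε) :
    ∫ x, ‖fderiv ℝ (moll (n := n) ε hε) x‖ =
      ε⁻¹ * ∫ x, ‖fderiv ℝ (moll (n := n) 1 one_pos) x‖ := by
  have h1 : moll (n := n) ε hε =
      fun x => (ε ^ n)⁻¹ • (fun x => moll (n := n) 1 one_pos (ε⁻¹ • x)) x :=
    funext fun x => moll_apply ε hε x
  have hd := (isMollifier_moll (n := n) 1 one_pos).contDiff.differentiable (by simp)
  have h2 : ∀ x, ‖fderiv ℝ (moll (n := n) ε hε) x‖ =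
      (ε ^ n)⁻¹ * ε⁻¹ * ‖fderiv ℝ (moll (n := n) 1 one_pos) (ε⁻¹ • x)‖ := fun x => by
    rw [h1, fderiv_fun_const_smul (by fun_prop), fderiv_comp_smul, norm_smul, norm_smul,
      Real.norm_of_nonneg (by positivity), Real.norm_of_nonneg (by positivity), mul_assoc]
  simp_rw [h2]
  rw [integral_const_mul, Measure.integral_comp_inv_smul_of_nonneg
    (f := fun x => ‖fderiv ℝ (moll (n := n) 1 one_pos) x‖) _ hε.le,
    finrank_euclideanSpace_fin, smul_eq_mul]
  field_simp

/-- Lebesgue differentiation; the constant `2` is the fixed ratio of the outer to the inner radius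
of the bumps. -/
lemma tendsto_conv_moll {u : Eu n → ℝ} (hu : LocallyIntegrable u) {ε : ℕ → ℝ} (hε : ∀ k, 0 < ε k)
    (h0 : Tendsto ε atTop (𝓝 0)) :
    ∀ᵐ x, Tendsto (fun k => conv (moll (ε k) (hε k)) u x) atTop (𝓝 (u x)) := by
  have := ContDiffBump.ae_convolution_tendsto_right_of_locallyIntegrable (μ := volume)
    (φ := fun k => bump (n := n) (ε k) (hε k)) (K := 2) (l := atTop) h0
    (.of_forall fun k => by simp [bump]; linarith) hu
  filter_upwards [this] with x hx
  refine hx.congr fun k => ?_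
  rw [convolution_eq_swap]
  simp [conv, moll, mul_comm]

end mollifiers

/-! ### Scalar inequalities for `q`-th powers. -/

section elementary

variable {q : ℝ}

/-- The odd power `|w|^{q-2} w`. -/
noncomputable def oddPow (q w : ℝ) : ℝ := |w| ^ (q - 2) * w

lemma abs_oddPow (hq : 1 < q) (w : ℝ) : |oddPow q w| = |w| ^ (q - 1) := by
  unfold oddPow
  rcases eq_or_ne w 0 with rfl | hw
  · simp [Real.zero_rpow (by linarith : q - 1 ≠ 0)]
  · have : 0 < |w| := abs_pos.2 hw
    rw [abs_mul, abs_of_nonneg (by positivity : 0 ≤ |w| ^ (q - 2))]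
    nth_rw 2 [← Real.rpow_one |w|]
    rw [← Real.rpow_add this]
    congr 1; ring

lemma oddPow_mul_self (hq : 1 < q) (w : ℝ) : oddPow q w * w = |w| ^ q := by
  unfold oddPow
  rcases eq_or_ne w 0 with rfl | hw
  · simp [Real.zero_rpow (by linarith : q ≠ 0)]
  · have : 0 < |w| := abs_pos.2 hw
    rw [mul_assoc, ← abs_mul_abs_self, ← mul_assoc]
    nth_rw 2 3 [← Real.rpow_one |w|]
    rw [← Real.rpow_add this, ← Real.rpow_add this]
    congr 1; ring

lemma measurable_oddPow : Measurable (oddPow q) := by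
  unfold oddPow
  exact (measurable_abs.pow_const _).mul measurable_id

lemma rpow_sub_one_mul_self (hq : 1 < q) {A : ℝ} (hA : 0 ≤ A) : A ^ (q - 1) * A = A ^ q := by
  rw [← Real.rpow_add_one' hA (by linarith)]
  congr 1; ring

/-- Young's inequality. -/
lemma mul_rpow_sub_one_mul_le (hq : 1 < q) {A B : ℝ} (hA : 0 ≤ A) (hB : 0 ≤ B) :
    q * (A ^ (q - 1) * B) ≤ (q - 1) * A ^ q + B ^ q := by
  have hpq := Real.HolderConjugate.conjExponent hq
  have h := Real.young_inequality_of_nonneg hB (Real.rpow_nonneg hA (q - 1)) hpq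
  have h1 : (A ^ (q - 1)) ^ q.conjExponent = A ^ q := by
    rw [← Real.rpow_mul hA, hpq.sub_one_mul_conj]
  have h2 : 1 / q.conjExponent = (q - 1) / q := by
    rw [one_div, ← hpq.one_sub_inv]; field_simp
  rw [h1, div_eq_mul_one_div (A ^ q), h2] at h
  have hq0 : 0 < q := by linarith
  have := mul_le_mul_of_nonneg_left h hq0.le
  rw [mul_comm (A ^ (q - 1)) B]
  calc _ ≤ _ := this
    _ = _ := by field_simp; ring

/-- The tangent line inequality of the convex function `|·|^q`. -/
lemma oddPow_mul_sub_le (hq : 1 < q) (v w : ℝ) :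
    q * (oddPow q v * (w - v)) ≤ |w| ^ q - |v| ^ q := by
  have h1 : oddPow q v * w ≤ |v| ^ (q - 1) * |w| := by
    rw [← abs_oddPow hq, ← abs_mul]; exact le_abs_self _
  have h2 := mul_rpow_sub_one_mul_le hq (abs_nonneg v) (abs_nonneg w)
  rw [mul_sub, oddPow_mul_self hq]
  nlinarith

/-- Concavity, then subadditivity, of `s ↦ s^{q/2}`; here `q ≤ 2` is needed. The hypothesis on `A +
B` is the parallelogram law in the application. -/
lemma rpow_add_rpow_le_two_mul (hq1 : 0 < q) (hq2 : q ≤ 2) {A B Y h : ℝ} (hA : 0 ≤ A) (hB : 0 ≤ B)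
    (hY : 0 ≤ Y) (hh : 0 ≤ h) (hAB : A + B = 2 * Y + 2 * h ^ 2) :
    A ^ (q / 2) + B ^ (q / 2) ≤ 2 * Y ^ (q / 2) + 2 * h ^ q := by
  have hc := (Real.concaveOn_rpow (p := q / 2) (by linarith) (by linarith)).2 (mem_Ici.2 hA)
    (mem_Ici.2 hB) (by norm_num : (0 : ℝ) ≤ 1 / 2) (by norm_num : (0 : ℝ) ≤ 1 / 2) (by norm_num)
  simp only [smul_eq_mul] at hc
  have h1 : 1 / 2 * A + 1 / 2 * B = Y + h ^ 2 := by linarith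
  have h2 := Real.rpow_add_le_add_rpow hY (sq_nonneg h) (by linarith : 0 ≤ q / 2) (by linarith)
  have h3 : (h ^ 2) ^ (q / 2) = h ^ q := by
    rw [← Real.rpow_natCast, ← Real.rpow_mul hh]; congr 1; push_cast; ring
  rw [h1] at hc
  rw [h3] at h2
  linarith

end elementary

/-! ### Truncated weights with constants independent of the truncation. -/

section weights

variable {n : ℕ} {q : ℝ}

/-- Bounded Lipschitz weights whose `q`-th power has controlled second differences. -/
structure IsWeight (q : ℝ) (a : Eu n → ℝ) : Prop where
  contDiff : ContDiff ℝ 1 a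
  pos : ∀ x, 0 < a x
  bounded : ∃ C, ∀ x, a x ≤ C
  le_add : ∀ x y, a x ≤ a y + ‖x - y‖
  add_le : ∀ x z, a (x + z) ^ q + a (x - z) ^ q ≤ 2 * a x ^ q + 2 * ‖z‖ ^ q

/-- The truncation `(1 + |x|²)^{1/2}` of order `κ^{-1/q}`. -/
noncomputable def truncWeight (q κ : ℝ) (x : Eu n) : ℝ :=
  (((1 + ‖x‖ ^ 2) ^ (-q / 2)) + κ) ^ (-1 / q)

/-- This identity explains the form of the truncation: the `q`-th power is the concave increasing
function `s/(1+κs)` of `(1+|x|²)^{q/2}`, and such a function does not worsen upper bounds of second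
differences. -/
lemma truncWeight_rpow (hq : 0 < q) {κ : ℝ} (hκ : 0 ≤ κ) (x : Eu n) :
    truncWeight q κ x ^ q =
      (1 + ‖x‖ ^ 2) ^ (q / 2) / (1 + κ * (1 + ‖x‖ ^ 2) ^ (q / 2)) := by
  have hY : 0 < 1 + ‖x‖ ^ 2 := by positivity
  rw [truncWeight, ← Real.rpow_mul (by positivity), div_mul_cancel₀ _ hq.ne', Real.rpow_neg_one,
    neg_div, Real.rpow_neg hY.le]
  have : 0 < (1 + ‖x‖ ^ 2) ^ (q / 2) := by positivity
  field_simp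

lemma truncWeight_antitone (hq : 0 < q) {κ : ℝ} (hκ : 0 ≤ κ) {x y : Eu n} (h : ‖x‖ ≤ ‖y‖) :
    truncWeight q κ x ≤ truncWeight q κ y := by
  unfold truncWeight
  refine Real.rpow_le_rpow_of_nonpos (by positivity) ?_ (by rw [neg_div]; simp; positivity)
  gcongr ?_ + κ
  refine Real.rpow_le_rpow_of_nonpos (by positivity) (by gcongr) ?_
  rw [neg_div]; simp; positivity

lemma sqrt_one_add_sq_sub_le (x y : Eu n) :
    √(1 + ‖x‖ ^ 2) ≤ √(1 + ‖y‖ ^ 2) + ‖x - y‖ := by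
  refine Real.sqrt_le_iff.2 ⟨by positivity, ?_⟩
  have h1 : ‖x‖ ≤ ‖y‖ + ‖x - y‖ := by
    simpa using norm_add_le y (x - y)
  have h2 := Real.sq_sqrt (by positivity : 0 ≤ 1 + ‖y‖ ^ 2)
  have h3 : ‖y‖ ≤ √(1 + ‖y‖ ^ 2) := Real.le_sqrt_of_sq_le (by linarith)
  nlinarith [norm_nonneg x, norm_nonneg y, norm_nonneg (x - y),
    mul_le_mul_of_nonneg_right h3 (norm_nonneg (x - y))]

lemma truncWeight_le (hq : 0 < q) {κ : ℝ} (hκ : 0 ≤ κ) (x : Eu n) :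
    truncWeight q κ x ≤ √(1 + ‖x‖ ^ 2) := by
  have hY : 0 < 1 + ‖x‖ ^ 2 := by positivity
  have : √(1 + ‖x‖ ^ 2) = ((1 + ‖x‖ ^ 2) ^ (-q / 2)) ^ (-1 / q) := by
    rw [← Real.rpow_mul hY.le, Real.sqrt_eq_rpow]; congr 1; field_simp
  rw [this, truncWeight]
  exact Real.rpow_le_rpow_of_nonpos (by positivity) (by linarith) (by rw [neg_div]; simp; positivity)

/-- Only the upper bound of the weight depends on `κ`. The Lipschitz constant and the second
difference bound are uniform, and this is what allows `κ → 0` at the end. -/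
lemma isWeight_truncWeight (hq1 : 1 < q) (hq2 : q ≤ 2) {κ : ℝ} (hκ : 0 < κ) :
    IsWeight (n := n) q (truncWeight q κ) where
  contDiff := by
    unfold truncWeight
    refine ContDiff.rpow_const_of_ne (ContDiff.add (ContDiff.rpow_const_of_ne
      (contDiff_const.add (contDiff_norm_sq ℝ)) fun x => ?_) contDiff_const) fun x => ?_
    · positivity
    · positivity
  pos x := by unfold truncWeight; positivity
  bounded := ⟨κ ^ (-1 / q), fun x => Real.rpow_le_rpow_of_nonpos hκ
    (by have : 0 ≤ (1 + ‖x‖ ^ 2) ^ (-q / 2) := by positivity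
        linarith) (by rw [neg_div]; simp; linarith)⟩
  le_add x y := by
    have hq0 : 0 < q := by linarith
    rcases le_total ‖x‖ ‖y‖ with h | h
    · have := truncWeight_antitone hq0 hκ.le h
      linarith [norm_nonneg (x - y)]
    · set X := 1 + ‖x‖ ^ 2 with hX
      set Y := 1 + ‖y‖ ^ 2 with hY
      have hX0 : 0 < X := by positivity
      have hY0 : 0 < Y := by positivity
      have hYX : Y ≤ X := by rw [hX, hY]; gcongr
      have hsY : 0 < √Y := Real.sqrt_pos.2 hY0
      -- The quotient of the weight by `(1+|x|²)^{1/2}` decreases with `|x|`, so the truncated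
      -- weight inherits the Lipschitz constant of the untruncated one.
      have key : truncWeight q κ x * √Y ≤ truncWeight q κ y * √X := by
        have e : ∀ Z W : ℝ, 0 < Z → 0 < W → (Z ^ (-q / 2) + κ) ^ (-1 / q) * √W =
            ((Z ^ (-q / 2) + κ) * W ^ (-q / 2)) ^ (-1 / q) := fun Z W hZ hW => by
          rw [Real.mul_rpow (by positivity) (by positivity), ← Real.rpow_mul hW.le,
            Real.sqrt_eq_rpow]
          congr 2; field_simp
        rw [truncWeight, truncWeight, ← hX, ← hY, e X Y hX0 hY0, e Y X hY0 hX0]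
        refine Real.rpow_le_rpow_of_nonpos (by positivity) ?_ (by rw [neg_div]; simp; linarith)
        have : X ^ (-q / 2) ≤ Y ^ (-q / 2) :=
          Real.rpow_le_rpow_of_nonpos hY0 hYX (by rw [neg_div]; simp; linarith)
        nlinarith
      have h1 := truncWeight_le hq0 hκ.le y
      have h2 : √X ≤ √Y + ‖x - y‖ := sqrt_one_add_sq_sub_le x y
      have h3 : 0 ≤ truncWeight q κ y := by unfold truncWeight; positivity
      have : truncWeight q κ x * √Y ≤ (truncWeight q κ y + ‖x - y‖) * √Y := by
        rw [← hY] at h1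
        nlinarith [mul_le_mul_of_nonneg_left h2 h3, mul_le_mul_of_nonneg_right h1
          (norm_nonneg (x - y))]
      exact le_of_mul_le_mul_right this hsY
  add_le x z := by
    have hq0 : 0 < q := by linarith
    rw [truncWeight_rpow hq0 hκ.le, truncWeight_rpow hq0 hκ.le, truncWeight_rpow hq0 hκ.le]
    have hpar : (1 + ‖x + z‖ ^ 2) + (1 + ‖x - z‖ ^ 2) = 2 * (1 + ‖x‖ ^ 2) + 2 * ‖z‖ ^ 2 := by
      have := parallelogram_law_with_norm ℝ x z
      nlinarith
    have h := rpow_add_rpow_le_two_mul hq0 hq2 (by positivity) (by positivity) (by positivity)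
      (norm_nonneg z) hpar
    set A := (1 + ‖x + z‖ ^ 2) ^ (q / 2)
    set B := (1 + ‖x - z‖ ^ 2) ^ (q / 2)
    set S := (1 + ‖x‖ ^ 2) ^ (q / 2)
    have hA : 0 ≤ A := by positivity
    have hB : 0 ≤ B := by positivity
    have hS : 0 ≤ S := by positivity
    -- Concavity of `s/(1+κs)`, whose tangent at `S` has slope at most `1`.
    have tangent : ∀ s : ℝ, 0 ≤ s → s / (1 + κ * s) ≤ S / (1 + κ * S) + (s - S) / (1 + κ * S) ^ 2 :=
      fun s hs => by
        have h1 : 0 < 1 + κ * s := by positivity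
        have h2 : 0 < 1 + κ * S := by positivity
        have : S / (1 + κ * S) + (s - S) / (1 + κ * S) ^ 2 - s / (1 + κ * s) =
            κ * (s - S) ^ 2 / ((1 + κ * S) ^ 2 * (1 + κ * s)) := by
          field_simp; ring
        have h3 : 0 ≤ κ * (s - S) ^ 2 / ((1 + κ * S) ^ 2 * (1 + κ * s)) := by positivity
        linarith
    have hzq : 0 ≤ ‖z‖ ^ q := by positivity
    have hD : 1 ≤ (1 + κ * S) ^ 2 := one_le_pow₀ (by nlinarith)
    have h4 : (A - S) / (1 + κ * S) ^ 2 + (B - S) / (1 + κ * S) ^ 2 ≤ 2 * ‖z‖ ^ q := by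
      rw [← add_div, div_le_iff₀ (by positivity)]
      nlinarith
    have h5 : 2 * (S / (1 + κ * S)) = S / (1 + κ * S) + S / (1 + κ * S) := by ring
    linarith [tangent A hA, tangent B hB]

lemma IsWeight.continuous {a : Eu n → ℝ} (ha : IsWeight q a) : Continuous a := ha.contDiff.continuous

lemma IsWeight.norm_fderiv_le {a : Eu n → ℝ} (ha : IsWeight q a) (x : Eu n) :
    ‖fderiv ℝ a x‖ ≤ 1 := by
  refine norm_fderiv_le_of_lip' ℝ zero_le_one (.of_forall fun y => ?_)
  rw [one_mul, Real.norm_eq_abs, abs_le]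
  have h1 := ha.le_add x y
  have h2 := ha.le_add y x
  rw [norm_sub_rev] at h1
  constructor <;> linarith

end weights

/-! ### The far part of the diffusion. -/

section fractional

variable {n : ℕ} {q θ : ℝ}

lemma integral_le_toReal_of_lintegral_enorm_le {α : Type*} [MeasurableSpace α] {μ : Measure α}
    {f : α → ℝ} (hf : AEStronglyMeasurable f μ) {B : ℝ} (hB : 0 ≤ B)
    (h : ∫⁻ x, ‖f x‖ₑ ∂μ ≤ ENNReal.ofReal B) : Integrable f μ ∧ ∫ x, f x ∂μ ≤ B := by
  have hi : Integrable f μ := ⟨hf, h.trans_lt ENNReal.ofReal_lt_top⟩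
  refine ⟨hi, (integral_mono hi hi.norm fun x => le_abs_self (f x)).trans ?_⟩
  rw [integral_norm_eq_lintegral_enorm hf]
  exact ENNReal.toReal_le_of_le_ofReal hB h

lemma integrable_of_abs_le_of_continuous {f g : Eu n → ℝ} (hf : Continuous f) (hg : Integrable g)
    {C : ℝ} (h : ∀ x, |f x| ≤ C) : Integrable fun x => f x * g x := by
  refine (hg.norm.const_mul C).mono' (hf.aestronglyMeasurable.mul hg.aestronglyMeasurable)
    (.of_forall fun x => ?_)
  rw [norm_mul, Real.norm_eq_abs]
  gcongr
  exact h x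

lemma integrable_abs_rpow (hq : 1 < q) {v : Eu n → ℝ} (hv : Continuous v) (hvi : Integrable v)
    {C : ℝ} (hC : ∀ x, |v x| ≤ C) : Integrable fun x => |v x| ^ q := by
  have := integrable_of_abs_le_of_continuous (f := fun x => |v x| ^ (q - 1)) (C := C ^ (q - 1))
    (hv.abs.rpow_const fun x => Or.inr (by linarith)) hvi.abs fun x => by
      rw [abs_of_nonneg (by positivity)]
      exact Real.rpow_le_rpow (abs_nonneg _) (hC x) (by linarith)
  refine this.congr (.of_forall fun x => ?_)
  exact rpow_sub_one_mul_self hq (abs_nonneg _)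

/-- The contribution of the far part of the kernel. -/
lemma integrableOn_far (hn : 1 ≤ n) (hq : 1 < q) (hθ : 0 < θ) (hqn : ((n : ℝ) - 1) * q = n)
    {W v : Eu n → ℝ} (hW : Continuous W) (hW0 : ∀ x, 0 ≤ W x) (hWq : Integrable fun x => W x ^ q)
    (hv : Continuous v) (hvi : Integrable v) {r : ℝ} (hr : 0 < r) :
    IntegrableOn (fun z => ‖z‖ ^ (1 - ((n : ℝ) + θ)) * ∫ x, W x ^ (q - 1) * |v (x + z)|)
      (ball (0 : Eu n) r)ᶜ ∧
    ∫ z in (ball (0 : Eu n) r)ᶜ,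
      ‖z‖ ^ (1 - ((n : ℝ) + θ)) * ∫ x, W x ^ (q - 1) * |v (x + z)| ≤
      (∫ x, |v x|) * (((sphereArea n / (θ * q)) ^ (1 / q) * r ^ (-θ)) *
        (∫ x, W x ^ q) ^ (1 - 1 / q)) := by
  have hq0 : 0 < q := by linarith
  have hpq := Real.HolderConjugate.conjExponent hq
  set q' := q.conjExponent with hq'
  set s : ℝ := 1 - ((n : ℝ) + θ) with hs
  -- The choice of `q` enters here: the far kernel raised to the power `q` decays `θ q` faster than
  -- the critical rate `-n`.
  have hsq : s * q = -(n : ℝ) - θ * q := by rw [hs]; linarith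
  have hsq' : s * q < -(n : ℝ) := by rw [hsq]; nlinarith
  have hwc : Continuous fun x => W x ^ (q - 1) := hW.rpow_const fun x => Or.inr (by linarith)
  have hvc : ∀ z, Continuous fun x => v (x + z) := fun z => by fun_prop
  have hmeas : AEStronglyMeasurable
      (fun z => ‖z‖ ^ s * ∫ x, W x ^ (q - 1) * |v (x + z)|) (volume : Measure (Eu n)) := by
    refine (measurable_norm.pow_const s).aestronglyMeasurable.mul ?_
    refine AEStronglyMeasurable.integral_prod_right' (f := fun p : Eu n × Eu n =>
      W p.2 ^ (q - 1) * |v (p.2 + p.1)|) ?_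
    exact ((hwc.comp continuous_snd).mul (by fun_prop)).aestronglyMeasurable
  refine integral_le_toReal_of_lintegral_enorm_le hmeas.restrict
    (by
      have := sphereArea_nonneg n
      have hI : 0 ≤ ∫ x, W x ^ q := integral_nonneg fun x => Real.rpow_nonneg (hW0 x) _
      positivity) ?_
  set κ : Eu n → ℝ≥0∞ := (ball (0 : Eu n) r)ᶜ.indicator fun z => ENNReal.ofReal (‖z‖ ^ s) with hκ
  set w : Eu n → ℝ≥0∞ := fun x => ENNReal.ofReal (W x ^ (q - 1)) with hw
  have hκm : Measurable κ :=
    ((measurable_norm.pow_const s).ennreal_ofReal).indicator measurableSet_ball.compl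
  have hwm : Measurable w := hwc.measurable.ennreal_ofReal
  have hvm : Measurable fun x => ‖v x‖ₑ := hv.measurable.enorm
  have hκq : ∫⁻ z, κ z ^ q = ENNReal.ofReal (sphereArea n / (θ * q) * r ^ (-θ * q)) := by
    have h1 : ∀ z, κ z ^ q =
        (ball (0 : Eu n) r)ᶜ.indicator (fun z => ENNReal.ofReal (‖z‖ ^ (s * q))) z := fun z => by
      by_cases hz : z ∈ (ball (0 : Eu n) r)ᶜ
      · rw [hκ, indicator_of_mem hz, indicator_of_mem hz,
          ENNReal.ofReal_rpow_of_nonneg (by positivity) hq0.le, ← Real.rpow_mul (norm_nonneg _)]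
      · rw [hκ, indicator_of_notMem hz, indicator_of_notMem hz, ENNReal.zero_rpow_of_pos hq0]
    simp_rw [h1]
    rw [lintegral_indicator measurableSet_ball.compl, ← ofReal_integral_eq_lintegral_ofReal
      (integrableOn_norm_rpow_compl_ball hn hsq' hr) (.of_forall fun z => by positivity),
      setIntegral_norm_rpow_compl_ball hn hsq' hr, hsq]
    congr 1
    rw [show -(n : ℝ) - θ * q + n = -θ * q by ring]
    field_simp
  have hwq : ∀ y, ∫⁻ z, w (y - z) ^ q' = ENNReal.ofReal (∫ x, W x ^ q) := fun y => by
    rw [lintegral_sub_left_eq_self (fun x => w x ^ q') y, ofReal_integral_eq_lintegral_ofReal hWq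
      (.of_forall fun x => by have := hW0 x; positivity)]
    refine lintegral_congr fun x => ?_
    rw [hw, ENNReal.ofReal_rpow_of_nonneg (Real.rpow_nonneg (hW0 x) _) hpq.symm.nonneg,
      ← Real.rpow_mul (hW0 x), hpq.sub_one_mul_conj]
  have hHolder : ∀ y, ∫⁻ z, κ z * w (y - z) ≤ ENNReal.ofReal
      (((sphereArea n / (θ * q)) ^ (1 / q) * r ^ (-θ)) * (∫ x, W x ^ q) ^ (1 - 1 / q)) := fun y => by
    have h := ENNReal.lintegral_mul_le_Lp_mul_Lq volume hpq hκm.aemeasurable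
      (g := fun z => w (y - z)) (hwm.comp (measurable_const.sub measurable_id)).aemeasurable
    simp only [Pi.mul_apply] at h
    have hA := sphereArea_nonneg n
    have hI : 0 ≤ ∫ x, W x ^ q := integral_nonneg fun x => Real.rpow_nonneg (hW0 x) _
    rw [hκq, hwq, ENNReal.ofReal_rpow_of_nonneg (by positivity) (by positivity),
      ENNReal.ofReal_rpow_of_nonneg hI (by have := hpq.symm.pos; positivity),
      ← ENNReal.ofReal_mul (by positivity), Real.mul_rpow (by positivity) (by positivity),
      ← Real.rpow_mul hr.le, mul_one_div (-θ * q), mul_div_cancel_right₀ _ hq0.ne'] at h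
    rwa [one_div q', ← hpq.one_sub_inv, ← one_div] at h
  calc ∫⁻ z in (ball (0 : Eu n) r)ᶜ, ‖‖z‖ ^ s * ∫ x, W x ^ (q - 1) * |v (x + z)|‖ₑ
      ≤ ∫⁻ z, κ z * ∫⁻ x, w x * ‖v (x + z)‖ₑ := by
        rw [← lintegral_indicator measurableSet_ball.compl]
        refine lintegral_mono fun z => ?_
        by_cases hz : z ∈ (ball (0 : Eu n) r)ᶜ
        · simp only
          rw [hκ, indicator_of_mem hz, indicator_of_mem hz, enorm_mul,
            Real.enorm_of_nonneg (by positivity)]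
          gcongr
          refine (enorm_integral_le_lintegral_enorm _).trans_eq (lintegral_congr fun x => ?_)
          rw [enorm_mul, Real.enorm_of_nonneg (Real.rpow_nonneg (hW0 x) _), hw, Real.enorm_abs]
        · rw [indicator_of_notMem hz]; exact zero_le
    -- Substituting `y = x + z` leaves `v` with the outer variable, so Hölder in `z` is uniform in
    -- `y` and only the `L¹` norm of `v` remains.
    _ = ∫⁻ z, ∫⁻ y, κ z * w (y - z) * ‖v y‖ₑ := by
        refine lintegral_congr fun z => ?_
        have hm : Measurable fun x => w x * ‖v (x + z)‖ₑ := hwm.mul (hvc z).measurable.enorm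
        rw [← lintegral_const_mul _ hm,
          ← lintegral_add_right_eq_self (fun y => κ z * w (y - z) * ‖v y‖ₑ) z]
        simp only [add_sub_cancel_right, mul_assoc]
    _ = ∫⁻ y, (∫⁻ z, κ z * w (y - z)) * ‖v y‖ₑ := by
        rw [lintegral_lintegral_swap]
        · refine lintegral_congr fun y => ?_
          rw [lintegral_mul_const]
          exact hκm.mul (hwm.comp (measurable_const.sub measurable_id))
        · exact (((hκm.comp measurable_fst).mul (hwm.comp
            (measurable_snd.sub measurable_fst))).mul (hvm.comp measurable_snd)).aemeasurable
    _ ≤ ∫⁻ y, ENNReal.ofReal (((sphereArea n / (θ * q)) ^ (1 / q) * r ^ (-θ)) *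
          (∫ x, W x ^ q) ^ (1 - 1 / q)) * ‖v y‖ₑ := by
        gcongr with y
        exact hHolder y
    _ = _ := by
        rw [lintegral_const_mul _ hvm, ← ofReal_integral_norm_eq_lintegral_enorm hvi,
          ← ENNReal.ofReal_mul (by
            have := sphereArea_nonneg n
            have hI : 0 ≤ ∫ x, W x ^ q := integral_nonneg fun x => Real.rpow_nonneg (hW0 x) _
            positivity), mul_comm]
        rfl

end fractional

/-! ### The weighted energy estimate for the diffusion. -/

section fractionalEnergy

variable {n : ℕ} {q θ : ℝ}

/-- The derivative `a^q q |v|^{q-2} v` of the energy density. -/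
noncomputable def energyDeriv (q : ℝ) (a v : Eu n → ℝ) (x : Eu n) : ℝ :=
  q * (a x ^ q * oddPow q (v x))

/-- The tangent inequality when the weight itself changes from `A` to `A'`: one factor `A` is
replaced by `A' + h`, Young's inequality handles `A'`, and `h` gives the error. The main terms form
a difference that integrates to zero under translation. -/
lemma mul_oddPow_sub_le (hq : 1 < q) {A A' h v w : ℝ} (hA : 0 ≤ A) (hA' : 0 ≤ A')
    (hAA : A ≤ A' + h) :
    q * (A ^ q * oddPow q v) * (w - v) ≤
      (A' * |w|) ^ q - (A * |v|) ^ q + q * h * ((A * |v|) ^ (q - 1) * |w|) := by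
  have hq0 : 0 < q := by linarith
  have hW : 0 ≤ A * |v| := by positivity
  have h1 : A ^ q * oddPow q v * w ≤ (A * |v|) ^ (q - 1) * (A * |w|) := by
    calc _ ≤ |A ^ q * oddPow q v * w| := le_abs_self _
      _ = A ^ q * |v| ^ (q - 1) * |w| := by
        rw [abs_mul, abs_mul, abs_oddPow hq, abs_of_nonneg (by positivity : 0 ≤ A ^ q)]
      _ = _ := by
        rw [Real.mul_rpow hA (abs_nonneg _), ← rpow_sub_one_mul_self hq hA]; ring
  have h2 : (A * |v|) ^ (q - 1) * (A * |w|) ≤ (A * |v|) ^ (q - 1) * (A' * |w| + h * |w|) := by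
    gcongr
    rw [← add_mul]
    gcongr
  have h3 := mul_rpow_sub_one_mul_le hq hW (by positivity : 0 ≤ A' * |w|)
  have h4 : A ^ q * oddPow q v * v = (A * |v|) ^ q := by
    rw [mul_assoc, oddPow_mul_self hq, Real.mul_rpow hA (abs_nonneg _)]
  have h5 : q * (A ^ q * oddPow q v) * (w - v) =
      q * (A ^ q * oddPow q v * w) - q * (A ^ q * oddPow q v * v) := by ring
  rw [h5, h4]
  have := mul_le_mul_of_nonneg_left (h1.trans h2) hq0.le
  nlinarith

lemma abs_energyDeriv (hq : 1 < q) {a v : Eu n → ℝ} (ha : ∀ x, 0 < a x) (x : Eu n) :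
    |energyDeriv q a v x| = q * (a x ^ q * |v x| ^ (q - 1)) := by
  have := ha x
  rw [energyDeriv, abs_mul, abs_mul, abs_oddPow hq, abs_of_nonneg (by linarith : 0 ≤ q),
    abs_of_nonneg (by positivity : 0 ≤ a x ^ q)]

lemma IsWeight.abs_energyDeriv_le (hq : 1 < q) {a v : Eu n → ℝ} (ha : IsWeight q a) {Ca Cv : ℝ}
    (hCa : ∀ x, a x ≤ Ca) {x : Eu n} (hCv : |v x| ≤ Cv) :
    |energyDeriv q a v x| ≤ q * (Ca ^ q * Cv ^ (q - 1)) := by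
  rw [abs_energyDeriv hq ha.pos]
  have h0 := (ha.pos x).le
  have hq1 : 0 ≤ q - 1 := by linarith
  have hCa0 : 0 ≤ Ca := h0.trans (hCa x)
  gcongr
  exact hCa x

lemma IsWeight.measurable_energyDeriv {a v : Eu n → ℝ} (ha : IsWeight q a) (hv : Measurable v) :
    Measurable (energyDeriv q a v) :=
  ((ha.continuous.measurable.pow_const q).mul (measurable_oddPow.comp hv)).const_mul q

lemma integral_far_reflect {r : ℝ} (f : Eu n → ℝ) :
    ∫ z in (ball (0 : Eu n) r)ᶜ, f (-z) = ∫ z in (ball (0 : Eu n) r)ᶜ, f z := by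
  rw [← integral_indicator measurableSet_ball.compl, ← integral_indicator measurableSet_ball.compl,
    ← integral_neg_eq_self]
  congr 1; ext z
  simp [indicator]

lemma integrableOn_far_reflect {r : ℝ} {f : Eu n → ℝ} (hf : IntegrableOn f (ball (0 : Eu n) r)ᶜ) :
    IntegrableOn (fun z => f (-z)) (ball (0 : Eu n) r)ᶜ := by
  rw [← integrable_indicator_iff measurableSet_ball.compl] at hf ⊢
  refine hf.comp_neg.congr (.of_forall fun z => ?_)
  simp [indicator]

/-- The weighted energy estimate for the fractional diffusion. -/
lemma neg_integral_energyDeriv_mul_secondDiff_le (hn : 2 ≤ n) (hq1 : 1 < q) (hq2 : q ≤ 2)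
    (hθ : 0 < θ) (hθ1 : θ ≤ 1) (hqn : ((n : ℝ) - 1) * q = n) {a : Eu n → ℝ} (ha : IsWeight q a)
    {v : Eu n → ℝ} (hv : Continuous v) (hvi : Integrable v) {Cv : ℝ} (hCv : ∀ x, |v x| ≤ Cv)
    {C : ℝ} (hC1 : ∀ z, ∫ x, |secondDiff v x z| ≤ C)
    (hC2 : ∀ z, ∫ x, |secondDiff v x z| ≤ C * ‖z‖ ^ 2) {r : ℝ} (hr : 0 < r) :
    -∫ x, energyDeriv q a v x * ∫ z, secondDiff v x z * levyKer θ z ≤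
      2 * (sphereArea n * (r ^ (q - θ) / (q - θ))) * (∫ x, |v x| ^ q) +
      2 * q * ((∫ x, |v x|) * (((sphereArea n / (θ * q)) ^ (1 / q) * r ^ (-θ)) *
        (∫ x, (a x * |v x|) ^ q) ^ (1 - 1 / q))) := by
  have hn' : (2 : ℝ) ≤ n := by exact_mod_cast hn
  have hn1 : 1 ≤ n := by omega
  have hq0 : 0 < q := by linarith
  obtain ⟨Ca, hCa⟩ := ha.bounded
  have hac := ha.continuous
  set P := energyDeriv q a v with hP
  have hPm : Measurable P := ha.measurable_energyDeriv hv.measurable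
  set CP := q * (Ca ^ q * Cv ^ (q - 1))
  have hPC : ∀ x, |P x| ≤ CP := fun x => ha.abs_energyDeriv_le hq1 hCa (hCv x)
  have hCP0 : 0 ≤ CP := (abs_nonneg _).trans (hPC 0)
  have hsdc : Continuous fun p : Eu n × Eu n => secondDiff v p.1 p.2 := by
    unfold secondDiff; fun_prop
  have hsdi : ∀ z, Integrable fun x => secondDiff v x z := fun z =>
    ((hvi.const_mul 2).sub (hvi.comp_add_right z)).sub (hvi.comp_sub_right z)
  have hPsd : ∀ z, Integrable fun x => P x * secondDiff v x z := fun z =>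
    (hsdi z).bdd_mul hPm.aestronglyMeasurable (.of_forall hPC)
  set Q : Eu n → ℝ := fun z => -∫ x, P x * secondDiff v x z with hQ
  -- `P` is bounded, so the `L¹` second difference bounds give `min 1 |z|²` against the kernel and
  -- Fubini applies.
  have hprod : Integrable (fun p : Eu n × Eu n => P p.1 * (secondDiff v p.1 p.2 * levyKer θ p.2))
      (volume.prod volume) := by
    have hm : AEStronglyMeasurable
        (fun p : Eu n × Eu n => P p.1 * (secondDiff v p.1 p.2 * levyKer θ p.2))
        (volume.prod volume) := ((hPm.comp measurable_fst).mul
          (hsdc.measurable.mul (measurable_levyKer.comp measurable_snd))).aestronglyMeasurable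
    have hm2 : AEStronglyMeasurable (fun z => ∫ x, ‖P x * secondDiff v x z‖)
        (volume : Measure (Eu n)) := by
      refine AEStronglyMeasurable.integral_prod_right' (f := fun p : Eu n × Eu n =>
        ‖P p.2 * secondDiff v p.2 p.1‖) ?_
      exact ((hPm.comp measurable_snd).mul
        (hsdc.comp continuous_swap).measurable).norm.aestronglyMeasurable
    rw [integrable_prod_iff' hm]
    refine ⟨.of_forall fun z => ?_, ?_⟩
    · simp_rw [← mul_assoc]
      exact (hPsd z).mul_const _
    · have hle : ∀ z, ∫ x, ‖P x * secondDiff v x z‖ ≤ CP * ∫ x, |secondDiff v x z| := fun z => by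
        rw [← integral_const_mul]
        refine integral_mono (hPsd z).norm ((hsdi z).abs.const_mul _) fun x => ?_
        simp only [norm_mul, Real.norm_eq_abs]
        gcongr
        exact hPC x
      have hnn : ∀ z, ‖∫ x, ‖P x * secondDiff v x z‖‖ = ∫ x, ‖P x * secondDiff v x z‖ := fun z =>
        Real.norm_of_nonneg (integral_nonneg fun _ => norm_nonneg _)
      have := integrable_mul_levyKer (C := CP * C) hn1 hθ hθ1 hm2
        (fun z => by
          rw [hnn]; exact (hle z).trans (mul_le_mul_of_nonneg_left (hC1 z) hCP0))
        (fun z => by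
          rw [hnn, mul_assoc]; exact (hle z).trans (mul_le_mul_of_nonneg_left (hC2 z) hCP0))
      refine this.congr (.of_forall fun z => ?_)
      simp only
      rw [← integral_mul_const]
      congr 1; ext x
      rw [← mul_assoc, norm_mul _ (levyKer θ z), Real.norm_of_nonneg (levyKer_nonneg θ z)]
  have hFub : -∫ x, P x * ∫ z, secondDiff v x z * levyKer θ z = ∫ z, Q z * levyKer θ z := by
    simp_rw [← integral_const_mul]
    rw [integral_integral_swap hprod, ← integral_neg]
    congr 1; ext z
    simp_rw [← mul_assoc]
    rw [integral_mul_const, hQ, neg_mul]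
  have hQi : Integrable fun z => Q z * levyKer θ z := by
    refine hprod.integral_prod_right.neg.congr (.of_forall fun z => ?_)
    simp only [Pi.neg_apply, ← mul_assoc]
    rw [integral_mul_const, hQ, neg_mul]
  have hvq : Integrable fun x => |v x| ^ q := integrable_abs_rpow hq1 hv hvi hCv
  have hvqc : Continuous fun x => |v x| ^ q := hv.abs.rpow_const fun x => Or.inr hq0.le
  have haq0 : ∀ x, 0 < a x ^ q := fun x => Real.rpow_pos_of_pos (ha.pos x) q
  have haqC : ∀ x, |a x ^ q| ≤ Ca ^ q := fun x => by
    rw [abs_of_pos (haq0 x)]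
    exact Real.rpow_le_rpow (ha.pos x).le (hCa x) hq0.le
  have haqc : Continuous fun x => a x ^ q := hac.rpow_const fun x => Or.inr hq0.le
  -- The tangent inequality at `v (x ± z)` with frozen weight, then a translation that moves the
  -- shifts onto `a^q`, whose second difference is at most `2‖z‖^q`.
  have hnear : ∀ z, Q z ≤ 2 * ‖z‖ ^ q * ∫ x, |v x| ^ q := fun z => by
    have i0 : Integrable fun x => a x ^ q * |v x| ^ q := integrable_of_abs_le_of_continuous haqc hvq haqC
    have i1 : ∀ z, Integrable fun x => a x ^ q * |v (x + z)| ^ q := fun z =>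
      integrable_of_abs_le_of_continuous haqc (hvq.comp_add_right z) haqC
    have i2 : ∀ z, Integrable fun x => a (x - z) ^ q * |v x| ^ q := fun z =>
      integrable_of_abs_le_of_continuous (haqc.comp (by fun_prop)) hvq fun x => haqC _
    have e1 : ∀ z, ∫ x, a x ^ q * |v (x + z)| ^ q = ∫ x, a (x - z) ^ q * |v x| ^ q := fun z => by
      rw [← integral_add_right_eq_self (fun x => a (x - z) ^ q * |v x| ^ q) z]
      simp
    calc Q z = ∫ x, -(P x * secondDiff v x z) := by rw [hQ, integral_neg]
      _ ≤ ∫ x, (a x ^ q * |v (x + z)| ^ q + a x ^ q * |v (x + -z)| ^ q -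
          2 * (a x ^ q * |v x| ^ q)) := by
        refine integral_mono (hPsd z).neg (((i1 z).add (i1 (-z))).sub (i0.const_mul 2)) fun x => ?_
        have h1 := mul_le_mul_of_nonneg_left (oddPow_mul_sub_le hq1 (v x) (v (x + z))) (haq0 x).le
        have h2 := mul_le_mul_of_nonneg_left (oddPow_mul_sub_le hq1 (v x) (v (x - z))) (haq0 x).le
        simp only [hP, energyDeriv, secondDiff, ← sub_eq_add_neg]
        linarith
      _ = ∫ x, (a (x - z) ^ q * |v x| ^ q + a (x + z) ^ q * |v x| ^ q -
          2 * (a x ^ q * |v x| ^ q)) := by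
        have j1 : Integrable fun x => a x ^ q * |v (x + z)| ^ q + a x ^ q * |v (x + -z)| ^ q :=
          (i1 z).add (i1 (-z))
        have i3 : Integrable fun x => a (x + z) ^ q * |v x| ^ q := by simpa using i2 (-z)
        have j2 : Integrable fun x => a (x - z) ^ q * |v x| ^ q + a (x + z) ^ q * |v x| ^ q :=
          (i2 z).add i3
        rw [integral_sub j1 (i0.const_mul 2), integral_sub j2 (i0.const_mul 2),
          integral_add (i1 z) (i1 (-z)), integral_add (i2 z) i3, e1, e1]
        simp
      _ ≤ ∫ x, 2 * ‖z‖ ^ q * |v x| ^ q := by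
        have i3 : Integrable fun x => a (x + z) ^ q * |v x| ^ q := by simpa using i2 (-z)
        refine integral_mono (((i2 z).add i3).sub (i0.const_mul 2)) (hvq.const_mul _) fun x => ?_
        have := mul_le_mul_of_nonneg_right (ha.add_le x z) (by positivity : 0 ≤ |v x| ^ q)
        simp only
        linarith
      _ = _ := integral_const_mul _ _
  set W : Eu n → ℝ := fun x => a x * |v x| with hW
  have hWc : Continuous W := hac.mul hv.abs
  have hW0 : ∀ x, 0 ≤ W x := fun x => mul_nonneg (ha.pos x).le (abs_nonneg _)
  have hWq : Integrable fun x => W x ^ q := by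
    refine (integrable_of_abs_le_of_continuous haqc hvq haqC).congr (.of_forall fun x => ?_)
    exact (Real.mul_rpow (ha.pos x).le (abs_nonneg _)).symm
  set S : Eu n → ℝ := fun z => ∫ x, W x ^ (q - 1) * |v (x + z)| with hS
  have hSi : ∀ z, Integrable fun x => W x ^ (q - 1) * |v (x + z)| := fun z =>
    integrable_of_abs_le_of_continuous (C := (Ca * Cv) ^ (q - 1))
      (hWc.rpow_const fun x => Or.inr (by linarith)) (hvi.comp_add_right z).abs fun x => by
      rw [abs_of_nonneg (Real.rpow_nonneg (hW0 x) _)]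
      exact Real.rpow_le_rpow (hW0 x) (mul_le_mul (hCa x) (hCv x) (abs_nonneg _)
        ((ha.pos x).le.trans (hCa x))) (by linarith)
  -- Here the weight moves along with `v`, with error `‖z‖`. The bound is linear in `‖z‖` and no
  -- longer asks for a `q`-th power of the kernel variable.
  have hfar : ∀ z, Q z ≤ q * ‖z‖ * (S z + S (-z)) := fun z => by
    have i1 : ∀ z, Integrable fun x => W (x + z) ^ q - W x ^ q := fun z =>
      (hWq.comp_add_right z).sub hWq
    have i2 : ∀ z : Eu n, Integrable fun x =>
        W (x + z) ^ q - W x ^ q + q * ‖z‖ * (W x ^ (q - 1) * |v (x + z)|) := fun z =>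
      (i1 z).add ((hSi z).const_mul _)
    have e1 : ∀ z, ∫ x, (W (x + z) ^ q - W x ^ q + q * ‖z‖ * (W x ^ (q - 1) * |v (x + z)|)) =
        q * ‖z‖ * S z := fun z => by
      rw [integral_add (i1 z) ((hSi z).const_mul _), integral_sub (hWq.comp_add_right z) hWq,
        integral_add_right_eq_self (fun x => W x ^ q), integral_const_mul]
      ring
    have hpt : ∀ x z, P x * (v (x + z) - v x) ≤
        W (x + z) ^ q - W x ^ q + q * ‖z‖ * (W x ^ (q - 1) * |v (x + z)|) := fun x z => by
      refine mul_oddPow_sub_le hq1 (ha.pos x).le (ha.pos (x + z)).le ?_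
      simpa [norm_neg] using ha.le_add x (x + z)
    calc Q z = ∫ x, -(P x * secondDiff v x z) := by rw [hQ, integral_neg]
      _ ≤ ∫ x, ((W (x + z) ^ q - W x ^ q + q * ‖z‖ * (W x ^ (q - 1) * |v (x + z)|)) +
          (W (x + -z) ^ q - W x ^ q + q * ‖-z‖ * (W x ^ (q - 1) * |v (x + -z)|))) := by
        refine integral_mono (hPsd z).neg ((i2 z).add (i2 (-z))) fun x => ?_
        refine le_trans (le_of_eq ?_) (add_le_add (hpt x z) (hpt x (-z)))
        simp only [secondDiff, ← sub_eq_add_neg]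
        ring
      _ = _ := by
        rw [integral_add (i2 z) (i2 (-z)), e1, e1, norm_neg]
        ring
  obtain ⟨hgi, hg⟩ := integrableOn_far hn1 hq1 hθ hqn hWc hW0 hWq hv hvi hr
  have hqθ : q ≠ (n : ℝ) + θ := by linarith
  have hvq0 : 0 ≤ ∫ x, |v x| ^ q := integral_nonneg fun x => by positivity
  have hball : ∫ z in ball (0 : Eu n) r, Q z * levyKer θ z ≤
      2 * (sphereArea n * (r ^ (q - θ) / (q - θ))) * ∫ x, |v x| ^ q := by
    have hs : -(n : ℝ) < q - (n + θ) := by linarith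
    have := integrableOn_norm_rpow_ball (n := n) (r := r) hn1 hs
    calc _ ≤ ∫ z in ball (0 : Eu n) r, (2 * ∫ x, |v x| ^ q) * ‖z‖ ^ (q - (n + θ)) := by
          refine integral_mono hQi.integrableOn (this.const_mul _) fun z => ?_
          simp only
          rw [← norm_rpow_mul_levyKer hqθ, ← mul_assoc]
          refine mul_le_mul_of_nonneg_right ((hnear z).trans_eq (by ring)) (levyKer_nonneg _ _)
      _ = _ := by
          rw [integral_const_mul, setIntegral_norm_rpow_ball hn1 hs hr]
          rw [show q - (n + θ) + n = q - θ by ring]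
          ring
  have hcompl : ∫ z in (ball (0 : Eu n) r)ᶜ, Q z * levyKer θ z ≤
      2 * q * ((∫ x, |v x|) * (((sphereArea n / (θ * q)) ^ (1 / q) * r ^ (-θ)) *
        (∫ x, W x ^ q) ^ (1 - 1 / q))) := by
    set g : Eu n → ℝ := fun z => ‖z‖ ^ (1 - ((n : ℝ) + θ)) * S z with hg_def
    calc _ ≤ ∫ z in (ball (0 : Eu n) r)ᶜ, q * (g z + g (-z)) := by
          refine integral_mono hQi.integrableOn
            ((hgi.add (integrableOn_far_reflect hgi)).const_mul q) fun z => ?_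
          simp only [hg_def, norm_neg]
          refine (mul_le_mul_of_nonneg_right (hfar z) (levyKer_nonneg _ _)).trans_eq ?_
          rw [← norm_rpow_mul_levyKer (by linarith : (1 : ℝ) ≠ n + θ), Real.rpow_one]
          ring
      _ = 2 * q * ∫ z in (ball (0 : Eu n) r)ᶜ, g z := by
          rw [integral_const_mul, integral_add hgi (integrableOn_far_reflect hgi),
            integral_far_reflect g]
          ring
      _ ≤ _ := by gcongr
  rw [hFub, ← integral_add_compl measurableSet_ball hQi]
  exact add_le_add hball hcompl

end fractionalEnergy

/-! ### The mollified drift and its commutator. -/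

section drift

variable {n : ℕ} {q M β : ℝ} {u ρ : Eu n → ℝ}

/-- The mollified drift `∫ u(y) ∇ρ(x - y) · ∇ψ(y) dy`. -/
noncomputable def driftFlux (ρ u : Eu n → ℝ) (x : Eu n) : ℝ :=
  ∫ y, u y * fderiv ℝ ρ (x - y) (gradPotential u y)

/-- The commutator of the mollification with the drift. -/
noncomputable def driftComm (ρ u : Eu n → ℝ) (x : Eu n) : ℝ :=
  driftFlux ρ u x - fderiv ℝ (conv ρ u) x (gradPotential u x) +
    divConst n * (conv ρ u x * u x)

lemma exists_norm_gradPotential_le (hn : 2 ≤ n) (hu : Integrable u) (hM : ∀ᵐ y, |u y| ≤ M) :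
    ∃ β, ∀ x, ‖gradPotential u x‖ ≤ β := ⟨_, fun x => norm_gradPotential_le hn hu hM x one_pos⟩

lemma integral_fderiv_eq_zero {F : Eu n → ℝ} (hF : IsTest F) (w : Eu n) :
    ∫ x, fderiv ℝ F x w = 0 := by
  have h := integral_smul_fderiv_eq_neg_fderiv_smul_of_integrable (μ := (volume : Measure (Eu n)))
    (f := fun _ => (1 : ℝ)) (g := F) (v := w) (by simp)
    (by simpa using hF.integrable_fderiv.apply_continuousLinearMap w) (by simpa using hF.integrable)
    (by fun_prop) (fun x _ => hF.contDiff.differentiable one_ne_zero x)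
  simpa using h

lemma fderiv_comp_const_sub {F : Eu n → ℝ} (hF : IsTest F) (x y : Eu n) :
    fderiv ℝ (fun y => F (x - y)) y = -fderiv ℝ F (x - y) := by
  have h := ((hF.contDiff.differentiable one_ne_zero) (x - y)).hasFDerivAt.comp y
    ((hasFDerivAt_id y).const_sub x)
  rw [Function.comp_def] at h
  rw [h.fderiv]
  ext w; simp

lemma IsTest.comp_const_sub {F : Eu n → ℝ} (hF : IsTest F) (x : Eu n) :
    IsTest (fun y => F (x - y)) where
  contDiff := hF.contDiff.comp (contDiff_const.sub contDiff_id)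
  integrable := hF.integrable.comp_sub_left x
  integrable_fderiv := by
    simp_rw [funext fun y => fderiv_comp_const_sub hF x y]
    exact (hF.integrable_fderiv.comp_sub_left x).neg
  bounded := hF.bounded.imp fun C hC y => hC _
  bounded_fderiv := hF.bounded_fderiv.imp fun C hC y => by
    rw [fderiv_comp_const_sub hF, norm_neg]; exact hC _

lemma integrable_fderiv_apply {L : Eu n → Eu n →L[ℝ] ℝ} (hL : Integrable L) {X : Eu n → Eu n}
    (hX : AEStronglyMeasurable X) (hβ : ∀ x, ‖X x‖ ≤ β) : Integrable fun x => L x (X x) := by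
  refine (hL.norm.mul_const β).mono' (aestronglyMeasurable_clm_apply hL.aestronglyMeasurable hX)
    (.of_forall fun x => ((L x).le_opNorm _).trans ?_)
  gcongr
  exact hβ x

lemma integral_fderiv_sub_gradPotential (hn : 2 ≤ n) (hu : Integrable u) (hM : ∀ᵐ y, |u y| ≤ M)
    (hρ : IsTest ρ) (x : Eu n) :
    ∫ y, fderiv ℝ ρ (x - y) (gradPotential u y) = -(divConst n * conv ρ u x) := by
  have h := integral_fderiv_gradPotential hn hu hM (hρ.comp_const_sub x)
  simp only [fderiv_comp_const_sub hρ, neg_apply, integral_neg] at h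
  rw [← neg_eq_iff_eq_neg, h]
  rfl

/-- Expanding the product of increments gives four terms: the flux, the transport of `conv ρ u` by
the field at `x`, the divergence term, and a multiple of `∫ ∇ρ = 0`. The double increment is what
beats the singularity of `∇ρ`. -/
lemma driftComm_eq (hn : 2 ≤ n) (hu : Integrable u) (hM : ∀ᵐ y, |u y| ≤ M) (hρ : IsTest ρ)
    (x : Eu n) :
    driftComm ρ u x =
      ∫ y, (u y - u x) * fderiv ℝ ρ (x - y) (gradPotential u y - gradPotential u x) := by
  obtain ⟨β, hβ⟩ := exists_norm_gradPotential_le hn hu hM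
  obtain ⟨C, hC⟩ := hρ.bounded_fderiv
  have hC0 : 0 ≤ C := (norm_nonneg _).trans (hC 0)
  have hb := aestronglyMeasurable_gradPotential hu.aestronglyMeasurable
  have hcont : Continuous fun y => fderiv ℝ ρ (x - y) :=
    hρ.continuous_fderiv.comp (by fun_prop)
  have hLi : Integrable fun y => fderiv ℝ ρ (x - y) := hρ.integrable_fderiv.comp_sub_left x
  have key {X : Eu n → Eu n} (hX : AEStronglyMeasurable X) {β : ℝ} (hβ : ∀ x, ‖X x‖ ≤ β) :
      Integrable fun y => u y * fderiv ℝ ρ (x - y) (X y) := by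
    refine (hu.norm.mul_const (C * β)).mono' (hu.aestronglyMeasurable.mul
      (aestronglyMeasurable_clm_apply hcont.aestronglyMeasurable hX)) (.of_forall fun y => ?_)
    rw [norm_mul]
    gcongr
    exact ((fderiv ℝ ρ (x - y)).le_opNorm _).trans (by gcongr; exacts [hC _, hβ _])
  have i1 := key hb hβ
  have i2 := key (X := fun _ => gradPotential u x) aestronglyMeasurable_const (fun _ => hβ x)
  have i3 := (integrable_fderiv_apply hLi hb hβ).const_mul (u x)
  have i4 := (integrable_fderiv_apply hLi (X := fun _ => gradPotential u x)
    aestronglyMeasurable_const (fun _ => hβ x)).const_mul (u x)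
  have e2 : ∫ y, u y * fderiv ℝ ρ (x - y) (gradPotential u x) =
      fderiv ℝ (conv ρ u) x (gradPotential u x) := by
    rw [fderiv_conv hρ hu, conv, ContinuousLinearMap.integral_apply
      (integrable_smul_comp_sub_left hρ.continuous_fderiv hC hu x)]
    rfl
  have e4 : ∫ y, fderiv ℝ ρ (x - y) (gradPotential u x) = 0 := by
    rw [integral_sub_left_eq_self (fun z => fderiv ℝ ρ z (gradPotential u x))]
    exact integral_fderiv_eq_zero hρ _
  have : ∀ y, (u y - u x) * fderiv ℝ ρ (x - y) (gradPotential u y - gradPotential u x) =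
      (u y * fderiv ℝ ρ (x - y) (gradPotential u y) -
        u y * fderiv ℝ ρ (x - y) (gradPotential u x)) -
      (u x * fderiv ℝ ρ (x - y) (gradPotential u y) -
        u x * fderiv ℝ ρ (x - y) (gradPotential u x)) := fun y => by
    rw [map_sub]; ring
  have i12 : Integrable fun y => u y * fderiv ℝ ρ (x - y) (gradPotential u y) -
      u y * fderiv ℝ ρ (x - y) (gradPotential u x) := i1.sub i2
  simp_rw [this]
  rw [integral_sub i12 (by exact i3.sub i4), integral_sub i1 i2, integral_sub i3 i4, e2,
    integral_const_mul, integral_const_mul, e4,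
    integral_fderiv_sub_gradPotential hn hu hM hρ, driftComm, driftFlux]
  ring

end drift

/-! ### The weighted power `a^q |v|^q` as a test function. -/

section weightedPowers

variable {n : ℕ} {q : ℝ} {a v : Eu n → ℝ}

lemma IsWeight.hasFDerivAt_rpow (ha : IsWeight q a) (x : Eu n) :
    HasFDerivAt (fun x => a x ^ q) ((q * a x ^ (q - 1)) • fderiv ℝ a x) x :=
  ((ha.contDiff.differentiable one_ne_zero) x).hasFDerivAt.rpow_const (Or.inl (ha.pos x).ne')

lemma IsWeight.hasFDerivAt_mul_rpow (hq : 1 < q) (ha : IsWeight q a) (hv : Differentiable ℝ v)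
    (x : Eu n) :
    HasFDerivAt (fun x => a x ^ q * |v x| ^ q) (energyDeriv q a v x • fderiv ℝ v x +
      (|v x| ^ q * (q * a x ^ (q - 1))) • fderiv ℝ a x) x := by
  have h := (ha.hasFDerivAt_rpow x).mul
    ((hasDerivAt_abs_rpow (v x) hq).comp_hasFDerivAt x (hv x).hasFDerivAt)
  refine h.congr_fderiv ?_
  simp only [smul_smul, energyDeriv, oddPow, Function.comp_apply]
  congr 2; ring

lemma IsWeight.isTest_mul_rpow (hq : 1 < q) (ha : IsWeight q a) (hv : IsTest v) :
    IsTest (fun x => a x ^ q * |v x| ^ q) := by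
  obtain ⟨Ca, hCa⟩ := ha.bounded
  obtain ⟨Cv, hCv⟩ := hv.bounded
  obtain ⟨Dv, hDv⟩ := hv.bounded_fderiv
  have hd := hv.contDiff.differentiable one_ne_zero
  have hq1 : 0 ≤ q - 1 := by linarith
  have hCa0 : 0 ≤ Ca := (ha.pos 0).le.trans (hCa 0)
  have hCv0 : 0 ≤ Cv := (norm_nonneg _).trans (hCv 0)
  have hcont : ContDiff ℝ 1 (fun x => a x ^ q * |v x| ^ q) :=
    (ha.contDiff.rpow_const_of_ne fun x => (ha.pos x).ne').mul (hv.contDiff.norm_rpow hq)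
  have hvq := integrable_abs_rpow hq hv.contDiff.continuous hv.integrable hCv
  have hfd : fderiv ℝ (fun x => a x ^ q * |v x| ^ q) = fun x =>
    energyDeriv q a v x • fderiv ℝ v x + (|v x| ^ q * (q * a x ^ (q - 1))) • fderiv ℝ a x :=
      funext fun x => (ha.hasFDerivAt_mul_rpow hq hd x).fderiv
  have hbd : ∀ x, ‖fderiv ℝ (fun x => a x ^ q * |v x| ^ q) x‖ ≤
      q * (Ca ^ q * Cv ^ (q - 1)) * ‖fderiv ℝ v x‖ + |v x| ^ q * (q * Ca ^ (q - 1)) := fun x => by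
    rw [hfd]
    have h0 := ha.pos x
    refine (norm_add_le _ _).trans (add_le_add ?_ ?_)
    · rw [norm_smul]
      gcongr
      exact ha.abs_energyDeriv_le hq hCa (hCv x)
    · rw [norm_smul, Real.norm_of_nonneg (by positivity)]
      refine (mul_le_of_le_one_right (by positivity) (ha.norm_fderiv_le x)).trans ?_
      gcongr
      exact hCa x
  refine ⟨hcont, ?_, ?_, ⟨Ca ^ q * Cv ^ q, fun x => ?_⟩, ⟨q * (Ca ^ q * Cv ^ (q - 1)) * Dv +
    Cv ^ q * (q * Ca ^ (q - 1)), fun x => (hbd x).trans ?_⟩⟩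
  · refine integrable_of_abs_le_of_continuous (C := Ca ^ q)
      (ha.continuous.rpow_const fun x => Or.inl (ha.pos x).ne') hvq fun x => ?_
    have h0 := ha.pos x
    rw [abs_of_nonneg (by positivity)]
    gcongr
    exact hCa x
  · exact ((hv.integrable_fderiv.norm.const_mul _).add (hvq.mul_const _)).mono'
      (hcont.continuous_fderiv one_ne_zero).aestronglyMeasurable (.of_forall hbd)
  · have h0 := ha.pos x
    rw [Real.norm_of_nonneg (by positivity)]
    gcongr
    exacts [hCa x, hCv x]
  · gcongr
    exacts [hDv x, hCv x]

end weightedPowers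

/-! ### The weighted energy estimate for the drift. -/

section driftEnergy

variable {n : ℕ} {q M β : ℝ} {a u ρ : Eu n → ℝ}

lemma integrable_driftFlux (hn : 2 ≤ n) (hu : Integrable u) (hM : ∀ᵐ y, |u y| ≤ M)
    (hρ : IsTest ρ) : Integrable (driftFlux ρ u) := by
  obtain ⟨β, hβ⟩ := exists_norm_gradPotential_le hn hu hM
  have hb := aestronglyMeasurable_gradPotential hu.aestronglyMeasurable
  have hm : AEStronglyMeasurable (fun p : Eu n × Eu n =>
      u p.2 * fderiv ℝ ρ (p.1 - p.2) (gradPotential u p.2)) (volume.prod volume) :=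
    hu.aestronglyMeasurable.comp_snd.mul (aestronglyMeasurable_clm_apply
      (hρ.continuous_fderiv.comp (by fun_prop)).aestronglyMeasurable hb.comp_snd)
  have hprod := integrable_conv_integrand_prod hρ.integrable_fderiv hu
  refine Integrable.integral_prod_left ((hprod.norm.mul_const β).mono' hm (.of_forall fun p => ?_))
  rw [norm_mul, norm_smul, mul_assoc]
  gcongr
  exact (fderiv ℝ ρ (p.1 - p.2)).le_opNorm_of_le (hβ _)

lemma abs_driftFlux_le (hu : Integrable u) (hβ : ∀ x, ‖gradPotential u x‖ ≤ β) {C : ℝ}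
    (hC : ∀ x, ‖fderiv ℝ ρ x‖ ≤ C) (x : Eu n) : |driftFlux ρ u x| ≤ (∫ y, |u y|) * (C * β) := by
  have hC0 : 0 ≤ C := (norm_nonneg _).trans (hC 0)
  rw [← integral_mul_const, ← Real.norm_eq_abs]
  refine norm_integral_le_of_norm_le (hu.abs.mul_const _) (.of_forall fun y => ?_)
  rw [norm_mul, Real.norm_eq_abs]
  gcongr
  exact ((fderiv ℝ ρ (x - y)).le_opNorm _).trans (by gcongr; exacts [hC _, hβ _])

lemma integral_abs_driftFlux_le (hu : Integrable u) (hρ : IsTest ρ)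
    (hβ : ∀ x, ‖gradPotential u x‖ ≤ β) :
    ∫ x, |driftFlux ρ u x| ≤ (∫ y, |u y|) * ((∫ z, ‖fderiv ℝ ρ z‖) * β) := by
  have h := integral_norm_conv_le (k := fun z => ‖fderiv ℝ ρ z‖) hρ.integrable_fderiv.norm hu.abs
  have hi := integrable_conv (k := fun z => ‖fderiv ℝ ρ z‖) hρ.integrable_fderiv.norm hu.abs
  have h0 : ∀ x, 0 ≤ conv (fun z => ‖fderiv ℝ ρ z‖) (fun y => |u y|) x := fun x =>
    integral_nonneg fun y => by simp only [smul_eq_mul]; positivity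
  obtain ⟨C, hC⟩ := hρ.bounded_fderiv
  have h1 : ∀ x, |driftFlux ρ u x| ≤ conv (fun z => ‖fderiv ℝ ρ z‖) (fun y => |u y|) x * β :=
    fun x => by
      rw [conv, ← integral_mul_const, ← Real.norm_eq_abs]
      refine norm_integral_le_of_norm_le ((integrable_smul_comp_sub_left
        hρ.continuous_fderiv.norm (by simpa using hC) hu.abs x).mul_const _) (.of_forall fun y => ?_)
      rw [norm_mul, Real.norm_eq_abs, smul_eq_mul, mul_assoc]
      gcongr
      exact (fderiv ℝ ρ (x - y)).le_opNorm_of_le (hβ _)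
  refine (integral_mono_of_nonneg (.of_forall fun _ => abs_nonneg _) (hi.mul_const β)
    (.of_forall h1)).trans ?_
  rw [integral_mul_const, ← mul_assoc]
  refine mul_le_mul_of_nonneg_right ?_ ((norm_nonneg _).trans (hβ 0))
  simpa [abs_of_nonneg (h0 _)] using h

lemma integrable_driftComm (hn : 2 ≤ n) (hu : Integrable u) (hM : ∀ᵐ y, |u y| ≤ M)
    (hρ : IsTest ρ) : Integrable (driftComm ρ u) := by
  obtain ⟨β, hβ⟩ := exists_norm_gradPotential_le hn hu hM
  have hv := isTest_conv hρ hu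
  obtain ⟨C, hC⟩ := hv.bounded
  exact ((integrable_driftFlux hn hu hM hρ).sub (integrable_fderiv_apply hv.integrable_fderiv
    (aestronglyMeasurable_gradPotential hu.aestronglyMeasurable) hβ)).add
    ((integrable_of_abs_le_of_continuous hv.contDiff.continuous hu hC).const_mul _)

lemma integral_rpow_sub_one_mul_le (hq : 1 < q) {W v : Eu n → ℝ} (hW : ∀ x, 0 ≤ W x)
    (hWm : AEStronglyMeasurable W) (hWq : Integrable fun x => W x ^ q)
    (hvm : AEStronglyMeasurable v) (hvq : Integrable fun x => |v x| ^ q) :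
    Integrable (fun x => W x ^ (q - 1) * |v x|) ∧
    ∫ x, W x ^ (q - 1) * |v x| ≤
      (∫ x, W x ^ q) ^ (1 - 1 / q) * (∫ x, |v x| ^ q) ^ (1 / q) := by
  have hpq := (Real.HolderConjugate.conjExponent hq).symm
  have hq0 : 0 < q := by linarith
  have e1 : ∀ x, (W x ^ (q - 1)) ^ q.conjExponent = W x ^ q := fun x => by
    rw [← Real.rpow_mul (hW x), hpq.symm.sub_one_mul_conj]
  have hc0 : q.conjExponent ≠ 0 := hpq.ne_zero
  have m1 : MemLp (fun x => W x ^ (q - 1)) (ENNReal.ofReal q.conjExponent) volume := by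
    rw [← integrable_norm_rpow_iff (hWm.aemeasurable.pow_const _).aestronglyMeasurable
      (by simpa using hpq.pos) ENNReal.ofReal_ne_top, ENNReal.toReal_ofReal hpq.nonneg]
    refine hWq.congr (.of_forall fun x => ?_)
    simp only
    rw [Real.norm_of_nonneg (Real.rpow_nonneg (hW x) _), e1]
  have m2 : MemLp (fun x => |v x|) (ENNReal.ofReal q) volume := by
    refine (integrable_norm_rpow_iff hvm.norm (by simpa using hq0) ENNReal.ofReal_ne_top).1 ?_
    simpa [ENNReal.toReal_ofReal hq0.le] using hvq
  have hcc : ENNReal.HolderConjugate (ENNReal.ofReal q.conjExponent) (ENNReal.ofReal q) :=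
    hpq.ennrealOfReal
  refine ⟨m1.integrable_mul m2, ?_⟩
  have := integral_mul_le_Lp_mul_Lq_of_nonneg hpq
    (.of_forall fun x => Real.rpow_nonneg (hW x) (q - 1)) (.of_forall fun x => abs_nonneg (v x)) m1 m2
  simp_rw [e1] at this
  have e2 : 1 / q.conjExponent = 1 - 1 / q := by
    rw [Real.conjExponent]; field_simp
  rwa [e2] at this

/-- The weighted energy estimate for the mollified drift. -/
lemma integral_energyDeriv_mul_driftFlux_le (hn : 2 ≤ n) (hq : 1 < q) (ha : IsWeight q a)
    (hu : Integrable u) (hM : ∀ᵐ y, |u y| ≤ M) (hβ : ∀ x, ‖gradPotential u x‖ ≤ β)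
    (hρ : IsTest ρ) {Ca Cv : ℝ} (hCa : ∀ x, a x ≤ Ca) (hCv : ∀ x, |conv ρ u x| ≤ Cv) :
    ∫ x, energyDeriv q a (conv ρ u) x * driftFlux ρ u x ≤
      |divConst n| * (q - 1) * M * (∫ x, (a x * |conv ρ u x|) ^ q) +
      q * β * ((∫ x, (a x * |conv ρ u x|) ^ q) ^ (1 - 1 / q) *
        (∫ x, |conv ρ u x| ^ q) ^ (1 / q)) +
      q * (Ca ^ q * Cv ^ (q - 1)) * ∫ x, |driftComm ρ u x| := by
  have hv := isTest_conv hρ hu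
  have hF := ha.isTest_mul_rpow hq hv
  set v := conv ρ u with hv_def
  set b := gradPotential u with hb_def
  have hb : AEStronglyMeasurable b := aestronglyMeasurable_gradPotential hu.aestronglyMeasurable
  have hd := hv.contDiff.differentiable one_ne_zero
  have hq0 : 0 < q := by linarith
  have hβ0 : 0 ≤ β := (norm_nonneg _).trans (hβ 0)
  have hFW : ∀ x, a x ^ q * |v x| ^ q = (a x * |v x|) ^ q := fun x =>
    (Real.mul_rpow (ha.pos x).le (abs_nonneg _)).symm
  have hvq := integrable_abs_rpow hq hv.contDiff.continuous hv.integrable hCv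
  have hW0 : ∀ x, 0 ≤ a x * |v x| := fun x => mul_nonneg (ha.pos x).le (abs_nonneg _)
  obtain ⟨hHi, hH⟩ := integral_rpow_sub_one_mul_le hq hW0
    (ha.continuous.mul hv.contDiff.continuous.abs).aestronglyMeasurable
    (hF.integrable.congr (.of_forall hFW)) hv.contDiff.continuous.aestronglyMeasurable hvq
  have hPm := (ha.measurable_energyDeriv hv.contDiff.continuous.measurable).aestronglyMeasurable
    (μ := (volume : Measure (Eu n)))
  have hDF : ∀ x, fderiv ℝ (fun x => a x ^ q * |v x| ^ q) x (b x) =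
      energyDeriv q a v x * fderiv ℝ v x (b x) +
        |v x| ^ q * (q * a x ^ (q - 1)) * fderiv ℝ a x (b x) := fun x => by
    rw [(ha.hasFDerivAt_mul_rpow hq hd x).fderiv]; rfl
  have hPv : ∀ x, energyDeriv q a v x * v x = q * (a x ^ q * |v x| ^ q) := fun x => by
    rw [energyDeriv, ← oddPow_mul_self hq]; ring
  have hvH : ∀ x, |v x| ^ q * a x ^ (q - 1) = (a x * |v x|) ^ (q - 1) * |v x| := fun x => by
    rw [Real.mul_rpow (ha.pos x).le (abs_nonneg _), mul_assoc,
      rpow_sub_one_mul_self hq (abs_nonneg _), mul_comm]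
  -- The transport term is the derivative of `a^q |v|^q` along the field, minus the part falling on
  -- the weight. The exact derivative is integrated by parts through the weak divergence identity.
  have ident : ∀ x, energyDeriv q a v x * driftFlux ρ u x =
      energyDeriv q a v x * driftComm ρ u x + fderiv ℝ (fun x => a x ^ q * |v x| ^ q) x (b x) +
      (-(q * ((a x * |v x|) ^ (q - 1) * |v x|) * fderiv ℝ a x (b x))) -
      divConst n * q * (u x * (a x ^ q * |v x| ^ q)) := fun x => by
    rw [hDF, ← hvH, driftComm, ← hv_def]
    linear_combination -divConst n * u x * hPv x
  have hPb : ∀ x, |energyDeriv q a v x| ≤ q * (Ca ^ q * Cv ^ (q - 1)) := fun x =>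
    ha.abs_energyDeriv_le hq hCa (hCv x)
  have hci := integrable_driftComm hn hu hM hρ
  have i1 : Integrable fun x => energyDeriv q a v x * driftComm ρ u x :=
    hci.bdd_mul hPm (.of_forall hPb)
  have i2 := integrable_fderiv_apply hF.integrable_fderiv hb hβ
  have b3 : ∀ x, ‖q * ((a x * |v x|) ^ (q - 1) * |v x|) * fderiv ℝ a x (b x)‖ ≤
      q * ((a x * |v x|) ^ (q - 1) * |v x|) * β := fun x => by
    have := hW0 x
    rw [norm_mul, Real.norm_of_nonneg (by positivity)]
    gcongr
    exact ((fderiv ℝ a x).le_opNorm _).trans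
      ((mul_le_mul (ha.norm_fderiv_le x) (hβ x) (norm_nonneg _) zero_le_one).trans_eq (one_mul _))
  have i3 : Integrable fun x => -(q * ((a x * |v x|) ^ (q - 1) * |v x|) * fderiv ℝ a x (b x)) :=
    (((hHi.const_mul q).mul_const β).mono' (((hHi.const_mul q).aestronglyMeasurable).mul
      (aestronglyMeasurable_clm_apply (ha.contDiff.continuous_fderiv one_ne_zero).aestronglyMeasurable
        hb)) (.of_forall b3)).neg
  have b4 : ∀ᵐ x, ‖u x * (a x ^ q * |v x| ^ q)‖ ≤ M * (a x ^ q * |v x| ^ q) := by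
    filter_upwards [hM] with x hx
    have h0 := ha.pos x
    rw [norm_mul, Real.norm_of_nonneg (by positivity : 0 ≤ a x ^ q * |v x| ^ q)]
    gcongr
    exact hx
  have i4 : Integrable fun x => u x * (a x ^ q * |v x| ^ q) :=
    (hF.integrable.const_mul M).mono'
      (hu.aestronglyMeasurable.mul hF.integrable.aestronglyMeasurable) b4
  have i12 := i1.add i2
  have i123 := i12.add i3
  simp_rw [ident]
  rw [integral_sub (by exact i123) (i4.const_mul _), integral_add (by exact i12) i3,
    integral_add i1 i2, integral_fderiv_gradPotential hn hu hM hF, integral_const_mul]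
  have t1 : ∫ x, energyDeriv q a v x * driftComm ρ u x ≤
      q * (Ca ^ q * Cv ^ (q - 1)) * ∫ x, |driftComm ρ u x| := by
    rw [← integral_const_mul]
    refine integral_mono i1 (hci.abs.const_mul _) fun x => (le_abs_self _).trans ?_
    simp only
    rw [abs_mul]
    gcongr
    exact hPb x
  have t3 : ∫ x, -(q * ((a x * |v x|) ^ (q - 1) * |v x|) * fderiv ℝ a x (b x)) ≤
      q * β * ∫ x, (a x * |v x|) ^ (q - 1) * |v x| := by
    rw [← integral_const_mul]
    refine integral_mono i3 (hHi.const_mul _) fun x => (neg_le_abs _).trans ((b3 x).trans_eq ?_)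
    ring
  have t4 : |∫ x, u x * (a x ^ q * |v x| ^ q)| ≤ M * ∫ x, (a x * |v x|) ^ q := by
    rw [← integral_const_mul, ← Real.norm_eq_abs]
    refine norm_integral_le_of_norm_le ((hF.integrable.congr (.of_forall hFW)).const_mul M) ?_
    filter_upwards [b4] with x hx
    rwa [← hFW]
  -- The two divergence contributions combine with factor `1 - q`; no sign of `u` is used, only its
  -- supremum.
  have t5 : divConst n * (∫ x, u x * (a x ^ q * |v x| ^ q)) -
      divConst n * q * ∫ x, u x * (a x ^ q * |v x| ^ q) ≤
      |divConst n| * (q - 1) * M * ∫ x, (a x * |v x|) ^ q := by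
    calc _ = -(divConst n * (∫ x, u x * (a x ^ q * |v x| ^ q))) * (q - 1) := by ring
      _ ≤ |divConst n * (∫ x, u x * (a x ^ q * |v x| ^ q))| * (q - 1) := by
          exact mul_le_mul_of_nonneg_right (neg_le_abs _) (by linarith)
      _ ≤ |divConst n| * (M * ∫ x, (a x * |v x|) ^ q) * (q - 1) := by
          rw [abs_mul]
          gcongr
      _ = _ := by ring
  have t6 := mul_le_mul_of_nonneg_left hH (by positivity : 0 ≤ q * β)
  linarith

end driftEnergy

/-! ### The commutator vanishes in `L¹` as the mollifier shrinks. -/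

section commutator

variable {n : ℕ} {M ε : ℝ} {u ρ : Eu n → ℝ}

/-- Strong continuity of the translation action on `L²`, written for functions instead of classes.
-/
lemma MemLp.tendsto_eLpNorm_translate {u : Eu n → ℝ} (hu : MemLp u 2 volume) :
    Tendsto (fun h : Eu n => eLpNorm (fun x => u (h + x) - u x) 2 volume) (𝓝 0) (𝓝 0) := by
  have : Fact ((2 : ℝ≥0∞) ≠ ∞) := ⟨by simp⟩
  have hc : Continuous fun h : Eu n => DomAddAct.mk h +ᵥ hu.toLp u :=
    (DomAddAct.continuous_mk.vadd continuous_const)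
  have h1 : Tendsto (fun h : Eu n => edist (DomAddAct.mk h +ᵥ hu.toLp u)
      (DomAddAct.mk (0 : Eu n) +ᵥ hu.toLp u)) (𝓝 0) (𝓝 0) := by
    have := (hc.edist (continuous_const (y := DomAddAct.mk (0 : Eu n) +ᵥ hu.toLp u))).tendsto 0
    simpa using this
  refine h1.congr fun h => ?_
  rw [DomAddAct.mk_vadd_toLp, DomAddAct.mk_vadd_toLp, Lp.edist_toLp_toLp]
  congr 1
  ext x; simp

/-- For a fixed shift `h`, Cauchy–Schwarz in `x` bounds the product of increments: `η` for the
density, and a multiple of `‖h‖ ‖u‖₂` for the field. As `∇ρ` vanishes beyond `ε`, integrating in `h`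
costs `ε ∫ |∇ρ|`. -/
lemma lintegral_enorm_driftComm_le (hn : 2 ≤ n) (hu : Integrable u) (hM : ∀ᵐ y, |u y| ≤ M)
    (hρ : IsTest ρ) (hε : ∀ x, ε < ‖x‖ → fderiv ℝ ρ x = 0) (hε0 : 0 ≤ ε) {η : ℝ≥0∞}
    (hη : ∀ h : Eu n, ‖h‖ ≤ ε → eLpNorm (fun x => u (h + x) - u x) 2 volume ≤ η) :
    ∫⁻ x, ‖driftComm ρ u x‖ₑ ≤
      ENNReal.ofReal (|newtonConst n| * kernMass n * (ε * ∫ z, ‖fderiv ℝ ρ z‖)) *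
        (eLpNorm u 2 volume * η) := by
  set b := gradPotential u with hb_def
  have hb : AEStronglyMeasurable b := aestronglyMeasurable_gradPotential hu.aestronglyMeasurable
  set K := |newtonConst n| * kernMass n with hK
  have e2 {f : Eu n → ℝ} : eLpNorm f 2 volume = (∫⁻ x, ‖f x‖ₑ ^ (2 : ℝ)) ^ (1 / 2 : ℝ) := by
    simp [eLpNorm_eq_lintegral_rpow_enorm_toReal]
  have hK0 : 0 ≤ K := mul_nonneg (abs_nonneg _) (kernMass_nonneg n)
  have hqm := quasiMeasurePreserving_sub_of_right_invariant (volume : Measure (Eu n)) volume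
  have hmeas : AEMeasurable (fun p : Eu n × Eu n => ‖fderiv ℝ ρ p.2‖ₑ *
      (‖u (p.1 - p.2) - u p.1‖ₑ * ‖b (p.1 - p.2) - b p.1‖ₑ)) (volume.prod volume) := by
    have m1 : AEMeasurable (fun p : Eu n × Eu n => ‖fderiv ℝ ρ p.2‖ₑ) (volume.prod volume) :=
      (hρ.continuous_fderiv.comp continuous_snd).enorm.measurable.aemeasurable
    have m2 := (hu.aestronglyMeasurable.comp_quasiMeasurePreserving hqm).sub
      hu.aestronglyMeasurable.comp_fst
    have m3 := (hb.comp_quasiMeasurePreserving hqm).sub hb.comp_fst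
    exact m1.mul (m2.enorm.mul m3.enorm)
  have hinner : ∀ h : Eu n, ‖h‖ ≤ ε → ∫⁻ x, ‖u (x - h) - u x‖ₑ * ‖b (x - h) - b x‖ₑ ≤
      ENNReal.ofReal (K * ε) * (eLpNorm u 2 volume * η) := fun h hh => by
    have hmp := measurePreserving_sub_right (volume : Measure (Eu n)) h
    have hCS := ENNReal.lintegral_mul_le_Lp_mul_Lq (volume : Measure (Eu n))
      (Real.HolderConjugate.two_two)
      (f := fun x => ‖u (x - h) - u x‖ₑ) (g := fun x => ‖b (x - h) - b x‖ₑ)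
      ((hu.aestronglyMeasurable.comp_measurePreserving hmp).sub hu.aestronglyMeasurable).enorm
      ((hb.comp_measurePreserving hmp).sub hb).enorm
    refine hCS.trans ?_
    have t1 : (∫⁻ x, ‖u (x - h) - u x‖ₑ ^ (2 : ℝ)) ^ (1 / 2 : ℝ) ≤ η := by
      have := hη (-h) (by simpa using hh)
      rw [e2] at this
      simpa only [neg_add_eq_sub] using this
    have t2 : (∫⁻ x, ‖b (x - h) - b x‖ₑ ^ (2 : ℝ)) ^ (1 / 2 : ℝ) ≤
        ENNReal.ofReal (K * ε) * eLpNorm u 2 volume := by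
      have := lintegral_sq_gradPotential_add_sub_le hn hu hM (-h)
      simp only [← sub_eq_add_neg, norm_neg] at this
      rw [e2]
      refine (ENNReal.rpow_le_rpow this (by norm_num)).trans ?_
      rw [ENNReal.mul_rpow_of_nonneg _ _ (by norm_num), ENNReal.ofReal_rpow_of_nonneg (by positivity)
        (by norm_num), ← Real.sqrt_eq_rpow, Real.sqrt_sq (by positivity)]
      gcongr
    calc _ ≤ η * (ENNReal.ofReal (K * ε) * eLpNorm u 2 volume) := by
          exact mul_le_mul' t1 t2
      _ = _ := by ring
  calc ∫⁻ x, ‖driftComm ρ u x‖ₑ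
      ≤ ∫⁻ x, ∫⁻ h, ‖fderiv ℝ ρ h‖ₑ * (‖u (x - h) - u x‖ₑ * ‖b (x - h) - b x‖ₑ) := by
        refine lintegral_mono fun x => ?_
        rw [driftComm_eq hn hu hM hρ]
        refine (enorm_integral_le_lintegral_enorm _).trans ?_
        rw [← lintegral_sub_left_eq_self _ x]
        refine lintegral_mono fun h => ?_
        rw [sub_sub_cancel, enorm_mul, mul_left_comm]
        gcongr
        exact (fderiv ℝ ρ h).le_opENorm _
    _ = ∫⁻ h, ∫⁻ x, ‖fderiv ℝ ρ h‖ₑ * (‖u (x - h) - u x‖ₑ * ‖b (x - h) - b x‖ₑ) :=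
        lintegral_lintegral_swap hmeas
    _ ≤ ∫⁻ h, ‖fderiv ℝ ρ h‖ₑ * (ENNReal.ofReal (K * ε) * (eLpNorm u 2 volume * η)) := by
        refine lintegral_mono fun h => ?_
        rw [lintegral_const_mul' _ _ enorm_ne_top]
        rcases le_or_gt ‖h‖ ε with hh | hh
        · gcongr
          exact hinner h hh
        · have h0 : ‖fderiv ℝ ρ h‖ₑ = 0 := by
            rw [← ofReal_norm, hε h hh, norm_zero, ENNReal.ofReal_zero]
          rw [h0, zero_mul, zero_mul]
    _ = _ := by
        rw [lintegral_mul_const _ hρ.continuous_fderiv.enorm.measurable,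
          ← ofReal_integral_norm_eq_lintegral_enorm hρ.integrable_fderiv, ← mul_assoc,
          ← ENNReal.ofReal_mul (by positivity)]
        congr 2
        ring

lemma IsMollifier.fderiv_eq_zero (h : IsMollifier ε ρ) {x : Eu n} (hx : ε < ‖x‖) :
    fderiv ℝ ρ x = 0 := by
  have : ρ =ᶠ[𝓝 x] fun _ => 0 := by
    filter_upwards [(isOpen_lt continuous_const continuous_norm).mem_nhds hx] with y hy
    exact h.eq_zero y hy
  rw [this.fderiv_eq, fderiv_fun_const, Pi.zero_apply]

/-- The constant of the commutator estimate. -/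
noncomputable def commConst (n : ℕ) : ℝ :=
  |newtonConst n| * kernMass n * ∫ z, ‖fderiv ℝ (moll (n := n) 1 one_pos) z‖

lemma lintegral_enorm_driftComm_moll_le (hn : 2 ≤ n) (hu : Integrable u)
    (hM : ∀ᵐ y, |u y| ≤ M) (hε : 0 < ε) {η : ℝ≥0∞}
    (hη : ∀ h : Eu n, ‖h‖ ≤ ε → eLpNorm (fun x => u (h + x) - u x) 2 volume ≤ η) :
    ∫⁻ x, ‖driftComm (moll ε hε) u x‖ₑ ≤
      ENNReal.ofReal (commConst n) * (eLpNorm u 2 volume * η) := by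
  have hm := isMollifier_moll (n := n) ε hε
  refine (lintegral_enorm_driftComm_le hn hu hM hm.isTest (fun x => hm.fderiv_eq_zero) hε.le
    hη).trans_eq ?_
  rw [integral_norm_fderiv_moll, mul_inv_cancel_left₀ hε.ne', commConst]

lemma memLp_two_of_bounded (hu : Integrable u) (hM : ∀ᵐ y, |u y| ≤ M) : MemLp u 2 volume := by
  rw [memLp_two_iff_integrable_sq hu.aestronglyMeasurable]
  exact integrable_sq_of_bounded hu hM

/-- The increments of `u` are estimated trivially by `2‖u‖₂`. This bound, uniform in `ε`, is the
majorant for dominated convergence in time. -/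
lemma lintegral_enorm_driftComm_moll_le_sq (hn : 2 ≤ n) (hu : Integrable u)
    (hM : ∀ᵐ y, |u y| ≤ M) (hε : 0 < ε) :
    ∫⁻ x, ‖driftComm (moll ε hε) u x‖ₑ ≤
      ENNReal.ofReal (commConst n) * (eLpNorm u 2 volume * (2 * eLpNorm u 2 volume)) := by
  refine lintegral_enorm_driftComm_moll_le hn hu hM hε fun h _ => ?_
  have hmp := measurePreserving_add_left (volume : Measure (Eu n)) h
  refine (eLpNorm_sub_le (hu.aestronglyMeasurable.comp_measurePreserving hmp)
    hu.aestronglyMeasurable (by norm_num)).trans_eq ?_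
  rw [eLpNorm_comp_measurePreserving hu.aestronglyMeasurable hmp, two_mul]

lemma tendsto_lintegral_enorm_driftComm_moll (hn : 2 ≤ n) (hu : Integrable u)
    (hM : ∀ᵐ y, |u y| ≤ M) {ε : ℕ → ℝ} (hε : ∀ k, 0 < ε k) (h0 : Tendsto ε atTop (𝓝 0)) :
    Tendsto (fun k => ∫⁻ x, ‖driftComm (moll (ε k) (hε k)) u x‖ₑ) atTop (𝓝 0) := by
  have hu2 := memLp_two_of_bounded hu hM
  set η : ℕ → ℝ≥0∞ := fun k => ⨆ h : closedBall (0 : Eu n) (ε k),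
    eLpNorm (fun x => u (h.1 + x) - u x) 2 volume
  have hη : Tendsto η atTop (𝓝 0) := by
    rw [ENNReal.tendsto_nhds_zero]
    intro δ hδ
    obtain ⟨r, hr, h⟩ := Metric.eventually_nhds_iff.1
      (ENNReal.tendsto_nhds_zero.1 (MemLp.tendsto_eLpNorm_translate hu2) δ hδ)
    filter_upwards [h0.eventually_lt_const hr] with k hk
    exact iSup_le fun y => h (lt_of_le_of_lt y.2 hk)
  have hlim : Tendsto (fun k => ENNReal.ofReal (commConst n) * (eLpNorm u 2 volume * η k)) atTop
      (𝓝 0) := by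
    have := ENNReal.Tendsto.const_mul (ENNReal.Tendsto.const_mul hη
      (Or.inr hu2.2.ne)) (Or.inr (ENNReal.ofReal_ne_top (r := commConst n)))
    simpa using this
  refine tendsto_of_tendsto_of_tendsto_of_le_of_le tendsto_const_nhds hlim (fun _ => zero_le)
    fun k => lintegral_enorm_driftComm_moll_le hn hu hM (hε k) fun h hh => ?_
  exact le_iSup (fun h : closedBall (0 : Eu n) (ε k) =>
    eLpNorm (fun x => u (h.1 + x) - u x) 2 volume) ⟨h, by simpa using hh⟩

end commutator

/-! ### The singular integral operator and mollification. -/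

section levyOperator

variable {n : ℕ} {θ : ℝ} {u ρ : Eu n → ℝ}

/-- The singular integral `∫ (2φ(x) - φ(x + z) - φ(x - z)) |z|^{-n-θ} dz`. -/
noncomputable def levyOp (θ : ℝ) (φ : Eu n → ℝ) (x : Eu n) : ℝ :=
  ∫ z, secondDiff φ x z * levyKer θ z

lemma continuous_secondDiff_prod (hρ : Continuous ρ) :
    Continuous fun p : Eu n × Eu n => secondDiff ρ p.1 p.2 := by
  unfold secondDiff; fun_prop

lemma secondDiff_comp_const_sub (φ : Eu n → ℝ) (x y z : Eu n) :
    secondDiff (fun y => φ (x - y)) y z = secondDiff φ (x - y) z := by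
  simp only [secondDiff]
  rw [show x - (y + z) = x - y - z by abel, show x - (y - z) = x - y + z by abel]
  ring

lemma integrable_min_mul_levyKer (hn : 1 ≤ n) (hθ : 0 < θ) (hθ1 : θ ≤ 1) {C : ℝ} (hC : 0 ≤ C) :
    Integrable fun z : Eu n => min C (C * ‖z‖ ^ 2) * levyKer θ z := by
  have h0 : ∀ z : Eu n, 0 ≤ min C (C * ‖z‖ ^ 2) := fun z => le_min hC (by positivity)
  refine integrable_mul_levyKer (C := C) hn hθ hθ1 (by fun_prop) (fun z => ?_) fun z => ?_
  · rw [Real.norm_of_nonneg (h0 z)]; exact min_le_left _ _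
  · rw [Real.norm_of_nonneg (h0 z)]; exact min_le_right _ _

lemma abs_levyOp_le (hn : 1 ≤ n) (hθ : 0 < θ) (hθ1 : θ ≤ 1) {C : ℝ} (hC : 0 ≤ C)
    (h1 : ∀ x z, |secondDiff ρ x z| ≤ C) (h2 : ∀ x z, |secondDiff ρ x z| ≤ C * ‖z‖ ^ 2)
    (x : Eu n) : |levyOp θ ρ x| ≤ ∫ z : Eu n, min C (C * ‖z‖ ^ 2) * levyKer θ z := by
  rw [← Real.norm_eq_abs]
  refine norm_integral_le_of_norm_le (integrable_min_mul_levyKer hn hθ hθ1 hC)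
    (.of_forall fun z => ?_)
  rw [norm_mul, Real.norm_of_nonneg (levyKer_nonneg θ z)]
  exact mul_le_mul_of_nonneg_right (le_min (h1 x z) (h2 x z)) (levyKer_nonneg θ z)

lemma integrable_secondDiff_mul_levyKer_prod (hn : 1 ≤ n) (hθ : 0 < θ) (hθ1 : θ ≤ 1)
    (hρ : Continuous ρ) (hρi : Integrable ρ) {C : ℝ} (h3 : ∀ z, ∫ x, |secondDiff ρ x z| ≤ C)
    (h4 : ∀ z, ∫ x, |secondDiff ρ x z| ≤ C * ‖z‖ ^ 2) :
    Integrable (fun p : Eu n × Eu n => secondDiff ρ p.1 p.2 * levyKer θ p.2)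
      (volume.prod volume) := by
  have hc := continuous_secondDiff_prod hρ
  have hm : AEStronglyMeasurable (fun p : Eu n × Eu n => secondDiff ρ p.1 p.2 * levyKer θ p.2)
      (volume.prod volume) := hc.aestronglyMeasurable.mul
    (measurable_levyKer.comp measurable_snd).aestronglyMeasurable
  rw [integrable_prod_iff' hm]
  have hi : ∀ z, Integrable fun x => secondDiff ρ x z := fun z =>
    ((hρi.const_mul 2).sub (hρi.comp_add_right z)).sub (hρi.comp_sub_right z)
  refine ⟨.of_forall fun z => (hi z).mul_const (levyKer θ z), ?_⟩
  have h0 : ∀ z, 0 ≤ ∫ x, |secondDiff ρ x z| := fun z => integral_nonneg fun _ => abs_nonneg _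
  have hm : AEStronglyMeasurable (fun z => ∫ x, |secondDiff ρ x z|) (volume : Measure (Eu n)) :=
    (hc.abs.comp continuous_swap).aestronglyMeasurable.integral_prod_right'
  have := integrable_mul_levyKer (C := C) hn hθ hθ1 hm
    (fun z => by rw [Real.norm_of_nonneg (h0 z)]; exact h3 z)
    (fun z => by rw [Real.norm_of_nonneg (h0 z)]; exact h4 z)
  refine this.congr (.of_forall fun z => ?_)
  simp only [norm_mul, Real.norm_of_nonneg (levyKer_nonneg θ _), integral_mul_const,
    Real.norm_eq_abs]

/-- Convolution commutes with the singular integral by Fubini. The weak equation puts the operator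
on the mollifier; the energy estimate needs it on the mollified solution. -/
lemma conv_levyOp (hn : 1 ≤ n) (hθ : 0 < θ) (hθ1 : θ ≤ 1) (hρ : IsTest ρ) (hu : Integrable u)
    {C : ℝ} (hC : 0 ≤ C) (h1 : ∀ x z, |secondDiff ρ x z| ≤ C)
    (h2 : ∀ x z, |secondDiff ρ x z| ≤ C * ‖z‖ ^ 2) (x : Eu n) :
    conv (levyOp θ ρ) u x = levyOp θ (conv ρ u) x := by
  unfold levyOp
  simp_rw [secondDiff_conv hρ hu]
  unfold conv
  simp_rw [← integral_smul, ← integral_mul_const]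
  rw [integral_integral_swap]
  · simp only [smul_eq_mul, mul_assoc]
  · refine (hu.norm.mul_prod (integrable_min_mul_levyKer hn hθ hθ1 hC)).mono' ?_
      (.of_forall fun p => ?_)
    · exact hu.aestronglyMeasurable.comp_fst.smul (((continuous_secondDiff_prod
        hρ.contDiff.continuous).comp (by fun_prop : Continuous fun p : Eu n × Eu n =>
          (x - p.1, p.2))).aestronglyMeasurable.mul
        (measurable_levyKer.comp measurable_snd).aestronglyMeasurable)
    · simp only [Function.uncurry, norm_smul, norm_mul, Real.norm_of_nonneg (levyKer_nonneg θ _)]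
      exact mul_le_mul_of_nonneg_left (mul_le_mul_of_nonneg_right
        (le_min (h1 _ _) (h2 _ _)) (levyKer_nonneg _ _)) (norm_nonneg _)

end levyOperator

/-! ### The energy identity in time. -/

section chainRule

variable {q : ℝ}

/-- The velocity is only bounded and measurable in time, so the primitive is Lipschitz. Its
composition with `|·|^q`, Lipschitz on the bounded range, is absolutely continuous, and the chain
rule holds almost everywhere. -/
lemma abs_rpow_integral_sub (hq : 1 < q) {g : ℝ → ℝ} {T C : ℝ} (hT : 0 ≤ T)
    (hg : IntervalIntegrable g volume 0 T) (hC : ∀ s ∈ Ioc 0 T, |g s| ≤ C) (c : ℝ) :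
    |c + ∫ s in (0 : ℝ)..T, g s| ^ q - |c| ^ q =
      ∫ s in (0 : ℝ)..T, q * oddPow q (c + ∫ r in (0 : ℝ)..s, g r) * g s := by
  rcases hT.eq_or_lt with rfl | hT0
  · simp
  have hC0 : 0 ≤ C := (abs_nonneg _).trans (hC T ⟨hT0, le_rfl⟩)
  set f : ℝ → ℝ := fun t => c + ∫ s in (0 : ℝ)..t, g s with hf
  have hlip : LipschitzOnWith C.toNNReal f (uIcc 0 T) := by
    refine LipschitzOnWith.of_dist_le_mul fun x hx y hy => ?_
    rw [uIcc_of_le hT] at hx hy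
    have hi : ∀ z ∈ Icc 0 T, IntervalIntegrable g volume 0 z := fun z hz =>
      hg.mono_set (by rw [uIcc_of_le hz.1, uIcc_of_le hT]; exact Icc_subset_Icc_right hz.2)
    rw [Real.dist_eq, Real.dist_eq, hf]
    simp only
    rw [add_sub_add_left_eq_sub, intervalIntegral.integral_interval_sub_left (hi x hx) (hi y hy),
      Real.coe_toNNReal _ hC0]
    refine intervalIntegral.norm_integral_le_of_norm_le_const fun s hs =>
      (Real.norm_eq_abs _).trans_le (hC s ?_)
    rw [uIoc] at hs
    exact ⟨(le_min hy.1 hx.1).trans_lt hs.1, hs.2.trans (max_le hy.2 hx.2)⟩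
  have hfb : MapsTo f (uIcc 0 T) (Icc (-(|c| + C * T)) (|c| + C * T)) := fun t ht => by
    rw [uIcc_of_le hT] at ht
    have h1 : |∫ s in (0 : ℝ)..t, g s| ≤ C * T := by
      refine (intervalIntegral.norm_integral_le_of_norm_le_const (C := C) fun s hs =>
        (Real.norm_eq_abs _).trans_le (hC s ?_)).trans ?_
      · rw [uIoc_of_le ht.1] at hs; exact ⟨hs.1, hs.2.trans ht.2⟩
      · rw [sub_zero, abs_of_nonneg ht.1]
        gcongr; exact ht.2
    exact abs_le.1 ((abs_add_le _ _).trans (by linarith))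
  have hH : ContDiff ℝ 1 fun x : ℝ => |x| ^ q := contDiff_norm_rpow hq
  obtain ⟨K, hK⟩ := hH.contDiffOn.exists_lipschitzOnWith (by decide)
    (convex_Icc (-(|c| + C * T)) (|c| + C * T)) isCompact_Icc
  have hac := (hK.comp hlip hfb).absolutelyContinuousOnInterval.integral_deriv_eq_sub
  have h0 : f 0 = c := by simp [hf]
  simp only [Function.comp_apply] at hac
  rw [h0] at hac
  rw [← hac]
  refine intervalIntegral.integral_congr_ae ?_
  filter_upwards [hg.ae_hasDerivAt_integral] with t ht hts
  have h1 : HasDerivAt f (g t) t :=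
    (ht (uIoc_subset_uIcc hts) 0 left_mem_uIcc).const_add c
  rw [((hasDerivAt_abs_rpow (f t) hq).comp t h1).deriv]
  simp only [oddPow]
  ring

/-- The evolution of a weighted energy along functions with a bounded integrable velocity. -/
lemma energy_eq {n : ℕ} (hq : 1 < q) {a : Eu n → ℝ} (ha : IsWeight q a) {v G : ℝ → Eu n → ℝ}
    {v₀ : Eu n → ℝ} {Cv C T : ℝ} (hT : 0 < T)
    (hvm : AEStronglyMeasurable (Function.uncurry v)
      ((volume.restrict (Ioi (0 : ℝ))).prod volume))
    (hGm : AEStronglyMeasurable (Function.uncurry G)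
      ((volume.restrict (Ioi (0 : ℝ))).prod volume))
    (hv : ∀ t, 0 < t → ∀ x, v t x = v₀ x + ∫ s in (0 : ℝ)..t, G s x)
    (hCv : ∀ t, 0 < t → ∀ x, |v t x| ≤ Cv) (hG : ∀ t, 0 < t → ∀ x, |G t x| ≤ C)
    (hGi : ∀ t, 0 < t → Integrable (G t)) (hGC : ∀ t, 0 < t → ∫ x, |G t x| ≤ C)
    (h0 : Integrable fun x => (a x * |v₀ x|) ^ q)
    (hvT : Integrable fun x => (a x * |v T x|) ^ q) :
    IntervalIntegrable (fun s => ∫ x, energyDeriv q a (v s) x * G s x) volume 0 T ∧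
    ∫ x, (a x * |v T x|) ^ q = (∫ x, (a x * |v₀ x|) ^ q) +
      ∫ s in (0 : ℝ)..T, ∫ x, energyDeriv q a (v s) x * G s x := by
  obtain ⟨Ca, hCa⟩ := ha.bounded
  set μ := (volume : Measure ℝ).restrict (Ioc 0 T) with hμ
  have hle : μ.prod (volume : Measure (Eu n)) ≤ (volume.restrict (Ioi (0 : ℝ))).prod volume :=
    Measure.prod_mono (Measure.restrict_mono Ioc_subset_Ioi_self le_rfl) le_rfl
  have hvm' := hvm.mono_measure hle
  have hGm' := hGm.mono_measure hle
  have hpos : ∀ᵐ s ∂μ, 0 < s := by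
    filter_upwards [ae_restrict_mem measurableSet_Ioc] with s hs using hs.1
  have hGprod : Integrable (Function.uncurry G) (μ.prod volume) := by
    rw [integrable_prod_iff hGm']
    refine ⟨hpos.mono fun s hs => hGi s hs, ?_⟩
    refine Integrable.mono' (g := fun _ => C) (integrable_const _) hGm'.norm.integral_prod_right' ?_
    filter_upwards [hpos] with s hs
    rw [Real.norm_of_nonneg (integral_nonneg fun _ => norm_nonneg _)]
    exact hGC s hs
  have hPm : AEStronglyMeasurable (fun p : ℝ × Eu n => energyDeriv q a (v p.1) p.2)
      (μ.prod volume) :=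
    (((ha.continuous.measurable.pow_const q).comp measurable_snd).aemeasurable.mul
      (measurable_oddPow.comp_aemeasurable hvm'.aemeasurable)).const_mul q |>.aestronglyMeasurable
  have hposp : ∀ᵐ p ∂(μ.prod (volume : Measure (Eu n))), 0 < p.1 :=
    Measure.quasiMeasurePreserving_fst.ae hpos
  -- A bounded factor times an integrable one: this is where boundedness of the weight and of `v`
  -- allows exchanging space and time integrals.
  have hPG : Integrable (fun p : ℝ × Eu n => energyDeriv q a (v p.1) p.2 * G p.1 p.2)
      (μ.prod volume) := by
    refine hGprod.bdd_mul hPm (c := q * (Ca ^ q * Cv ^ (q - 1))) ?_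
    filter_upwards [hposp] with p hp
    exact ha.abs_energyDeriv_le hq hCa (hCv _ hp _)
  have hsec : ∀ᵐ x, Integrable (fun s => G s x) μ := hGprod.prod_left_ae
  have key : ∀ᵐ x, (a x * |v T x|) ^ q - (a x * |v₀ x|) ^ q =
      ∫ s, energyDeriv q a (v s) x * G s x ∂μ := by
    filter_upwards [hsec] with x hx
    have hax := (ha.pos x).le
    rw [Real.mul_rpow hax (abs_nonneg _), Real.mul_rpow hax (abs_nonneg _), ← mul_sub,
      hv T hT, abs_rpow_integral_sub hq hT.le (by rwa [intervalIntegrable_iff_integrableOn_Ioc_of_le hT.le])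
        (fun s hs => hG s hs.1 x), intervalIntegral.integral_of_le hT.le, ← integral_const_mul]
    refine integral_congr_ae ?_
    filter_upwards [hpos] with s hs
    rw [energyDeriv, hv s hs]
    ring
  refine ⟨?_, ?_⟩
  · rw [intervalIntegrable_iff_integrableOn_Ioc_of_le hT.le]
    exact hPG.integral_prod_left
  · rw [← sub_eq_iff_eq_add', ← integral_sub hvT h0, integral_congr_ae key,
      intervalIntegral.integral_of_le hT.le, integral_integral_swap]
    exact hPG.swap

end chainRule

/-! ### The logarithmic Gronwall argument. -/

section gronwall

/-- Gronwall's inequality in integral form, with an explicit primitive of the coefficient. -/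
lemma le_mul_exp_of_le_add_integral {E α β : ℝ → ℝ} {K T : ℝ} (hT : 0 < T)
    (hE : ContinuousOn E (Icc 0 T))
    (hα : ContinuousOn α (Icc 0 T)) (hα0 : ∀ t ∈ Icc 0 T, 0 ≤ α t)
    (hβ : ∀ t ∈ Icc 0 T, HasDerivAt β (α t) t)
    (h : ∀ t ∈ Icc 0 T, E t ≤ K + ∫ s in (0 : ℝ)..t, α s * E s) :
    E T ≤ K * Real.exp (β T - β 0) := by
  set Z : ℝ → ℝ := fun t => K + ∫ s in (0 : ℝ)..t, α s * E s with hZ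
  have hαE := hα.mul hE
  have hint : IntervalIntegrable (fun s => α s * E s) volume 0 T :=
    ContinuousOn.intervalIntegrable (by rwa [uIcc_of_le hT.le])
  have hZc : ContinuousOn Z (Icc 0 T) := by
    have := intervalIntegral.continuousOn_primitive_interval' hint left_mem_uIcc
    rw [uIcc_of_le hT.le] at this
    exact continuousOn_const.add this
  have hZd : ∀ t ∈ Ioo 0 T, HasDerivAt Z (α t * E t) t := fun t ht => by
    refine HasDerivAt.const_add K (intervalIntegral.integral_hasDerivAt_right
      (hint.mono_set ?_) ?_ ?_)
    · rw [uIcc_of_le ht.1.le, uIcc_of_le hT.le]; exact Icc_subset_Icc_right ht.2.le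
    · exact hαE.stronglyMeasurableAtFilter_nhdsWithin measurableSet_Icc t |>.filter_mono (by
        rw [nhdsWithin_eq_nhds.2 (Icc_mem_nhds ht.1 ht.2)])
    · exact hαE.continuousAt (Icc_mem_nhds ht.1 ht.2)
  have hβc : ContinuousOn β (Icc 0 T) := fun t ht => (hβ t ht).continuousAt.continuousWithinAt
  have hd : ∀ t ∈ Ioo 0 T, HasDerivAt (fun t => Z t * Real.exp (-β t))
      (α t * E t * Real.exp (-β t) + Z t * (Real.exp (-β t) * -α t)) t := fun t ht =>
    (hZd t ht).mul ((hβ t (Ioo_subset_Icc_self ht)).neg.exp)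
  have hanti : AntitoneOn (fun t => Z t * Real.exp (-β t)) (Icc 0 T) := by
    refine antitoneOn_of_deriv_nonpos (convex_Icc 0 T)
      (hZc.mul (Real.continuous_exp.comp_continuousOn hβc.neg)) ?_ ?_
    · rw [interior_Icc]
      exact fun t ht => (hd t ht).differentiableAt.differentiableWithinAt
    · rw [interior_Icc]
      intro t ht
      rw [(hd t ht).deriv]
      have h1 := h t (Ioo_subset_Icc_self ht)
      have h2 := hα0 t (Ioo_subset_Icc_self ht)
      have h3 := Real.exp_pos (-β t)
      have : 0 ≤ α t * (Z t - E t) * Real.exp (-β t) :=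
        mul_nonneg (mul_nonneg h2 (sub_nonneg.2 h1)) h3.le
      nlinarith
  have h1 := hanti (left_mem_Icc.2 hT.le) (right_mem_Icc.2 hT.le) hT.le
  have hZ0 : Z 0 = K := by simp [hZ]
  simp only [hZ0] at h1
  calc E T ≤ Z T := h T (right_mem_Icc.2 hT.le)
    _ = Z T * Real.exp (-β T) * Real.exp (β T) := by
        rw [mul_assoc, ← Real.exp_add, neg_add_cancel, Real.exp_zero, mul_one]
    _ ≤ K * Real.exp (-β 0) * Real.exp (β T) := by gcongr
    _ = _ := by rw [mul_assoc, ← Real.exp_add, neg_add_eq_sub]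

/-- Compare `E` with `L^q`. This linearizes the critical power at a free level `L`, to be taken as
the logarithm of the final time. -/
lemma rpow_one_sub_inv_le {q L E : ℝ} (hq : 1 < q) (hL : 0 < L) (hE : 0 ≤ E) :
    E ^ (1 - 1 / q) ≤ E / L + L ^ (q - 1) := by
  have hq0 : 0 < q := by linarith
  rcases le_or_gt E (L ^ q) with h | h
  · have h1 : E ^ (1 - 1 / q) ≤ (L ^ q) ^ (1 - 1 / q) :=
      Real.rpow_le_rpow hE h (sub_nonneg.2 ((div_le_one hq0).2 hq.le))
    rw [← Real.rpow_mul hL.le, show q * (1 - 1 / q) = q - 1 by field_simp] at h1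
    have : 0 ≤ E / L := by positivity
    linarith
  · have hE' : 0 < E := (Real.rpow_pos_of_pos hL q).trans h
    have h1 : L ≤ E ^ (1 / q) := by
      have := Real.rpow_le_rpow (by positivity) h.le (by positivity : 0 ≤ 1 / q)
      rwa [← Real.rpow_mul hL.le, mul_one_div_cancel hq0.ne', Real.rpow_one] at this
    rw [Real.rpow_sub hE', Real.rpow_one]
    have : E / E ^ (1 / q) ≤ E / L := by gcongr
    have := Real.rpow_pos_of_pos hL (q - 1)
    linarith

lemma one_le_log_exp_add {T : ℝ} (hT : 0 ≤ T) : 1 ≤ Real.log (Real.exp 1 + T) := by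
  rw [Real.le_log_iff_exp_le (by positivity)]
  linarith

lemma log_one_add_le {t T : ℝ} (ht : 0 ≤ t) (htT : t ≤ T) :
    Real.log (1 + t) ≤ Real.log (Real.exp 1 + T) :=
  Real.log_le_log (by linarith) (by linarith [Real.add_one_le_exp 1])

/-- A differential inequality with logarithmic growth. -/
lemma le_log_rpow_of_integral_le {q A B T : ℝ} {E e r : ℝ → ℝ} (hq : 1 < q) (hA : 0 ≤ A)
    (hB : 0 ≤ B) (hT : 0 < T) (hE0 : ∀ t ∈ Icc 0 T, 0 ≤ E t)
    (he : IntervalIntegrable e volume 0 T) (hr : IntervalIntegrable r volume 0 T)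
    (hr0 : ∀ t ∈ Icc 0 T, 0 ≤ r t)
    (hEe : ∀ t ∈ Icc 0 T, E t = E 0 + ∫ s in (0 : ℝ)..t, e s)
    (hle : ∀ s ∈ Ioc 0 T, e s ≤ A * (1 + s)⁻¹ * (1 + E s ^ (1 - 1 / q)) +
      B * ((1 + s) ^ 2)⁻¹ * (1 + E s) + r s) :
    E T ≤ (E 0 + (2 * A + B) * Real.log (Real.exp 1 + T) ^ q + ∫ s in (0 : ℝ)..T, r s) *
      Real.exp (A + B) := by
  -- `L` is frozen at the final time. The linear coefficient `A/L · (1+s)⁻¹` then has integral at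
  -- most `A`, so the exponential stays bounded, while the forcing `A L^{q-1} (1+s)⁻¹` integrates to
  -- at most `A L^q`.
  set L := Real.log (Real.exp 1 + T) with hL_def
  have hL : 1 ≤ L := one_le_log_exp_add hT.le
  have hL0 : 0 < L := by linarith
  have hsub : ∀ t ∈ Icc 0 T, uIcc 0 t ⊆ uIcc 0 T := fun t ht => by
    rw [uIcc_of_le ht.1, uIcc_of_le hT.le]; exact Icc_subset_Icc_right ht.2
  set α : ℝ → ℝ := fun s => A / L * (1 + s)⁻¹ + B * ((1 + s) ^ 2)⁻¹ with hα
  set γ : ℝ → ℝ := fun s => A * (1 + L ^ (q - 1)) * (1 + s)⁻¹ + B * ((1 + s) ^ 2)⁻¹ with hγ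
  -- A single primitive serves both coefficients: `a = A / L` for `α` and `a = A (1 + L^{q-1})` for
  -- `γ`.
  have hprim : ∀ a t : ℝ, 0 ≤ t →
      HasDerivAt (fun t => a * Real.log (1 + t) - B * (1 + t)⁻¹)
        (a * (1 + t)⁻¹ + B * ((1 + t) ^ 2)⁻¹) t := fun a t ht => by
    have h1 : HasDerivAt (fun t : ℝ => 1 + t) 1 t := (hasDerivAt_id t).const_add 1
    have hne : 1 + t ≠ 0 := by positivity
    refine ((h1.log hne).const_mul a |>.sub ((h1.inv hne).const_mul B)).congr_deriv ?_
    field_simp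
    ring
  have hcont : ∀ a : ℝ, ContinuousOn (fun s => a * (1 + s)⁻¹ + B * ((1 + s) ^ 2)⁻¹) (Icc 0 T) :=
    fun a => by
      have h1 : ContinuousOn (fun s : ℝ => (1 + s)⁻¹) (Icc 0 T) :=
        ContinuousOn.inv₀ (by fun_prop) fun s hs => by have := hs.1; positivity
      have h2 : ContinuousOn (fun s : ℝ => ((1 + s) ^ 2)⁻¹) (Icc 0 T) :=
        ContinuousOn.inv₀ (by fun_prop) fun s hs => by have := hs.1; positivity
      fun_prop
  have hEc : ContinuousOn E (Icc 0 T) := by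
    have := intervalIntegral.continuousOn_primitive_interval' he left_mem_uIcc
    rw [uIcc_of_le hT.le] at this
    exact (continuousOn_const.add this).congr hEe
  have hγi : ∀ t ∈ Icc 0 T, ∫ s in (0 : ℝ)..t, γ s ≤ (2 * A + B) * L ^ q := fun t ht => by
    rw [intervalIntegral.integral_eq_sub_of_hasDerivAt (fun s hs => hprim _ s ?_)
      (((hcont _).mono (by rw [uIcc_of_le ht.1]; exact Icc_subset_Icc_right ht.2)).intervalIntegrable)]
    · have h1 := log_one_add_le ht.1 ht.2
      have h2 : 0 ≤ (1 + t)⁻¹ := by have := ht.1; positivity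
      have h3 : L ≤ L ^ q := Real.self_le_rpow_of_one_le hL hq.le
      have h4 : L ^ (q - 1) * L = L ^ q := rpow_sub_one_mul_self hq hL0.le
      have h5 : 0 ≤ L ^ (q - 1) := by positivity
      simp only [add_zero, Real.log_one, mul_zero, inv_one, mul_one, zero_sub, sub_neg_eq_add]
      have h6 : A * (1 + L ^ (q - 1)) * Real.log (1 + t) ≤ A * (1 + L ^ (q - 1)) * L := by gcongr
      nlinarith [mul_nonneg hB h2, mul_le_mul_of_nonneg_left h3 hA,
        mul_le_mul_of_nonneg_left (hL.trans h3) hB]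
    · rw [uIcc_of_le ht.1] at hs; exact hs.1
  set K := E 0 + (2 * A + B) * L ^ q + ∫ s in (0 : ℝ)..T, r s with hK
  have hri : 0 ≤ ∫ s in (0 : ℝ)..T, r s := intervalIntegral.integral_nonneg hT.le hr0
  have hK0 : 0 ≤ K := by
    have := hE0 0 (left_mem_Icc.2 hT.le)
    positivity
  have hmain : ∀ t ∈ Icc 0 T, E t ≤ K + ∫ s in (0 : ℝ)..t, α s * E s := fun t ht => by
    have i1 : IntervalIntegrable (fun s => α s * E s) volume 0 t :=
      (((hcont _).mul hEc).mono (by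
        rw [uIcc_of_le ht.1]; exact Icc_subset_Icc_right ht.2)).intervalIntegrable
    have i2 : IntervalIntegrable γ volume 0 t := ((hcont _).mono (by
        rw [uIcc_of_le ht.1]; exact Icc_subset_Icc_right ht.2)).intervalIntegrable
    have i3 := hr.mono_set (hsub t ht)
    have h1 : ∫ s in (0 : ℝ)..t, e s ≤ ∫ s in (0 : ℝ)..t, (α s * E s + γ s + r s) := by
      refine intervalIntegral.integral_mono_on_of_le_Ioo ht.1 (he.mono_set (hsub t ht))
        ((i1.add i2).add i3) fun s hs => ?_
      have hsT : s ∈ Ioc 0 T := ⟨hs.1, hs.2.le.trans ht.2⟩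
      refine (hle s hsT).trans ?_
      have h2 := rpow_one_sub_inv_le hq hL0 (hE0 s ⟨hsT.1.le, hsT.2⟩)
      have h3 : 0 ≤ A * (1 + s)⁻¹ := by have := hs.1; positivity
      have h4 := mul_le_mul_of_nonneg_left h2 h3
      simp only [hα, hγ]
      have h5 : A / L * (1 + s)⁻¹ * E s = A * (1 + s)⁻¹ * (E s / L) := by ring
      nlinarith
    rw [intervalIntegral.integral_add (i1.add i2) i3, intervalIntegral.integral_add i1 i2] at h1
    have h2 : ∫ s in (0 : ℝ)..t, r s ≤ ∫ s in (0 : ℝ)..T, r s := by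
      refine intervalIntegral.integral_mono_interval le_rfl ht.1 ht.2 ?_ hr
      filter_upwards [ae_restrict_mem measurableSet_Ioc] with s hs
      exact hr0 s ⟨hs.1.le, hs.2⟩
    rw [hEe t ht, hK]
    linarith [hγi t ht]
  have := le_mul_exp_of_le_add_integral hT hEc (hcont (A / L)) (fun t ht => ?_)
    (fun t ht => hprim (A / L) t ht.1) hmain
  · refine this.trans ?_
    gcongr
    have h1 := log_one_add_le hT.le le_rfl
    have h2 : A / L * Real.log (1 + T) ≤ A / L * L := by gcongr
    rw [div_mul_cancel₀ _ hL0.ne'] at h2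
    have h3 : 0 ≤ B * (1 + T)⁻¹ := by positivity
    simp
    linarith
  · have := ht.1
    positivity

end gronwall

/-! ### Measurability in time and space. -/

section jointMeasurability

variable {n : ℕ} {G : Type*} [NormedAddCommGroup G] {ν : Measure ℝ} [SFinite ν]

lemma _root_.MeasureTheory.AEStronglyMeasurable.comp_fst_fst_snd {f : ℝ × Eu n → G}
    (hf : AEStronglyMeasurable f (ν.prod volume)) :
    AEStronglyMeasurable (fun p : (ℝ × Eu n) × Eu n => f (p.1.1, p.2))
      ((ν.prod volume).prod volume) :=
  hf.comp_quasiMeasurePreserving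
    (QuasiMeasurePreserving.prodMap Measure.quasiMeasurePreserving_fst
      (Measure.QuasiMeasurePreserving.id volume))

variable {u : ℝ → Eu n → ℝ}

lemma aestronglyMeasurable_conv_prod [NormedSpace ℝ G]
    (hu : AEStronglyMeasurable (Function.uncurry u) (ν.prod volume)) {k : Eu n → G}
    (hk : StronglyMeasurable k) :
    AEStronglyMeasurable (fun p : ℝ × Eu n => conv k (u p.1) p.2) (ν.prod volume) :=
  (hu.comp_fst_fst_snd.smul (hk.comp_measurable (by fun_prop :
    Measurable fun p : (ℝ × Eu n) × Eu n => p.1.2 - p.2)).aestronglyMeasurable).integral_prod_right'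

lemma aestronglyMeasurable_gradPotential_prod
    (hu : AEStronglyMeasurable (Function.uncurry u) (ν.prod volume)) :
    AEStronglyMeasurable (fun p : ℝ × Eu n => gradPotential (u p.1) p.2) (ν.prod volume) := by
  simp_rw [gradPotential_eq]
  exact (aestronglyMeasurable_conv_prod hu measurable_kern.stronglyMeasurable).const_smul
    (newtonConst n)

lemma aestronglyMeasurable_driftFlux_prod
    (hu : AEStronglyMeasurable (Function.uncurry u) (ν.prod volume)) {ρ : Eu n → ℝ}
    (hρ : IsTest ρ) :
    AEStronglyMeasurable (fun p : ℝ × Eu n => driftFlux ρ (u p.1) p.2) (ν.prod volume) :=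
  AEStronglyMeasurable.integral_prod_right' (f := fun p : (ℝ × Eu n) × Eu n =>
    u p.1.1 p.2 * fderiv ℝ ρ (p.1.2 - p.2) (gradPotential (u p.1.1) p.2))
    (hu.comp_fst_fst_snd.mul (aestronglyMeasurable_clm_apply
      (hρ.continuous_fderiv.comp (by fun_prop)).aestronglyMeasurable
      (aestronglyMeasurable_gradPotential_prod hu).comp_fst_fst_snd))

lemma aestronglyMeasurable_driftComm_prod
    (hu : AEStronglyMeasurable (Function.uncurry u) (ν.prod volume))
    (hui : ∀ᵐ s ∂ν, Integrable (u s)) {ρ : Eu n → ℝ} (hρ : IsTest ρ) :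
    AEStronglyMeasurable (fun p : ℝ × Eu n => driftComm ρ (u p.1) p.2) (ν.prod volume) := by
  have h1 := (aestronglyMeasurable_driftFlux_prod hu hρ).sub (aestronglyMeasurable_clm_apply
    (aestronglyMeasurable_conv_prod hu hρ.continuous_fderiv.stronglyMeasurable)
    (aestronglyMeasurable_gradPotential_prod hu))
  have h2 := ((aestronglyMeasurable_conv_prod hu hρ.contDiff.continuous.stronglyMeasurable).mul
    hu).const_mul (divConst n)
  refine (h1.add h2).congr ?_
  filter_upwards [(Measure.quasiMeasurePreserving_fst (ν := (volume : Measure (Eu n)))).ae hui]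
    with p hp
  simp only [driftComm, fderiv_conv hρ hp]
  rfl

lemma stronglyMeasurable_levyOp {θ : ℝ} {ρ : Eu n → ℝ} (hρ : Continuous ρ) :
    StronglyMeasurable (levyOp θ ρ) :=
  StronglyMeasurable.integral_prod_right' (f := fun p : Eu n × Eu n =>
    secondDiff ρ p.1 p.2 * levyKer θ p.2)
    ((continuous_secondDiff_prod hρ).stronglyMeasurable.mul
      (measurable_levyKer.comp measurable_snd).stronglyMeasurable)

end jointMeasurability

/-! ### The equation of the mollified solution. -/

section velocity

variable {n : ℕ} {θ c ε : ℝ} {ρ u : Eu n → ℝ}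

/-- The time derivative of the mollified solution. -/
noncomputable def velocity (θ c : ℝ) (ρ u : Eu n → ℝ) (x : Eu n) : ℝ :=
  -(c * levyOp θ (conv ρ u) x) + driftFlux ρ u x

lemma velocity_eq (hn : 1 ≤ n) (hθ : 0 < θ) (hθ1 : θ ≤ 1) (hρ : IsMollifier ε ρ)
    (hu : Integrable u) (x : Eu n) :
    velocity θ c ρ u x = -(c * conv (levyOp θ ρ) u x) + driftFlux ρ u x := by
  obtain ⟨C, hC0, h1, h2, -, -⟩ := exists_secondDiff_le hρ.contDiff hρ.hasCompactSupport
  rw [velocity, conv_levyOp hn hθ hθ1 hρ.isTest hu hC0 h1 h2]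

/-- Uniform bounds of the velocity. -/
lemma exists_velocity_le (hn : 2 ≤ n) (hθ : 0 < θ) (hθ1 : θ ≤ 1) (hρ : IsMollifier ε ρ) (c : ℝ)
    {D β : ℝ} (hD : 0 ≤ D) :
    ∃ C, ∀ u : Eu n → ℝ, Integrable u → ∫ y, |u y| ≤ D → (∀ᵐ y, |u y| ≤ D) →
      (∀ x, ‖gradPotential u x‖ ≤ β) →
      Integrable (velocity θ c ρ u) ∧ (∀ x, |velocity θ c ρ u x| ≤ C) ∧
        ∫ x, |velocity θ c ρ u x| ≤ C := by
  obtain ⟨C, hC0, h1, h2, h3, h4⟩ := exists_secondDiff_le hρ.contDiff hρ.hasCompactSupport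
  have hρt := hρ.isTest
  have hρc := hρt.contDiff.continuous
  obtain ⟨C', hC'⟩ := hρt.bounded_fderiv
  have hK := abs_levyOp_le (ρ := ρ) (by omega) hθ hθ1 hC0 h1 h2
  set K := ∫ z : Eu n, min C (C * ‖z‖ ^ 2) * levyKer θ z with hK_def
  have hki : Integrable (levyOp θ ρ) :=
    (integrable_secondDiff_mul_levyKer_prod (by omega) hθ hθ1 hρc hρt.integrable h3
      h4).integral_prod_left
  have hK0 : 0 ≤ K := (abs_nonneg _).trans (hK 0)
  have hC'0 : 0 ≤ C' := (norm_nonneg _).trans (hC' 0)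
  set K' := ∫ z, ‖levyOp θ ρ z‖ with hK'
  set R := ∫ z, ‖fderiv ℝ ρ z‖ with hR
  have hK'0 : 0 ≤ K' := integral_nonneg fun _ => norm_nonneg _
  have hR0 : 0 ≤ R := integral_nonneg fun _ => norm_nonneg _
  refine ⟨|c| * (K * D) + D * (C' * |β|) + (|c| * (D * K') + D * (R * |β|)),
    fun u hu hD1 hDi hβ => ?_⟩
  have hβ' : ∀ x, ‖gradPotential u x‖ ≤ |β| := fun x => (hβ x).trans (le_abs_self β)
  have hv : velocity θ c ρ u = fun x => -(c * conv (levyOp θ ρ) u x) + driftFlux ρ u x :=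
    funext fun x => velocity_eq (by omega) hθ hθ1 hρ hu x
  have hI0 : 0 ≤ ∫ y, |u y| := integral_nonneg fun _ => abs_nonneg _
  have i1 := integrable_conv hki hu
  have i2 := integrable_driftFlux hn hu hDi hρt
  rw [hv]
  refine ⟨(i1.const_mul c).neg.add i2, fun x => ?_, ?_⟩
  · have b1 : |conv (levyOp θ ρ) u x| ≤ K * D :=
      (norm_conv_le (k := levyOp θ ρ) hu hK x).trans (by gcongr)
    have b2 : |driftFlux ρ u x| ≤ D * (C' * |β|) :=
      (abs_driftFlux_le hu hβ' hC' x).trans (by gcongr)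
    have b3 : 0 ≤ |c| * (D * K') + D * (R * |β|) := by positivity
    refine (abs_add_le _ _).trans ?_
    rw [abs_neg, abs_mul]
    have := mul_le_mul_of_nonneg_left b1 (abs_nonneg c)
    linarith
  · have b1 : ∫ x, |conv (levyOp θ ρ) u x| ≤ D * K' :=
      (integral_norm_conv_le hki hu).trans (by gcongr)
    have b2 : ∫ x, |driftFlux ρ u x| ≤ D * (R * |β|) :=
      (integral_abs_driftFlux_le hu hρt hβ').trans (by gcongr)
    have b3 : 0 ≤ |c| * (K * D) + D * (C' * |β|) := by positivity
    calc _ ≤ ∫ x, (|c| * |conv (levyOp θ ρ) u x| + |driftFlux ρ u x|) := by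
          refine integral_mono ((i1.const_mul c).neg.add i2).abs ((i1.abs.const_mul _).add i2.abs)
            fun x => (abs_add_le _ _).trans_eq ?_
          rw [abs_neg, abs_mul]
      _ = |c| * (∫ x, |conv (levyOp θ ρ) u x|) + ∫ x, |driftFlux ρ u x| := by
          rw [integral_add (i1.abs.const_mul _) i2.abs, integral_const_mul]
      _ ≤ _ := by
          have := mul_le_mul_of_nonneg_left b1 (abs_nonneg c)
          linarith

lemma aestronglyMeasurable_velocity_prod {ν : Measure ℝ} [SFinite ν] {u : ℝ → Eu n → ℝ}
    (hn : 1 ≤ n) (hθ : 0 < θ) (hθ1 : θ ≤ 1)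
    (hu : AEStronglyMeasurable (Function.uncurry u) (ν.prod volume))
    (hui : ∀ᵐ s ∂ν, Integrable (u s)) (hρ : IsMollifier ε ρ) :
    AEStronglyMeasurable (fun p : ℝ × Eu n => velocity θ c ρ (u p.1) p.2) (ν.prod volume) := by
  refine ((((aestronglyMeasurable_conv_prod hu
    (stronglyMeasurable_levyOp (θ := θ) hρ.isTest.contDiff.continuous)).const_mul c).neg).add
    (aestronglyMeasurable_driftFlux_prod hu hρ.isTest)).congr ?_
  filter_upwards [(Measure.quasiMeasurePreserving_fst (ν := (volume : Measure (Eu n)))).ae hui]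
    with p hp
  rw [velocity_eq hn hθ hθ1 hρ hp]
  rfl

/-- The mollified solution in terms of its velocity. -/
lemma exists_conv_eq_add_integral_velocity (hn : 1 ≤ n) (hθ : 0 < θ) (hθ1 : θ ≤ 1) :
    ∃ c : ℝ, 0 < c ∧ ∀ (u₀ : Eu n → ℝ) (u : ℝ → Eu n → ℝ), IsWeakSolution θ u₀ u →
      (∀ t, 0 < t → Integrable (u t)) → ∀ (ε : ℝ) (ρ : Eu n → ℝ), IsMollifier ε ρ →
      ∀ x t, 0 < t →
        conv ρ (u t) x = conv ρ u₀ x + ∫ s in (0 : ℝ)..t, velocity θ c ρ (u s) x := by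
  obtain ⟨c, hc, hfrac⟩ := exists_fracLaplacian_eq (n := n) hn hθ hθ1
  refine ⟨c, hc, fun u₀ u hsol hui ε ρ hρ x t ht => ?_⟩
  -- The weak equation is tested with the reflected translate of the mollifier, which is how
  -- convolutions at `x` appear.
  have hsm : ContDiff ℝ ((⊤ : ℕ∞) : WithTop ℕ∞) fun y => ρ (x - y) :=
    hρ.contDiff.comp (contDiff_const.sub contDiff_id)
  have hcs : HasCompactSupport fun y => ρ (x - y) :=
    hρ.hasCompactSupport.comp_homeomorph (Homeomorph.subLeft x)
  have h := hsol.weak_eq _ hsm hcs t ht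
  rw [sub_eq_iff_eq_add'] at h
  refine h.trans ?_
  congr 1
  refine intervalIntegral.integral_congr_ae (.of_forall fun s hs => ?_)
  rw [uIoc_of_le ht.le] at hs
  rw [velocity_eq hn hθ hθ1 hρ (hui s hs.1), sub_eq_add_neg]
  congr 1
  · rw [conv, ← integral_const_mul]
    congr 2; ext y
    rw [hfrac _ hsm hcs]
    simp only [secondDiff_comp_const_sub, smul_eq_mul, levyOp]
    ring
  · rw [driftFlux, ← integral_neg]
    congr 1; ext y
    rw [gradient, real_inner_comm, InnerProductSpace.toDual_symm_apply,
      fderiv_comp_const_sub hρ.isTest, neg_apply]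
    ring

end velocity

/-! ### The differential inequality at the diffusive scale. -/

section energyRate

variable {n : ℕ} {q θ c ε M : ℝ} {ρ u : Eu n → ℝ}

lemma integrable_abs_rpow_of_bounded (hq : 1 < q) (hu : Integrable u) (hM : ∀ᵐ y, |u y| ≤ M) :
    Integrable fun y => |u y| ^ q := by
  refine (hu.abs.const_mul (M ^ (q - 1))).mono'
    (hu.abs.aemeasurable.pow_const q).aestronglyMeasurable ?_
  filter_upwards [hM] with y hy
  rw [Real.norm_of_nonneg (by positivity), ← rpow_sub_one_mul_self hq (abs_nonneg _)]
  gcongr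

lemma lintegral_enorm_conv_rpow_le (hq : 1 < q) (hρ : IsMollifier ε ρ)
    {f : Eu n → ℝ} (hf : AEStronglyMeasurable f) :
    ∫⁻ x, (∫⁻ y, ‖ρ (x - y)‖ₑ * ‖f y‖ₑ) ^ q ≤ ∫⁻ y, ‖f y‖ₑ ^ q := by
  have h := lintegral_conv_rpow_le (k := fun z => ‖ρ z‖ₑ) hρ.contDiff.continuous.enorm.measurable
    hf.enorm hq
  have h1 : ∫⁻ z, ‖ρ z‖ₑ = 1 := by
    rw [← ofReal_integral_norm_eq_lintegral_enorm hρ.isTest.integrable, hρ.integral_norm,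
      ENNReal.ofReal_one]
  rwa [h1, ENNReal.one_rpow, one_mul] at h

lemma enorm_conv_le (ρ u : Eu n → ℝ) (x : Eu n) :
    ‖conv ρ u x‖ₑ ≤ ∫⁻ y, ‖ρ (x - y)‖ₑ * ‖u y‖ₑ := by
  refine (enorm_integral_le_lintegral_enorm _).trans_eq (lintegral_congr fun y => ?_)
  rw [enorm_smul, mul_comm]

lemma integral_abs_rpow_eq_toReal (hq : 0 ≤ q) {f : Eu n → ℝ} (hf : AEStronglyMeasurable f) :
    ∫ x, |f x| ^ q = (∫⁻ x, ‖f x‖ₑ ^ q).toReal := by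
  rw [integral_eq_lintegral_of_nonneg_ae (.of_forall fun x => by positivity)
    ((continuous_abs.comp_aestronglyMeasurable hf).aemeasurable.pow_const q).aestronglyMeasurable]
  congr 1
  refine lintegral_congr fun x => ?_
  rw [← ENNReal.ofReal_rpow_of_nonneg (abs_nonneg _) hq, ← Real.norm_eq_abs, ofReal_norm]

lemma lintegral_enorm_rpow_ne_top (hq : 0 ≤ q) {f : Eu n → ℝ}
    (hf : Integrable fun x => |f x| ^ q) : ∫⁻ x, ‖f x‖ₑ ^ q ≠ ∞ := by
  have h := hf.2
  rw [hasFiniteIntegral_iff_enorm] at h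
  refine ((lintegral_congr fun x => ?_).trans_lt h).ne
  rw [Real.enorm_of_nonneg (Real.rpow_nonneg (abs_nonneg (f x)) q), ← ENNReal.ofReal_rpow_of_nonneg (abs_nonneg _) hq,
    ← Real.norm_eq_abs, ofReal_norm]

lemma integral_abs_conv_rpow_le (hq : 1 < q) (hρ : IsMollifier ε ρ) (hu : Integrable u)
    (huq : Integrable fun y => |u y| ^ q) : ∫ x, |conv ρ u x| ^ q ≤ ∫ y, |u y| ^ q := by
  have hq0 : 0 ≤ q := by linarith
  rw [integral_abs_rpow_eq_toReal hq0 (integrable_conv hρ.isTest.integrable hu).1,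
    integral_abs_rpow_eq_toReal hq0 hu.1]
  refine ENNReal.toReal_mono (lintegral_enorm_rpow_ne_top hq0 huq) ?_
  refine (lintegral_mono fun x => ?_).trans (lintegral_enorm_conv_rpow_le hq hρ hu.1)
  exact ENNReal.rpow_le_rpow (enorm_conv_le ρ u x) hq0

lemma abs_conv_le (hρ : IsMollifier ε ρ) (hM : ∀ᵐ y, |u y| ≤ M) (x : Eu n) :
    |conv ρ u x| ≤ M := by
  have := norm_conv_le_of_bounded hρ.isTest.integrable hM x
  rwa [hρ.integral_norm, mul_one] at this

lemma integral_abs_conv_le (hρ : IsMollifier ε ρ) (hu : Integrable u) :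
    ∫ x, |conv ρ u x| ≤ ∫ y, |u y| := by
  have := integral_norm_conv_le hρ.isTest.integrable hu
  rwa [hρ.integral_norm, mul_one] at this

/-- The decay of a density at the length scale `τ`. -/
structure IsDecaying (q D τ : ℝ) (u : Eu n → ℝ) : Prop where
  integrable : Integrable u
  integral_le : ∫ y, |u y| ≤ D
  integral_rpow_le : ∫ y, |u y| ^ q ≤ (D / τ) ^ q
  ae_le : ∀ᵐ y, |u y| ≤ D * τ ^ (-(n : ℝ))

lemma IsDecaying.norm_gradPotential_le {D τ : ℝ} (hn : 2 ≤ n) (hτ : 0 < τ)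
    (hu : IsDecaying q D τ u) (x : Eu n) :
    ‖gradPotential u x‖ ≤ |newtonConst n| * (D * (sphereArea n + 1)) * τ ^ (1 - (n : ℝ)) := by
  refine (DriftDiffusion.norm_gradPotential_le hn hu.integrable hu.ae_le x hτ).trans ?_
  have h1 : τ ^ (-(n : ℝ)) * τ = τ ^ (1 - (n : ℝ)) := by
    rw [sub_eq_neg_add, Real.rpow_add hτ, Real.rpow_one]
  have h2 : τ ^ (1 - (n : ℝ)) * ∫ y, |u y| ≤ τ ^ (1 - (n : ℝ)) * D := by
    gcongr; exact hu.integral_le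
  calc _ ≤ |newtonConst n| * (D * τ ^ (-(n : ℝ)) * (sphereArea n * τ) + τ ^ (1 - (n : ℝ)) * D) := by
        gcongr
    _ = |newtonConst n| * (D * sphereArea n * (τ ^ (-(n : ℝ)) * τ) + τ ^ (1 - (n : ℝ)) * D) := by
        ring
    _ = _ := by rw [h1]; ring

lemma integrable_levyOp_conv (hn : 1 ≤ n) (hθ : 0 < θ) (hθ1 : θ ≤ 1) (hρ : IsMollifier ε ρ)
    (hu : Integrable u) : Integrable (levyOp θ (conv ρ u)) := by
  obtain ⟨C, hC0, h1, h2, h3, h4⟩ := exists_secondDiff_le hρ.contDiff hρ.hasCompactSupport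
  rw [← funext fun x => conv_levyOp hn hθ hθ1 hρ.isTest hu hC0 h1 h2 x]
  exact integrable_conv (integrable_secondDiff_mul_levyKer_prod hn hθ hθ1
    hρ.isTest.contDiff.continuous hρ.isTest.integrable h3 h4).integral_prod_left hu

/-- The growth rate of the weighted energy of the mollified solution. -/
lemma exists_energy_rate_le (hn : 2 ≤ n) (hq1 : 1 < q) (hq2 : q ≤ 2) (hθ : 0 < θ) (hθ1 : θ ≤ 1)
    (hqn : ((n : ℝ) - 1) * q = n) (hc : 0 < c) {D : ℝ} (hD : 0 ≤ D) :
    ∃ A B, 0 ≤ A ∧ 0 ≤ B ∧ ∀ (u : Eu n → ℝ) (τ : ℝ), 1 ≤ τ → IsDecaying q D τ u →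
      ∀ (ε : ℝ) (ρ : Eu n → ℝ), IsMollifier ε ρ → ∀ (a : Eu n → ℝ) (Ca : ℝ), IsWeight q a →
      (∀ x, a x ≤ Ca) →
      ∫ x, energyDeriv q a (conv ρ u) x * velocity θ c ρ u x ≤
        A * τ ^ (-θ) * (1 + (∫ x, (a x * |conv ρ u x|) ^ q) ^ (1 - 1 / q)) +
        B * τ ^ (-(n : ℝ)) * (1 + ∫ x, (a x * |conv ρ u x|) ^ q) +
        q * (Ca ^ q * D ^ (q - 1)) * ∫ x, |driftComm ρ u x| := by
  set S := sphereArea n with hS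
  have hS0 : 0 ≤ S := sphereArea_nonneg n
  have hn' : (2 : ℝ) ≤ n := by exact_mod_cast hn
  have hqθ : 0 < q - θ := by linarith
  have hq0 : 0 < q := by linarith
  -- `A1` and `A2` come from the near and far parts of the diffusion, `A3` from the field acting on
  -- the gradient of the weight, and `B1` from the divergence of the field.
  set A1 := c * (2 * (S / (q - θ)) * D ^ q) with hA1
  set A2 := c * (2 * q * (D * (S / (θ * q)) ^ (1 / q))) with hA2
  set A3 := q * (|newtonConst n| * (D * (S + 1))) * D with hA3
  set B1 := |divConst n| * (q - 1) * D with hB1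
  have hA10 : 0 ≤ A1 := by positivity
  have hA20 : 0 ≤ A2 := by positivity
  have hA30 : 0 ≤ A3 := by positivity
  have hB10 : 0 ≤ B1 := mul_nonneg (mul_nonneg (abs_nonneg _) (by linarith)) hD
  refine ⟨A1 + A2 + A3, B1, by positivity, hB10,
    fun u τ hτ hu ε ρ hρ a Ca ha hCa => ?_⟩
  have hτ0 : 0 < τ := by linarith
  have hui := hu.integrable
  have hMτ : D * τ ^ (-(n : ℝ)) ≤ D := mul_le_of_le_one_right hD
    (Real.rpow_le_one_of_one_le_of_nonpos hτ (by linarith))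
  have hv := isTest_conv hρ.isTest hui
  have hCv : ∀ x, |conv ρ u x| ≤ D := fun x => (abs_conv_le hρ hu.ae_le x).trans hMτ
  have hvq := integrable_abs_rpow hq1 hv.contDiff.continuous hv.integrable hCv
  obtain ⟨C, hC0, h1, h2, h3, h4⟩ := exists_secondDiff_le hρ.contDiff hρ.hasCompactSupport
  have hsd : ∀ z, ∫ x, |secondDiff (conv ρ u) x z| ≤ (∫ y, |u y|) * ∫ x, |secondDiff ρ x z| :=
    fun z => by
      simp_rw [secondDiff_conv hρ.isTest hui]
      have hi := hρ.isTest.integrable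
      exact integral_norm_conv_le (k := fun x => secondDiff ρ x z) (((hi.const_mul 2).sub
        (hi.comp_add_right z)).sub (hi.comp_sub_right z)) hui
  have hI0 : 0 ≤ ∫ y, |u y| := integral_nonneg fun _ => abs_nonneg _
  -- The splitting radius is the length scale `τ` of the density itself; with it near and far parts
  -- both scale like `τ^{-θ}`.
  have hlevy := neg_integral_energyDeriv_mul_secondDiff_le hn hq1 hq2 hθ hθ1 hqn ha
    hv.contDiff.continuous hv.integrable hCv (C := (∫ y, |u y|) * C)
    (fun z => (hsd z).trans (by gcongr; exact h3 z))
    (fun z => (hsd z).trans (by rw [mul_assoc]; gcongr; exact h4 z)) hτ0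
  have hdrift := integral_energyDeriv_mul_driftFlux_le hn hq1 ha hui hu.ae_le
    (hu.norm_gradPotential_le hn hτ0) hρ.isTest hCa hCv
  have hP : ∀ x, |energyDeriv q a (conv ρ u) x| ≤ q * (Ca ^ q * D ^ (q - 1)) := fun x =>
    ha.abs_energyDeriv_le hq1 hCa (hCv x)
  have hPm := (ha.measurable_energyDeriv hv.contDiff.continuous.measurable).aestronglyMeasurable
    (μ := (volume : Measure (Eu n)))
  have i1 : Integrable fun x => energyDeriv q a (conv ρ u) x * levyOp θ (conv ρ u) x :=
    (integrable_levyOp_conv (by omega) hθ hθ1 hρ hui).bdd_mul hPm (.of_forall hP)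
  have i2 : Integrable fun x => energyDeriv q a (conv ρ u) x * driftFlux ρ u x :=
    (integrable_driftFlux hn hui hu.ae_le hρ.isTest).bdd_mul hPm (.of_forall hP)
  have hsplit : ∫ x, energyDeriv q a (conv ρ u) x * velocity θ c ρ u x =
      c * -(∫ x, energyDeriv q a (conv ρ u) x * levyOp θ (conv ρ u) x) +
        ∫ x, energyDeriv q a (conv ρ u) x * driftFlux ρ u x := by
    rw [← integral_neg, ← integral_const_mul, ← integral_add (by exact i1.neg.const_mul c) i2]
    congr 1; ext x
    rw [velocity]; ring
  set E := ∫ x, (a x * |conv ρ u x|) ^ q with hE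
  have hE0 : 0 ≤ E := integral_nonneg fun x => by
    have := (ha.pos x).le
    positivity
  set F := E ^ (1 - 1 / q) with hF
  have hF0 : 0 ≤ F := by positivity
  have hVq : ∫ x, |conv ρ u x| ^ q ≤ (D / τ) ^ q :=
    (integral_abs_conv_rpow_le hq1 hρ hui
      (integrable_abs_rpow_of_bounded hq1 hui hu.ae_le)).trans hu.integral_rpow_le
  have hV0 : 0 ≤ ∫ x, |conv ρ u x| ^ q := integral_nonneg fun x => by positivity
  have hV1 : ∫ x, |conv ρ u x| ≤ D := (integral_abs_conv_le hρ hui).trans hu.integral_le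
  have hVr : (∫ x, |conv ρ u x| ^ q) ^ (1 / q) ≤ D / τ := by
    have := Real.rpow_le_rpow hV0 hVq (by positivity : 0 ≤ 1 / q)
    rwa [← Real.rpow_mul (by positivity), mul_one_div_cancel hq0.ne', Real.rpow_one] at this
  have e1 : τ ^ (q - θ) * (D / τ) ^ q = D ^ q * τ ^ (-θ) := by
    rw [Real.div_rpow hD hτ0.le, Real.rpow_sub hτ0, Real.rpow_neg hτ0.le]
    have := Real.rpow_pos_of_pos hτ0 q
    have := Real.rpow_pos_of_pos hτ0 θ
    field_simp
  have e2 : τ ^ (1 - (n : ℝ)) * τ⁻¹ = τ ^ (-(n : ℝ)) := by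
    rw [sub_eq_neg_add, Real.rpow_add hτ0, Real.rpow_one, mul_inv_cancel_right₀ hτ0.ne']
  -- The field decays like `τ^{1-n}` and `‖v‖_q` like `τ⁻¹`; since `θ ≤ n` and `τ ≥ 1`, this drift
  -- term is no larger than the diffusion terms.
  have e3 : τ ^ (-(n : ℝ)) ≤ τ ^ (-θ) := Real.rpow_le_rpow_of_exponent_le hτ (by linarith)
  have hτθ := Real.rpow_pos_of_pos hτ0 (-θ)
  have hτn := Real.rpow_pos_of_pos hτ0 (-(n : ℝ))
  have b1 : 2 * (S * (τ ^ (q - θ) / (q - θ))) * (∫ x, |conv ρ u x| ^ q) ≤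
      2 * (S / (q - θ)) * D ^ q * τ ^ (-θ) := by
    calc _ ≤ 2 * (S * (τ ^ (q - θ) / (q - θ))) * (D / τ) ^ q := by gcongr
      _ = 2 * (S / (q - θ)) * (τ ^ (q - θ) * (D / τ) ^ q) := by ring
      _ = _ := by rw [e1]; ring
  have b2 : 2 * q * ((∫ x, |conv ρ u x|) * (((S / (θ * q)) ^ (1 / q) * τ ^ (-θ)) * F)) ≤
      2 * q * (D * (S / (θ * q)) ^ (1 / q)) * (τ ^ (-θ) * F) := by
    calc _ ≤ 2 * q * (D * (((S / (θ * q)) ^ (1 / q) * τ ^ (-θ)) * F)) := by gcongr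
      _ = _ := by ring
  have b3 : q * (|newtonConst n| * (D * (S + 1)) * τ ^ (1 - (n : ℝ))) *
      (F * (∫ x, |conv ρ u x| ^ q) ^ (1 / q)) ≤ A3 * (τ ^ (-θ) * F) := by
    calc _ ≤ q * (|newtonConst n| * (D * (S + 1)) * τ ^ (1 - (n : ℝ))) * (F * (D / τ)) := by gcongr
      _ = A3 * (τ ^ (1 - (n : ℝ)) * τ⁻¹ * F) := by rw [hA3]; ring
      _ ≤ _ := by rw [e2]; gcongr
  have b4 : |divConst n| * (q - 1) * (D * τ ^ (-(n : ℝ))) * E ≤ B1 * τ ^ (-(n : ℝ)) * (1 + E) := by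
    have : 0 ≤ B1 * τ ^ (-(n : ℝ)) := by positivity
    calc _ = B1 * τ ^ (-(n : ℝ)) * E := by rw [hB1]; ring
      _ ≤ _ := by linarith
  rw [hsplit]
  have hlevy' := mul_le_mul_of_nonneg_left (hlevy.trans (add_le_add b1 b2)) hc.le
  have hx : 0 ≤ (A2 + A3) * τ ^ (-θ) := by positivity
  have hy : 0 ≤ A1 * (τ ^ (-θ) * F) := by positivity
  have : c * (2 * (S / (q - θ)) * D ^ q * τ ^ (-θ) +
      2 * q * (D * (S / (θ * q)) ^ (1 / q)) * (τ ^ (-θ) * F)) =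
      A1 * τ ^ (-θ) + A2 * (τ ^ (-θ) * F) := by rw [hA1, hA2]; ring
  rw [this] at hlevy'
  calc _ ≤ (A1 * τ ^ (-θ) + A2 * (τ ^ (-θ) * F)) + (B1 * τ ^ (-(n : ℝ)) * (1 + E) +
        A3 * (τ ^ (-θ) * F) + q * (Ca ^ q * D ^ (q - 1)) * ∫ x, |driftComm ρ u x|) :=
        add_le_add hlevy' (hdrift.trans (by gcongr))
    _ ≤ _ := by linarith

end energyRate

/-! ### The energy bound for the mollified solution. -/

section energyBound

variable {n : ℕ} {q θ c ε D T : ℝ}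

lemma commConst_nonneg (n : ℕ) : 0 ≤ commConst n :=
  mul_nonneg (mul_nonneg (abs_nonneg _) (kernMass_nonneg n))
    (integral_nonneg fun _ => norm_nonneg _)

lemma IsDecaying.ae_le_const {τ : ℝ} {u : Eu n → ℝ} (hu : IsDecaying q D τ u) (hD : 0 ≤ D)
    (hτ : 1 ≤ τ) : ∀ᵐ y, |u y| ≤ D := by
  have hn : (0 : ℝ) ≤ n := by positivity
  filter_upwards [hu.ae_le] with y hy
  exact hy.trans (mul_le_of_le_one_right hD
    (Real.rpow_le_one_of_one_le_of_nonpos hτ (by linarith)))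

lemma eLpNorm_two_le_of_bounded {u : Eu n → ℝ} (hu : Integrable u) (hD : 0 ≤ D)
    (h1 : ∫ y, |u y| ≤ D) (hM : ∀ᵐ y, |u y| ≤ D) : eLpNorm u 2 volume ≤ ENNReal.ofReal D := by
  have h2 : ∫ y, ‖u y‖ ^ 2 ≤ D ^ 2 := by
    calc ∫ y, ‖u y‖ ^ 2 ≤ ∫ y, D * |u y| := by
          refine integral_mono_ae ?_ (hu.abs.const_mul D) ?_
          · simpa using integrable_sq_of_bounded hu hM
          · filter_upwards [hM] with y hy
            rw [sq, Real.norm_eq_abs]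
            gcongr
      _ ≤ D * D := by rw [integral_const_mul]; gcongr
      _ = _ := (sq D).symm
  rw [(memLp_two_of_bounded hu hM).eLpNorm_eq_integral_rpow_norm (by norm_num) (by norm_num)]
  refine ENNReal.ofReal_le_ofReal ?_
  simp only [ENNReal.toReal_ofNat, Real.rpow_ofNat]
  rw [← Real.sqrt_sq hD, ← one_div, ← Real.sqrt_eq_rpow]
  exact Real.sqrt_le_sqrt h2

lemma integral_abs_driftComm_moll_le (hn : 2 ≤ n) {u : Eu n → ℝ} (hu : Integrable u) (hD : 0 ≤ D)
    (h1 : ∫ y, |u y| ≤ D) (hM : ∀ᵐ y, |u y| ≤ D) (hε : 0 < ε) :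
    ∫ x, |driftComm (moll ε hε) u x| ≤ commConst n * (D * (2 * D)) := by
  have h2 := eLpNorm_two_le_of_bounded hu hD h1 hM
  have hc := commConst_nonneg n
  have h3 := (lintegral_enorm_driftComm_moll_le_sq hn hu hM hε).trans
    (mul_le_mul_right (mul_le_mul' h2 (mul_le_mul_right h2 2)) (ENNReal.ofReal (commConst n)))
  have h4 := integral_norm_eq_lintegral_enorm
    (integrable_driftComm hn hu hM (isMollifier_moll ε hε).isTest).1
  simp only [Real.norm_eq_abs] at h4
  rw [h4]
  refine ENNReal.toReal_le_of_le_ofReal (by positivity) (h3.trans_eq ?_)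
  rw [ENNReal.ofReal_mul hc, ENNReal.ofReal_mul hD, ENNReal.ofReal_mul zero_le_two,
    ENNReal.ofReal_ofNat]

lemma one_le_one_add_rpow (hθ : 0 < θ) {t : ℝ} (ht : 0 ≤ t) : 1 ≤ (1 + t) ^ (1 / θ) :=
  Real.one_le_rpow (by linarith) (by positivity)

/-- Decay of a time dependent density at the diffusive scale. -/
structure IsDecayingFlow (q θ D : ℝ) (u : ℝ → Eu n → ℝ) : Prop where
  nonneg : 0 ≤ D
  aestronglyMeasurable : AEStronglyMeasurable (Function.uncurry u)
    ((volume.restrict (Ioi (0 : ℝ))).prod volume)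
  isDecaying : ∀ t, 0 < t → IsDecaying q D ((1 + t) ^ (1 / θ)) (u t)

variable {u : ℝ → Eu n → ℝ}

lemma IsDecayingFlow.integrable (hu : IsDecayingFlow q θ D u) {t : ℝ} (ht : 0 < t) :
    Integrable (u t) := (hu.isDecaying t ht).integrable

lemma IsDecayingFlow.ae_le (hθ : 0 < θ) (hu : IsDecayingFlow q θ D u) {t : ℝ} (ht : 0 < t) :
    ∀ᵐ y, |u t y| ≤ D :=
  (hu.isDecaying t ht).ae_le_const hu.nonneg (one_le_one_add_rpow hθ ht.le)

lemma IsDecayingFlow.ae_integrable (hu : IsDecayingFlow q θ D u) :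
    ∀ᵐ s ∂(volume.restrict (Ioi (0 : ℝ))), Integrable (u s) := by
  filter_upwards [ae_restrict_mem measurableSet_Ioi] with s hs using hu.integrable hs

lemma IsDecayingFlow.norm_gradPotential_le (hn : 2 ≤ n) (hθ : 0 < θ) (hu : IsDecayingFlow q θ D u)
    {t : ℝ} (ht : 0 < t) (x : Eu n) :
    ‖gradPotential (u t) x‖ ≤ |newtonConst n| * (D * (sphereArea n + 1)) := by
  have hn' : (2 : ℝ) ≤ n := by exact_mod_cast hn
  have h1 := one_le_one_add_rpow hθ ht.le
  have := hu.nonneg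
  have := sphereArea_nonneg n
  refine ((hu.isDecaying t ht).norm_gradPotential_le hn (by linarith) x).trans ?_
  exact mul_le_of_le_one_right (by positivity)
    (Real.rpow_le_one_of_one_le_of_nonpos h1 (by linarith))

lemma IsDecayingFlow.integrable_weighted (hq : 1 < q) (hu : IsDecayingFlow q θ D u)
    {ρ : Eu n → ℝ} (hρ : IsMollifier ε ρ) {a : Eu n → ℝ} (ha : IsWeight q a) {t : ℝ} (ht : 0 < t) :
    Integrable fun x => (a x * |conv ρ (u t) x|) ^ q :=
  (ha.isTest_mul_rpow hq (isTest_conv hρ.isTest (hu.integrable ht))).integrable.congr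
    (.of_forall fun x => (Real.mul_rpow (ha.pos x).le (abs_nonneg _)).symm)

lemma IsDecayingFlow.aestronglyMeasurable_driftComm (hu : IsDecayingFlow q θ D u)
    {ρ : Eu n → ℝ} (hρ : IsTest ρ) :
    AEStronglyMeasurable (fun s => ∫ x, |driftComm ρ (u s) x|)
      (volume.restrict (Ioc 0 T)) :=
  ((aestronglyMeasurable_driftComm_prod hu.aestronglyMeasurable hu.ae_integrable
    hρ).norm.integral_prod_right').mono_measure
      (Measure.restrict_mono Ioc_subset_Ioi_self le_rfl)

/-- The bound of the weighted energy of the mollified solution. -/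
lemma energy_conv_moll_le (hn : 2 ≤ n) (hq : 1 < q) (hθ : 0 < θ) (hθ1 : θ ≤ 1)
    (hu : IsDecayingFlow q θ D u) {A B : ℝ} (hA : 0 ≤ A) (hB : 0 ≤ B)
    {a : Eu n → ℝ} {Ca : ℝ} (ha : IsWeight q a) (hε : 0 < ε) {u₀ : Eu n → ℝ}
    (hrate : ∀ t, 0 < t →
      ∫ x, energyDeriv q a (conv (moll ε hε) (u t)) x * velocity θ c (moll ε hε) (u t) x ≤
        A * ((1 + t) ^ (1 / θ)) ^ (-θ) *
          (1 + (∫ x, (a x * |conv (moll ε hε) (u t) x|) ^ q) ^ (1 - 1 / q)) +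
        B * ((1 + t) ^ (1 / θ)) ^ (-(n : ℝ)) * (1 + ∫ x, (a x * |conv (moll ε hε) (u t) x|) ^ q) +
        q * (Ca ^ q * D ^ (q - 1)) * ∫ x, |driftComm (moll ε hε) (u t) x|)
    (hCa : ∀ x, a x ≤ Ca)
    (heq : ∀ x t, 0 < t → conv (moll ε hε) (u t) x =
      conv (moll ε hε) u₀ x + ∫ s in (0 : ℝ)..t, velocity θ c (moll ε hε) (u s) x)
    (h0 : Integrable fun x => (a x * |conv (moll ε hε) u₀ x|) ^ q) (hT : 0 < T) :
    ∫ x, (a x * |conv (moll ε hε) (u T) x|) ^ q ≤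
      ((∫ x, (a x * |conv (moll ε hε) u₀ x|) ^ q) +
        (2 * A + B) * Real.log (Real.exp 1 + T) ^ q +
        ∫ s in (0 : ℝ)..T, q * (Ca ^ q * D ^ (q - 1)) *
          ∫ x, |driftComm (moll ε hε) (u s) x|) * Real.exp (A + B) := by
  set ρ : Eu n → ℝ := moll ε hε with hρ_def
  have hρ : IsMollifier ε ρ := isMollifier_moll ε hε
  have hD := hu.nonneg
  have hn' : (2 : ℝ) ≤ n := by exact_mod_cast hn
  have hq0 : 0 ≤ q := by linarith
  have hCa0 : 0 ≤ Ca := (ha.pos 0).le.trans (hCa 0)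
  -- The value `u 0` is unrelated to `u₀`. Defining `v` by the integral formula gives the right
  -- initial value at `t = 0` and agrees with the mollified solution for `t > 0`.
  set v : ℝ → Eu n → ℝ := fun t x =>
    conv ρ u₀ x + ∫ s in (0 : ℝ)..t, velocity θ c ρ (u s) x with hv
  have hv0 : v 0 = conv ρ u₀ := by ext x; simp [hv]
  have hvt : ∀ t, 0 < t → v t = conv ρ (u t) := fun t ht => funext fun x => (heq x t ht).symm
  obtain ⟨C, hC⟩ := exists_velocity_le hn hθ hθ1 hρ c
    (β := |newtonConst n| * (D * (sphereArea n + 1))) hD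
  have hC' := fun t (ht : 0 < t) => hC (u t) (hu.integrable ht) (hu.isDecaying t ht).integral_le
    (hu.ae_le hθ ht) (hu.norm_gradPotential_le hn hθ ht)
  have hvm : AEStronglyMeasurable (Function.uncurry v)
      ((volume.restrict (Ioi (0 : ℝ))).prod volume) := by
    refine (aestronglyMeasurable_conv_prod hu.aestronglyMeasurable
      hρ.isTest.contDiff.continuous.stronglyMeasurable).congr ?_
    filter_upwards [(Measure.quasiMeasurePreserving_fst (ν := (volume : Measure (Eu n)))).ae
      (ae_restrict_mem measurableSet_Ioi)] with p hp
    exact heq p.2 p.1 hp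
  set E : ℝ → ℝ := fun t => ∫ x, (a x * |v t x|) ^ q with hE
  have hEt : ∀ t, 0 < t → E t = ∫ x, (a x * |conv ρ (u t) x|) ^ q := fun t ht => by
    simp only [hE, hvt t ht]
  have hE0 : E 0 = ∫ x, (a x * |conv ρ u₀ x|) ^ q := by simp only [hE, hv0]
  have hEnn : ∀ t, 0 ≤ E t := fun t => integral_nonneg fun x => by
    have := (ha.pos x).le
    positivity
  set e : ℝ → ℝ := fun s => ∫ x, energyDeriv q a (v s) x * velocity θ c ρ (u s) x with he
  have hid : ∀ t, 0 < t → IntervalIntegrable e volume 0 t ∧ E t = E 0 + ∫ s in (0 : ℝ)..t, e s :=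
    fun t ht => by
      have := energy_eq hq ha (v := v) (G := fun s => velocity θ c ρ (u s)) (v₀ := conv ρ u₀) (Cv := D) (C := C) ht hvm
        (aestronglyMeasurable_velocity_prod (by omega) hθ hθ1 hu.aestronglyMeasurable
          hu.ae_integrable hρ) (fun t _ x => rfl)
        (fun t ht x => by rw [hvt t ht]; exact abs_conv_le hρ (hu.ae_le hθ ht) x)
        (fun t ht => (hC' t ht).2.1) (fun t ht => (hC' t ht).1) (fun t ht => (hC' t ht).2.2) h0
        (by simp only [hvt t ht]; exact hu.integrable_weighted hq hρ ha ht)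
      rwa [← hE0] at this
  set P := q * (Ca ^ q * D ^ (q - 1)) with hP
  have hP0 : 0 ≤ P := by positivity
  have hrb : ∀ s, 0 < s → ∫ x, |driftComm ρ (u s) x| ≤ commConst n * (D * (2 * D)) := fun s hs =>
    integral_abs_driftComm_moll_le hn (hu.integrable hs) hD (hu.isDecaying s hs).integral_le
      (hu.ae_le hθ hs) hε
  have hri : IntervalIntegrable (fun s => P * ∫ x, |driftComm ρ (u s) x|) volume 0 T := by
    rw [intervalIntegrable_iff_integrableOn_Ioc_of_le hT.le]
    refine Integrable.const_mul (Integrable.mono' (integrable_const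
      (commConst n * (D * (2 * D)))) (hu.aestronglyMeasurable_driftComm hρ.isTest) ?_) _
    filter_upwards [ae_restrict_mem measurableSet_Ioc] with s hs
    rw [Real.norm_of_nonneg (integral_nonneg fun _ => abs_nonneg _)]
    exact hrb s hs.1
  rw [← hE0, ← hEt T hT]
  refine le_log_rpow_of_integral_le hq hA hB hT (fun t _ => hEnn t) (hid T hT).1 hri
    (fun t _ => mul_nonneg hP0 (integral_nonneg fun _ => abs_nonneg _)) (fun t ht => ?_)
    fun s hs => ?_
  · rcases ht.1.eq_or_lt with rfl | h
    · simp
    · exact (hid t h).2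
  · have h1 := hrate s hs.1
    rw [← hEt s hs.1, ← hvt s hs.1] at h1
    refine h1.trans ?_
    have hs0 : 0 < 1 + s := by linarith [hs.1]
    have e1 : ((1 + s) ^ (1 / θ)) ^ (-θ) = (1 + s)⁻¹ := by
      rw [← Real.rpow_mul hs0.le, mul_neg, one_div_mul_cancel hθ.ne', Real.rpow_neg_one]
    -- The exponent `n/θ` is at least `2` because `n ≥ 2` and `θ ≤ 1`, so these coefficients are
    -- integrable in time.
    have e2 : ((1 + s) ^ (1 / θ)) ^ (-(n : ℝ)) ≤ ((1 + s) ^ 2)⁻¹ := by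
      rw [← Real.rpow_mul hs0.le, ← Real.rpow_natCast, ← Real.rpow_neg hs0.le]
      refine Real.rpow_le_rpow_of_exponent_le (by linarith [hs.1]) ?_
      have : 1 ≤ 1 / θ := (one_le_div hθ).2 hθ1
      push_cast
      nlinarith
    rw [e1]
    have := hEnn s
    gcongr

end energyBound

/-! ### From the decay hypothesis to the length scale. -/

section decayConstants

variable {n : ℕ} {q θ : ℝ}

/-- Only `p = 1, q, ∞` are needed. As `n(1 - 1/q) = 1`, the `L^q` norm decays exactly like the
inverse of the length `(1+t)^{1/θ}`. The sum of the absolute values of the three constants serves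
all bounds at once. -/
lemma HasDecay.exists_isDecayingFlow (hn : 2 ≤ n) (hq : 1 < q) (hθ : 0 < θ)
    (hqn : ((n : ℝ) - 1) * q = n) {u : ℝ → Eu n → ℝ} (hu : HasDecay θ u) :
    ∃ D, IsDecayingFlow q θ D u := by
  have hq0 : 0 < q := by linarith
  have hn' : (2 : ℝ) ≤ n := by exact_mod_cast hn
  obtain ⟨C1, h1⟩ := hu.decay 1 le_rfl
  obtain ⟨Cq, hCq⟩ := hu.decay (ENNReal.ofReal q) (by rw [ENNReal.one_le_ofReal]; exact hq.le)
  obtain ⟨Ci, hCi⟩ := hu.decay ∞ le_top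
  have hint : ∀ t, 0 < t → Integrable (u t) := fun t ht => memLp_one_iff_integrable.1 (hu.memLp_one t ht)
  refine ⟨|C1| + |Cq| + |Ci|, by positivity, hu.aestronglyMeasurable, fun t ht => ?_⟩
  set D := |C1| + |Cq| + |Ci| with hD
  have hD0 : 0 ≤ D := by positivity
  have ht0 : 0 < 1 + t := by linarith
  have hle1 : C1 ≤ D := (le_abs_self _).trans (by rw [hD]; linarith [abs_nonneg Cq, abs_nonneg Ci])
  have hleq : Cq ≤ D := (le_abs_self _).trans (by rw [hD]; linarith [abs_nonneg C1, abs_nonneg Ci])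
  have hlei : Ci ≤ D := (le_abs_self _).trans (by rw [hD]; linarith [abs_nonneg C1, abs_nonneg Cq])
  refine ⟨hint t ht, ?_, ?_, ?_⟩
  · have h := h1 t ht
    simp only [inv_one, ENNReal.toReal_one, sub_self, mul_zero, Real.rpow_zero, mul_one] at h
    rw [eLpNorm_one_eq_lintegral_enorm] at h
    have h2 := integral_norm_eq_lintegral_enorm (hint t ht).1
    simp only [Real.norm_eq_abs] at h2
    rw [h2]
    exact ENNReal.toReal_le_of_le_ofReal hD0 (h.trans (ENNReal.ofReal_le_ofReal hle1))
  · have h := hCq t ht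
    have e1 : -((n : ℝ) / θ) * (1 - ((ENNReal.ofReal q)⁻¹).toReal) = -(1 / θ) := by
      rw [ENNReal.toReal_inv, ENNReal.toReal_ofReal hq0.le]
      have : (n : ℝ) * (1 - q⁻¹) = 1 := by
        field_simp
        linarith
      field_simp
      linarith
    rw [e1, eLpNorm_eq_lintegral_rpow_enorm_toReal (by simpa using hq0) ENNReal.ofReal_ne_top,
      ENNReal.toReal_ofReal hq0.le] at h
    rw [integral_abs_rpow_eq_toReal hq0.le (hint t ht).1]
    refine ENNReal.toReal_le_of_le_ofReal (by positivity) ?_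
    rw [← ENNReal.ofReal_rpow_of_nonneg (by positivity) hq0.le, ← ENNReal.rpow_inv_le_iff hq0,
      ← one_div]
    refine h.trans (ENNReal.ofReal_le_ofReal ?_)
    rw [Real.rpow_neg ht0.le, ← div_eq_mul_inv]
    gcongr
  · have h := hCi t ht
    simp only [ENNReal.inv_top, ENNReal.toReal_zero, sub_zero, mul_one] at h
    rw [eLpNorm_exponent_top] at h
    filter_upwards [enorm_ae_le_eLpNormEssSup (u t) volume] with y hy
    have h2 := hy.trans h
    rw [← ofReal_norm, Real.norm_eq_abs] at h2
    have e1 : ((1 + t) ^ (1 / θ)) ^ (-(n : ℝ)) = (1 + t) ^ (-((n : ℝ) / θ)) := by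
      rw [← Real.rpow_mul ht0.le]; congr 1; ring
    rw [e1]
    exact (ENNReal.ofReal_le_ofReal_iff (by positivity)).1
      (h2.trans (ENNReal.ofReal_le_ofReal (by gcongr)))

end decayConstants

/-! ### Passage to the limit by Fatou's lemma. -/

section fatou

lemma lintegral_le_of_tendsto {α : Type*} [MeasurableSpace α] {μ : Measure α} {f : ℕ → α → ℝ≥0∞}
    {g : α → ℝ≥0∞} {b : ℕ → ℝ≥0∞} {B : ℝ≥0∞} (hf : ∀ k, AEMeasurable (f k) μ)
    (hlim : ∀ᵐ x ∂μ, Tendsto (fun k => f k x) atTop (𝓝 (g x)))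
    (hb : ∀ k, ∫⁻ x, f k x ∂μ ≤ b k) (hB : Tendsto b atTop (𝓝 B)) : ∫⁻ x, g x ∂μ ≤ B := by
  calc ∫⁻ x, g x ∂μ = ∫⁻ x, liminf (fun k => f k x) atTop ∂μ :=
        lintegral_congr_ae (hlim.mono fun x hx => hx.liminf_eq.symm)
    _ ≤ liminf (fun k => ∫⁻ x, f k x ∂μ) atTop := lintegral_liminf_le' hf
    _ ≤ liminf b atTop := liminf_le_liminf (.of_forall hb)
    _ = B := hB.liminf_eq

lemma tendsto_truncWeight {n : ℕ} {q : ℝ} (hq : 0 < q) {κ : ℕ → ℝ} (h0 : Tendsto κ atTop (𝓝 0))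
    (x : Eu n) : Tendsto (fun k => truncWeight q (κ k) x) atTop (𝓝 √(1 + ‖x‖ ^ 2)) := by
  have hY : 0 < 1 + ‖x‖ ^ 2 := by positivity
  have e : √(1 + ‖x‖ ^ 2) = ((1 + ‖x‖ ^ 2) ^ (-q / 2) + 0) ^ (-1 / q) := by
    rw [add_zero, ← Real.rpow_mul hY.le, Real.sqrt_eq_rpow]; congr 1; field_simp
  rw [e]
  exact (tendsto_const_nhds.add h0).rpow_const (Or.inl (by rw [add_zero]; positivity))

end fatou

/-! ### Bounds of the initial datum. -/

section initialData

variable {n : ℕ} {q θ c ε D : ℝ} {u₀ : Eu n → ℝ} {u : ℝ → Eu n → ℝ}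

/-- No bound on `u₀` is assumed. It is inherited from `u(t)`: the mollified solution moves by at
most `C t`, with `C` depending on the mollifier, and `t → 0` removes it. -/
lemma abs_conv_init_le (hn : 2 ≤ n) (hθ : 0 < θ) (hθ1 : θ ≤ 1) (hu : IsDecayingFlow q θ D u)
    {ρ : Eu n → ℝ} (hρ : IsMollifier ε ρ)
    (heq : ∀ x t, 0 < t → conv ρ (u t) x =
      conv ρ u₀ x + ∫ s in (0 : ℝ)..t, velocity θ c ρ (u s) x) (x : Eu n) :
    |conv ρ u₀ x| ≤ D := by
  obtain ⟨C, hC⟩ := exists_velocity_le hn hθ hθ1 hρ c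
    (β := |newtonConst n| * (D * (sphereArea n + 1))) hu.nonneg
  have hC' := fun t (ht : 0 < t) => (hC (u t) (hu.integrable ht) (hu.isDecaying t ht).integral_le
    (hu.ae_le hθ ht) (hu.norm_gradPotential_le hn hθ ht)).2.1
  have hb : ∀ t, 0 < t → |conv ρ u₀ x| ≤ D + C * t := fun t ht => by
    have h1 : |∫ s in (0 : ℝ)..t, velocity θ c ρ (u s) x| ≤ C * t := by
      rw [← Real.norm_eq_abs]
      refine (intervalIntegral.norm_integral_le_of_norm_le_const (C := C) fun s hs => ?_).trans_eq ?_
      · rw [uIoc_of_le ht.le] at hs; exact hC' s hs.1 x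
      · rw [sub_zero, abs_of_nonneg ht.le]
    have h2 := abs_conv_le hρ (hu.ae_le hθ ht) x
    rw [eq_sub_of_add_eq (heq x t ht).symm]
    exact (abs_sub _ _).trans (add_le_add h2 h1)
  have hlim : Tendsto (fun t : ℝ => D + C * t) (𝓝[>] 0) (𝓝 (D + C * 0)) :=
    ((continuous_const.add (continuous_const.mul continuous_id)).tendsto 0).mono_left
      nhdsWithin_le_nhds
  rw [mul_zero, add_zero] at hlim
  exact ge_of_tendsto hlim (by filter_upwards [self_mem_nhdsWithin] with t ht using hb t ht)

lemma sqrt_one_add_sq_le (y : Eu n) : √(1 + ‖y‖ ^ 2) ≤ 1 + ‖y‖ := by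
  rw [Real.sqrt_le_left (by positivity)]
  nlinarith [norm_nonneg y]

/-- The moment hypothesis controls `u₀` only away from the origin. In the unit ball the bound by `D`
is used; outside it, `1+|y| ≤ 2|y|`. The factor `2` anticipates the mollification. -/
lemma integrable_weighted_init (hq : 1 < q) (hu₀ : AEStronglyMeasurable u₀)
    (hM : ∀ᵐ y, |u₀ y| ≤ D) (hmom : MemLp (fun x => u₀ x • x) (ENNReal.ofReal q) volume) :
    Integrable fun y => |2 * √(1 + ‖y‖ ^ 2) * u₀ y| ^ q := by
  have hq0 : 0 < q := by linarith
  have hind : MemLp ((ball (0 : Eu n) 1).indicator fun _ => 4 * D) (ENNReal.ofReal q) volume :=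
    memLp_indicator_const _ measurableSet_ball _ (Or.inr measure_ball_lt_top.ne)
  have hm : AEStronglyMeasurable (fun y => 2 * √(1 + ‖y‖ ^ 2) * u₀ y) (volume : Measure (Eu n)) :=
    (Continuous.aestronglyMeasurable (by fun_prop)).mul hu₀
  have hf : MemLp (fun y => 2 * √(1 + ‖y‖ ^ 2) * u₀ y) (ENNReal.ofReal q) volume := by
    refine ((hmom.norm.const_mul 4).add hind).mono' hm ?_
    filter_upwards [hM] with y hy
    have h1 := sqrt_one_add_sq_le y
    have h0 := abs_nonneg (u₀ y)
    rw [norm_mul, Real.norm_of_nonneg (by positivity), Real.norm_eq_abs]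
    simp only [Pi.add_apply, norm_smul, Real.norm_eq_abs]
    by_cases hy1 : y ∈ ball (0 : Eu n) 1
    · rw [indicator_of_mem hy1]
      have : ‖y‖ < 1 := by simpa using hy1
      have h3 : 0 ≤ |u₀ y| * ‖y‖ := by positivity
      nlinarith
    · rw [indicator_of_notMem hy1]
      have : 1 ≤ ‖y‖ := by simpa using hy1
      nlinarith
  have := hf.integrable_norm_rpow (by simpa using hq0) ENNReal.ofReal_ne_top
  simpa only [ENNReal.toReal_ofReal hq0.le, Real.norm_eq_abs] using this

/-- Within distance `ε ≤ 1` the weight at `x` is at most `√(1+|y|²) + 1 ≤ 2√(1+|y|²)`, so it passes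
under the convolution; Young with unit mass finishes, uniformly in `ε` and `κ`. -/
lemma weighted_conv_init (hq1 : 1 < q) (hq2 : q ≤ 2) {κ : ℝ} (hκ : 0 < κ) (hε1 : ε ≤ 1)
    {ρ : Eu n → ℝ} (hρ : IsMollifier ε ρ) (hu₀ : AEStronglyMeasurable u₀)
    (hi : Integrable fun y => |2 * √(1 + ‖y‖ ^ 2) * u₀ y| ^ q) :
    Integrable (fun x => (truncWeight q κ x * |conv ρ u₀ x|) ^ q) ∧
    ∫ x, (truncWeight q κ x * |conv ρ u₀ x|) ^ q ≤ ∫ y, |2 * √(1 + ‖y‖ ^ 2) * u₀ y| ^ q := by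
  have hq0 : 0 < q := by linarith
  have ha := isWeight_truncWeight (n := n) hq1 hq2 hκ
  have hm : AEStronglyMeasurable (fun y => 2 * √(1 + ‖y‖ ^ 2) * u₀ y) (volume : Measure (Eu n)) :=
    (Continuous.aestronglyMeasurable (by fun_prop)).mul hu₀
  have hcm : AEStronglyMeasurable (conv ρ u₀) := by
    have : AEStronglyMeasurable (fun p : Eu n × Eu n => u₀ p.2 • ρ (p.1 - p.2))
        (volume.prod volume) := hu₀.comp_snd.smul
      (hρ.contDiff.continuous.comp (by fun_prop)).aestronglyMeasurable
    exact this.integral_prod_right'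
  have hwm : AEStronglyMeasurable fun x => truncWeight q κ x * conv ρ u₀ x :=
    ha.continuous.aestronglyMeasurable.mul hcm
  have hpt : ∀ x, ‖truncWeight q κ x * conv ρ u₀ x‖ₑ ≤
      ∫⁻ y, ‖ρ (x - y)‖ₑ * ‖2 * √(1 + ‖y‖ ^ 2) * u₀ y‖ₑ := fun x => by
    rw [enorm_mul]
    refine (mul_le_mul_right (enorm_conv_le ρ u₀ x) _).trans ?_
    rw [← lintegral_const_mul' _ _ enorm_ne_top]
    refine lintegral_mono fun y => ?_
    rw [mul_left_comm, enorm_mul _ (u₀ y)]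
    by_cases hxy : ε < ‖x - y‖
    · simp [hρ.eq_zero _ hxy]
    · gcongr
      rw [← ofReal_norm, ← ofReal_norm, Real.norm_of_nonneg (ha.pos x).le,
        Real.norm_of_nonneg (by positivity)]
      refine ENNReal.ofReal_le_ofReal ?_
      have h1 := truncWeight_le hq0 hκ.le x
      have h2 := sqrt_one_add_sq_sub_le x y
      have h3 : 1 ≤ √(1 + ‖y‖ ^ 2) := Real.one_le_sqrt.2 (by nlinarith [norm_nonneg y])
      linarith [not_lt.1 hxy]
  have hL : ∫⁻ x, ‖truncWeight q κ x * conv ρ u₀ x‖ₑ ^ q ≤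
      ∫⁻ y, ‖2 * √(1 + ‖y‖ ^ 2) * u₀ y‖ₑ ^ q :=
    (lintegral_mono fun x => ENNReal.rpow_le_rpow (hpt x) hq0.le).trans
      (lintegral_enorm_conv_rpow_le hq1 hρ hm)
  have htop := lintegral_enorm_rpow_ne_top hq0.le hi
  have hcongr : ∀ x, |truncWeight q κ x * conv ρ u₀ x| ^ q =
      (truncWeight q κ x * |conv ρ u₀ x|) ^ q := fun x => by
    rw [abs_mul, abs_of_nonneg (ha.pos x).le]
  simp_rw [← hcongr]
  refine ⟨⟨((continuous_abs.comp_aestronglyMeasurable hwm).aemeasurable.pow_const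
    q).aestronglyMeasurable, ?_⟩, ?_⟩
  · rw [hasFiniteIntegral_iff_enorm]
    refine (lintegral_congr fun x => ?_).trans_lt (hL.trans_lt htop.lt_top)
    rw [Real.enorm_of_nonneg (Real.rpow_nonneg (abs_nonneg _) q),
      ← ENNReal.ofReal_rpow_of_nonneg (abs_nonneg _) hq0.le, ← Real.norm_eq_abs, ofReal_norm]
  · rw [integral_abs_rpow_eq_toReal hq0.le hwm, integral_abs_rpow_eq_toReal hq0.le hm]
    exact ENNReal.toReal_mono htop hL

end initialData

/-! ### Removal of the mollifier and of the truncation. -/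

section moments

variable {n : ℕ} {q θ D T : ℝ} {u₀ : Eu n → ℝ} {u : ℝ → Eu n → ℝ}

/-- Dominated convergence in time: the commutator tends to zero in `L¹` at each positive time and is
bounded uniformly in time and radius. -/
lemma tendsto_integral_driftComm (hn : 2 ≤ n) (hθ : 0 < θ) (hu : IsDecayingFlow q θ D u)
    (hT : 0 < T) {ε : ℕ → ℝ} (hε : ∀ k, 0 < ε k) (h0 : Tendsto ε atTop (𝓝 0)) (P : ℝ) :
    Tendsto (fun k => ∫ s in (0 : ℝ)..T, P * ∫ x, |driftComm (moll (ε k) (hε k)) (u s) x|) atTop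
      (𝓝 0) := by
  have hlim := intervalIntegral.tendsto_integral_filter_of_dominated_convergence
    (μ := (volume : Measure ℝ)) (a := 0) (b := T) (l := atTop)
    (F := fun k s => P * ∫ x, |driftComm (moll (ε k) (hε k)) (u s) x|) (f := fun _ => 0)
    (fun _ => |P| * (commConst n * (D * (2 * D)))) (.of_forall fun k => ?_)
    (.of_forall fun k => .of_forall fun s hs => ?_) intervalIntegrable_const
    (.of_forall fun s hs => ?_)
  · simpa using hlim
  · rw [uIoc_of_le hT.le]
    exact (hu.aestronglyMeasurable_driftComm (isMollifier_moll _ (hε k)).isTest).const_mul P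
  · rw [uIoc_of_le hT.le] at hs
    rw [norm_mul, Real.norm_eq_abs, Real.norm_of_nonneg (integral_nonneg fun _ => abs_nonneg _)]
    gcongr
    exact integral_abs_driftComm_moll_le hn (hu.integrable hs.1) hu.nonneg
      (hu.isDecaying s hs.1).integral_le (hu.ae_le hθ hs.1) (hε k)
  · rw [uIoc_of_le hT.le] at hs
    have h1 := tendsto_lintegral_enorm_driftComm_moll hn (hu.integrable hs.1) (hu.ae_le hθ hs.1)
      hε h0
    have h2 := (ENNReal.tendsto_toReal ENNReal.zero_ne_top).comp h1
    have h3 : Tendsto (fun k => ∫ x, |driftComm (moll (ε k) (hε k)) (u s) x|) atTop (𝓝 0) := by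
      refine h2.congr fun k => ?_
      exact (integral_norm_eq_lintegral_enorm (integrable_driftComm hn (hu.integrable hs.1)
        (hu.ae_le hθ hs.1) (isMollifier_moll _ (hε k)).isTest).1).symm
    simpa using h3.const_mul P

lemma tendsto_weighted_rpow (hq : 0 < q) {a v : ℕ → ℝ} {A V : ℝ} (ha : Tendsto a atTop (𝓝 A))
    (hv : Tendsto v atTop (𝓝 V)) :
    Tendsto (fun k => ENNReal.ofReal ((a k * |v k|) ^ q)) atTop
      (𝓝 (ENNReal.ofReal ((A * |V|) ^ q))) :=
  ENNReal.tendsto_ofReal ((ha.mul hv.abs).rpow_const (Or.inr hq.le))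

/-- Logarithmic growth of the weighted moment. -/
lemma exists_lintegral_weighted_le (hn : 2 ≤ n) (hq1 : 1 < q) (hq2 : q ≤ 2) (hθ : 0 < θ)
    (hθ1 : θ ≤ 1) (hqn : ((n : ℝ) - 1) * q = n) (hsol : IsWeakSolution θ u₀ u)
    (hu : IsDecayingFlow q θ D u)
    (hmom : MemLp (fun x => u₀ x • x) (ENNReal.ofReal q) volume) :
    ∃ K, 0 ≤ K ∧ ∀ T, 0 < T → ∫⁻ x, ENNReal.ofReal ((√(1 + ‖x‖ ^ 2) * |u T x|) ^ q) ≤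
      ENNReal.ofReal (K * Real.log (Real.exp 1 + T) ^ q) := by
  have hq0 : 0 < q := by linarith
  have hD := hu.nonneg
  obtain ⟨c, hc, heq⟩ := exists_conv_eq_add_integral_velocity (n := n) (by omega) hθ hθ1
  replace heq := heq u₀ u hsol fun t ht => hu.integrable ht
  obtain ⟨A, B, hA, hB, hrate⟩ := exists_energy_rate_le hn hq1 hq2 hθ hθ1 hqn hc hD
  set ε : ℕ → ℝ := fun k => 1 / ((k : ℝ) + 1) with hε_def
  have hε : ∀ k, 0 < ε k := fun k => by simp only [hε_def]; positivity
  have hε1 : ∀ k, ε k ≤ 1 := fun k => by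
    simp only [hε_def]
    rw [div_le_one (by positivity)]
    linarith [(Nat.cast_nonneg k : (0 : ℝ) ≤ k)]
  have hε0 : Tendsto ε atTop (𝓝 0) := tendsto_one_div_add_atTop_nhds_zero_nat
  have hu₀m : AEStronglyMeasurable u₀ := hsol.locallyIntegrable_init.aestronglyMeasurable
  have hM : ∀ᵐ y, |u₀ y| ≤ D := by
    filter_upwards [tendsto_conv_moll hsol.locallyIntegrable_init hε hε0] with y hy
    exact le_of_tendsto hy.abs (.of_forall fun k => abs_conv_init_le hn hθ hθ1 hu
      (isMollifier_moll _ (hε k)) (heq _ _ (isMollifier_moll _ (hε k))) y)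
  have hi := integrable_weighted_init hq1 hu₀m hM hmom
  set K₀ := ∫ y, |2 * √(1 + ‖y‖ ^ 2) * u₀ y| ^ q with hK₀
  have hK₀0 : 0 ≤ K₀ := integral_nonneg fun y => by positivity
  -- The initial energy `K₀` is absorbed in the logarithm, which is at least `1`.
  refine ⟨(K₀ + (2 * A + B)) * Real.exp (A + B), by positivity, fun T hT => ?_⟩
  set L := Real.log (Real.exp 1 + T) with hL
  have hL1 : 1 ≤ L := one_le_log_exp_add hT.le
  have hLq : 1 ≤ L ^ q := Real.one_le_rpow hL1 hq0.le
  have huT := hu.integrable hT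
  -- The order of limits matters: the commutator is multiplied by `Ca ^ q`, where `Ca` bounds the
  -- truncated weight and depends on `κ`. So the mollifier is removed first, with `κ` fixed, and the
  -- bound left is free of `κ`.
  have htrunc : ∀ κ : ℝ, 0 < κ → ∫⁻ x, ENNReal.ofReal ((truncWeight q κ x * |u T x|) ^ q) ≤
      ENNReal.ofReal ((K₀ + (2 * A + B) * L ^ q) * Real.exp (A + B)) := fun κ hκ => by
    have ha := isWeight_truncWeight (n := n) hq1 hq2 hκ
    obtain ⟨Ca, hCa⟩ := ha.bounded
    have hI := tendsto_integral_driftComm hn hθ hu hT hε hε0 (q * (Ca ^ q * D ^ (q - 1)))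
    have hb := ENNReal.tendsto_ofReal
      ((hI.const_add (K₀ + (2 * A + B) * L ^ q)).mul_const (Real.exp (A + B)))
    rw [add_zero] at hb
    refine lintegral_le_of_tendsto
      (f := fun k x => ENNReal.ofReal ((truncWeight q κ x * |conv (moll (ε k) (hε k)) (u T) x|) ^ q))
      (fun k => ?_) ?_ (fun k => ?_) hb
    · have hc := (isTest_conv (isMollifier_moll _ (hε k)).isTest huT).contDiff.continuous
      exact ((ha.continuous.mul hc.abs).measurable.pow_const q).ennreal_ofReal.aemeasurable
    · filter_upwards [tendsto_conv_moll huT.locallyIntegrable hε hε0] with x hx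
      exact tendsto_weighted_rpow hq0 tendsto_const_nhds hx
    · have hρ := isMollifier_moll (n := n) _ (hε k)
      obtain ⟨h1, h2⟩ := weighted_conv_init hq1 hq2 hκ (hε1 k) hρ hu₀m hi
      rw [← ofReal_integral_eq_lintegral_ofReal (hu.integrable_weighted hq1 hρ ha hT)
        (.of_forall fun x => by have := (ha.pos x).le; positivity)]
      refine ENNReal.ofReal_le_ofReal ((energy_conv_moll_le hn hq1 hθ hθ1 hu hA hB ha (hε k)
        (fun t ht => hrate (u t) _ (one_le_one_add_rpow hθ ht.le) (hu.isDecaying t ht) _ _ hρ _ Ca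
          ha hCa) hCa (heq _ _ hρ) h1 hT).trans ?_)
      gcongr
  -- Now `κ` runs through the same null sequence `ε k`, and the weights tend to `√(1+|x|²)`.
  have hlim := lintegral_le_of_tendsto
    (f := fun k x => ENNReal.ofReal ((truncWeight q (ε k) x * |u T x|) ^ q))
    (fun k => ((((isWeight_truncWeight hq1 hq2 (hε k)).continuous.aestronglyMeasurable.mul
      (continuous_abs.comp_aestronglyMeasurable huT.1)).aemeasurable.pow_const q).ennreal_ofReal))
    (.of_forall fun x => tendsto_weighted_rpow hq0 (tendsto_truncWeight hq0 hε0 x)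
      tendsto_const_nhds) (fun k => htrunc _ (hε k)) tendsto_const_nhds
  refine hlim.trans (ENNReal.ofReal_le_ofReal ?_)
  rw [mul_right_comm]
  gcongr
  nlinarith

end moments

end DriftDiffusion

theorem proposition2p3 (n : ℕ) (hn : 2 ≤ n) (θ : ℝ) (hθ : 0 < θ) (hθ1 : θ ≤ 1)
    (u₀ : EuclideanSpace ℝ (Fin n) → ℝ) (u : ℝ → EuclideanSpace ℝ (Fin n) → ℝ)
    (hsol : DriftDiffusion.IsWeakSolution θ u₀ u)
    (hdecay : DriftDiffusion.HasDecay θ u)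
    (hmom : MemLp (fun x => u₀ x • x) (ENNReal.ofReal ((n : ℝ) / ((n : ℝ) - 1))) volume) :
    ∃ C : ℝ, ∀ j : Fin n, ∀ t : ℝ, 0 < t →
      eLpNorm (fun x : EuclideanSpace ℝ (Fin n) => x j * u t x)
          (ENNReal.ofReal ((n : ℝ) / ((n : ℝ) - 1))) volume ≤
        ENNReal.ofReal (C * Real.log (Real.exp 1 + t)) := by
  have hn' : (2 : ℝ) ≤ n := by exact_mod_cast hn
  have hn1 : (0 : ℝ) < (n : ℝ) - 1 := by linarith
  set q : ℝ := (n : ℝ) / ((n : ℝ) - 1) with hq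
  have hq1 : 1 < q := by rw [hq, one_lt_div hn1]; linarith
  have hq2 : q ≤ 2 := by rw [hq, div_le_iff₀ hn1]; linarith
  have hqn : ((n : ℝ) - 1) * q = n := by rw [hq, mul_div_cancel₀ _ hn1.ne']
  have hq0 : 0 < q := by linarith
  obtain ⟨D, hD⟩ := hdecay.exists_isDecayingFlow hn hq1 hθ hqn
  obtain ⟨K, hK, h⟩ :=
    DriftDiffusion.exists_lintegral_weighted_le hn hq1 hq2 hθ hθ1 hqn hsol hD hmom
  -- The `q`-th root of the bound `K log^q`; each coordinate is dominated by `√(1+|x|²)`.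
  refine ⟨K ^ (1 / q), fun j t ht => ?_⟩
  have hL : 0 ≤ Real.log (Real.exp 1 + t) :=
    zero_le_one.trans (DriftDiffusion.one_le_log_exp_add ht.le)
  have hpt : ∀ x : EuclideanSpace ℝ (Fin n), ‖x j * u t x‖ₑ ^ q ≤
      ENNReal.ofReal ((√(1 + ‖x‖ ^ 2) * |u t x|) ^ q) := fun x => by
    rw [← ENNReal.ofReal_rpow_of_nonneg (by positivity) hq0.le, ← ofReal_norm, norm_mul,
      Real.norm_eq_abs (u t x)]
    gcongr
    refine (PiLp.norm_apply_le x j).trans (Real.le_sqrt_of_sq_le ?_)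
    linarith
  rw [eLpNorm_eq_lintegral_rpow_enorm_toReal (by simpa using hq0) ENNReal.ofReal_ne_top,
    ENNReal.toReal_ofReal hq0.le]
  refine (ENNReal.rpow_le_rpow ((MeasureTheory.lintegral_mono hpt).trans (h t ht))
    (by positivity)).trans_eq ?_
  rw [ENNReal.ofReal_rpow_of_nonneg (by positivity) (by positivity),
    Real.mul_rpow hK (by positivity), ← Real.rpow_mul hL, mul_one_div_cancel hq0.ne', Real.rpow_one]
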